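/- There is an absolute constant $C>0$ with the following property. Let $V_-<V_+$ be real numbers, let $V_0(x)=V_-$ for $x<0$ and $V_0(x)=V_+$ for $x>0$, and let $f\in L^1(\mathbb{R})$ be complex valued. Then every solution $u$ of $$i u_t-u_{xx}+V_0(x)u=0,\qquad u(0,x)=f(x),\qquad (t,x)\in\mathbb{R}\times\mathbb{R},$$ satisfies the dispersive estimate $$|u(t,x)|\le C\,\|f\|_{L^1(\mathbb{R})}\,|t|^{-1/2}\qquad\text{for every } t\neq 0 \text{ and almost every } x\in\mathbb{R};$$ in particular $C$ does not depend on $V_\pm$, $f$, $u$, $t$ or $x$. Here solutions are understood as follows. If $f\in L^1\cap L^2$, a solution is a function $u\in C(\mathbb{R};L^2(\mathbb{R}))$ with $u(0)=f$ such that, for every $\varphi\in C_c^\infty(\mathbb{R};\mathbb{C})$, the function $t\mapsto\int u(t,x)\varphi(x)\,dx$ is differentiable on $\mathbb{R}$ and $$i\frac{d}{dt}\int u\,\varphi\,dx-\int u\,\varphi''\,dx+\int V_0\,u\,\varphi\,dx=0$$ for all $t$. For general $f\in L^1$, a solution is a family of locally integrable functions $u(t,\cdot)$, $t\in\mathbb{R}$,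 for which there are solutions $w_n\in C(\mathbb{R};L^2(\mathbb{R}))$ in the preceding sense, with $w_n(0)\in L^1\cap L^2$ and $w_n(0)\to f$ in $L^1$, such that $w_n(t)\to u(t)$ in the sense of distributions for every $t\in\mathbb{R}$. -/

import Mathlib

open MeasureTheory Filter Topology
open scoped ContDiff ENNReal

/-- The step potential `V₀`, equal to `Vm` on the negative and to `Vp` on the positive half line
(the value at the origin is immaterial). -/
noncomputable def stepPotential (Vm Vp : ℝ) (x : ℝ) : ℝ :=
  if x < 0 then Vm else Vp

/-- Test functions on the line: smooth, complex valued, compactly supported. -/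
def IsTestFunction (φ : ℝ → ℂ) : Prop :=
  ContDiff ℝ ∞ φ ∧ HasCompactSupport φ

/-- `u ∈ C(ℝ; L²(ℝ))` is a weak solution of `i u_t - u_xx + V₀ u = 0`: for every test function
`φ`, the function `t ↦ ∫ u(t) φ` is differentiable and
`i d/dt ∫ u(t) φ - ∫ u(t) φ'' + ∫ V₀ u(t) φ = 0` at every time. -/
structure IsL2Solution (Vm Vp : ℝ) (u : ℝ → Lp ℂ 2 (volume : Measure ℝ)) : Prop where
  continuous : Continuous u
  differentiable : ∀ φ : ℝ → ℂ, IsTestFunction φ →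
    Differentiable ℝ (fun t : ℝ => ∫ x : ℝ, u t x * φ x)
  equation : ∀ φ : ℝ → ℂ, IsTestFunction φ → ∀ t : ℝ,
    Complex.I * deriv (fun s : ℝ => ∫ x : ℝ, u s x * φ x) t
      - (∫ x : ℝ, u t x * deriv (deriv φ) x)
      + (∫ x : ℝ, (stepPotential Vm Vp x : ℂ) * u t x * φ x) = 0

/-- Solutions of `i u_t - u_xx + V₀ u = 0`, `u(0) = f`, for data `f ∈ L¹(ℝ)` that need not be
square integrable. They are the limits, at each time in the sense of distributions, of
`L²` solutions `w n` whose initial data lie in `L¹ ∩ L²` and converge to `f` in `L¹`. -/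
structure IsL1Solution (Vm Vp : ℝ) (f : ℝ → ℂ) (u : ℝ → ℝ → ℂ) : Prop where
  locallyIntegrable : ∀ t : ℝ, LocallyIntegrable (u t) volume
  approximation : ∃ w : ℕ → ℝ → Lp ℂ 2 (volume : Measure ℝ),
    (∀ n, IsL2Solution Vm Vp (w n)) ∧
    (∀ n, Integrable (w n 0 : ℝ → ℂ) volume) ∧
    Tendsto (fun n => ∫ x : ℝ, ‖w n 0 x - f x‖) atTop (𝓝 0) ∧
    ∀ t : ℝ, ∀ φ : ℝ → ℂ, IsTestFunction φ →
      Tendsto (fun n => ∫ x : ℝ, w n t x * φ x) atTop (𝓝 (∫ x : ℝ, u t x * φ x))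

/-! Write q² = V₊ − V₋ and ℓ(z) = √(z² − q²), the branch with Im ℓ ≥ 0 on the closed upper half
plane: a wave of momentum z in front of the step has momentum ℓ behind it. For a source on the left
the transmitted amplitude is 2z/(z + ℓ) and the reflected one is 2z/(z + ℓ) − 1. For a source on the
right the same amplitudes appear after the substitution ℓ dℓ = z dz. So the propagator consists of
free Gaussians and of the single integral T(X, Y) = ∫ e^{−τz²} z/(z + ℓ) e^{i(zX + ℓY)} dz with X, Y
≥ 0.

The dispersive bound is a bound for T on the real axis. There z/(z + ℓ) = z(z − ℓ)/q² is built from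
monotone factors with values in [0, 1], which cost only absolute constants. The phase obeys van der
Corput estimates uniform in q, X, Y (`oscBound_transmission_phase`), so |T| ≤ 576 |Im τ|^{−1/2}
(`norm_transmission_le`).

Solutions are only weak, so they are reached by duality. For fixed t, ε > 0 and y ≠ 0, take the
kernel G(s, x) with source y in complex time τ = ε + i(s − t). The Gaussian damping makes every
integral absolutely convergent, and moving the contour off the real axis makes G decay exponentially
in x. G solves the equation adjoint for the bilinear pairing. It is C¹ across the step, with a jump
only in its second x-derivative, and it can still be used as a test function
(`IsL2Solution.hasDerivAt_pairing`). Hence ∫ u(s) G(s) dx does not depend on s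
(`IsL2Solution.pairing_conserved`).

At s = 0 the pairing is at most ‖u(0)‖₁ sup |G(0)|, which is O(‖u(0)‖₁ |t|^{−1/2}). At s = t, G is a
heat kernel centred at y up to an error O(ε^{−1/2} e^{−(|x|+|y|)/√ε}), seen by raising the contour
to height 1/√ε (`exists_kernel`). Averaging over y against a bump supported away from 0 and letting
ε → 0 bounds u(t) tested against that bump. Lebesgue differentiation then gives the almost
everywhere bound, and data in L¹ follow by passing to the limit in the tested inequality. -/

/-! ### Oscillatory integrals on intervals: monotone amplitudes and van der Corput tests. -/

/-- All integrals of `F` over compact subintervals of `S` are bounded by `J`. -/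
def OscBound (F : ℝ → ℂ) (S : Set ℝ) (J : ℝ) : Prop :=
  ContinuousOn F S ∧ ∀ c ∈ S, ∀ d ∈ S, c ≤ d → ‖∫ x in c..d, F x‖ ≤ J

theorem OscBound.mono {F : ℝ → ℂ} {S : Set ℝ} {J K : ℝ} (h : OscBound F S J) (hJK : J ≤ K) :
    OscBound F S K :=
  ⟨h.1, fun c hc d hd hcd => (h.2 c hc d hd hcd).trans hJK⟩

theorem OscBound.add {F G : ℝ → ℂ} {S : Set ℝ} [S.OrdConnected] {J K : ℝ} (hF : OscBound F S J)
    (hG : OscBound G S K) : OscBound (fun x => F x + G x) S (J + K) := by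
  refine ⟨hF.1.add hG.1, fun c hc d hd hcd => ?_⟩
  have hsub : Set.uIcc c d ⊆ S := by
    rw [Set.uIcc_of_le hcd]; exact Set.OrdConnected.out ‹_› hc hd
  rw [intervalIntegral.integral_add (hF.1.mono hsub).intervalIntegrable
    (hG.1.mono hsub).intervalIntegrable]
  exact (norm_add_le _ _).trans (add_le_add (hF.2 c hc d hd hcd) (hG.2 c hc d hd hcd))

theorem OscBound.const_mul {F : ℝ → ℂ} {S : Set ℝ} {J : ℝ} (hF : OscBound F S J) (z : ℂ) :
    OscBound (fun x => z * F x) S (‖z‖ * J) := by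
  refine ⟨continuousOn_const.mul hF.1, fun c hc d hd hcd => ?_⟩
  rw [intervalIntegral.integral_const_mul, norm_mul]
  exact mul_le_mul_of_nonneg_left (hF.2 c hc d hd hcd) (norm_nonneg _)

theorem OscBound.congr {F G : ℝ → ℂ} {S : Set ℝ} [S.OrdConnected] {J : ℝ} (hF : OscBound F S J)
    (h : ∀ x ∈ S, G x = F x) : OscBound G S J := by
  refine ⟨hF.1.congr h, fun c hc d hd hcd => ?_⟩
  rw [intervalIntegral.integral_congr (g := F)]
  · exact hF.2 c hc d hd hcd
  · intro x hx
    rw [Set.uIcc_of_le hcd] at hx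
    exact h x (Set.OrdConnected.out ‹_› hc hd hx)

/-- Multiplication by a monotone amplitude with values in `[0, 1]` preserves oscillatory bounds. -/
theorem OscBound.mul_monotone {F : ℝ → ℂ} {S : Set ℝ} [S.OrdConnected] {J : ℝ}
    (hF : OscBound F S J) {a a' : ℝ → ℝ} (ha : ∀ x ∈ S, HasDerivAt a (a' x) x)
    (ha' : ContinuousOn a' S) (h0 : ∀ x ∈ S, 0 ≤ a x) (h1 : ∀ x ∈ S, a x ≤ 1)
    (hmono : (∀ x ∈ S, 0 ≤ a' x) ∨ (∀ x ∈ S, a' x ≤ 0)) :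
    OscBound (fun x => (a x : ℂ) * F x) S (2 * J) := by
  have hac : ContinuousOn a S := fun x hx => (ha x hx).continuousAt.continuousWithinAt
  refine ⟨(Complex.continuous_ofReal.comp_continuousOn hac).mul hF.1, fun c hc d hd hcd => ?_⟩
  have hJ : 0 ≤ J := (norm_nonneg _).trans (hF.2 c hc d hd hcd)
  have hsub : Set.Icc c d ⊆ S := Set.OrdConnected.out ‹_› hc hd
  have hu : Set.uIcc c d = Set.Icc c d := Set.uIcc_of_le hcd
  set I : ℝ → ℂ := fun x => ∫ t in c..x, F t with hI
  have hFi : IntervalIntegrable F volume c d := (hF.1.mono (hu ▸ hsub)).intervalIntegrable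
  have hIc : ContinuousOn I (Set.uIcc c d) := by
    refine intervalIntegral.continuousOn_primitive_interval ?_
    rw [hu]; exact (hF.1.mono hsub).integrableOn_Icc
  have hint : IntervalIntegrable a' volume c d := (ha'.mono (hu ▸ hsub)).intervalIntegrable
  -- Integrating by parts against the primitive of F that vanishes at c leaves a(d)J plus the
  -- variation |a(d) − a(c)| J. Monotonicity and 0 ≤ a ≤ 1 make the sum at most 2J.
  have key : ∫ x in c..d, (a x : ℂ) * F x
      = (a d : ℂ) * I d - (a c : ℂ) * I c - ∫ x in c..d, (a' x : ℂ) * I x := by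
    refine intervalIntegral.integral_mul_deriv_eq_deriv_mul_of_hasDerivAt
      (Complex.continuous_ofReal.comp_continuousOn (hac.mono (hu ▸ hsub))) hIc ?_ ?_
      ?_ hFi
    · intro x hx
      rw [min_eq_left hcd, max_eq_right hcd] at hx
      exact (ha x (hsub ⟨hx.1.le, hx.2.le⟩)).ofReal_comp
    · intro x hx
      rw [min_eq_left hcd, max_eq_right hcd] at hx
      have hn : Set.Icc c d ∈ 𝓝 x := Icc_mem_nhds hx.1 hx.2
      refine intervalIntegral.integral_hasDerivAt_right
        ((hF.1.mono ?_).intervalIntegrable) ?_ ((hF.1.mono hsub).continuousAt hn)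
      · rw [Set.uIcc_of_le hx.1.le]
        exact (Set.Icc_subset_Icc_right hx.2.le).trans hsub
      · exact ((hF.1.mono (Set.Ioo_subset_Icc_self.trans hsub)).stronglyMeasurableAtFilter
          isOpen_Ioo x hx)
    · exact (Complex.continuous_ofReal.comp_continuousOn (ha'.mono (hu ▸ hsub))).intervalIntegrable
  have hIb : ∀ x ∈ Set.Icc c d, ‖I x‖ ≤ J := fun x hx => hF.2 c hc x (hsub hx) hx.1
  have hIc0 : I c = 0 := by simp [hI]
  have hftc : ∫ x in c..d, a' x = a d - a c :=
    intervalIntegral.integral_eq_sub_of_hasDerivAt (fun x hx => ha x (hsub (hu ▸ hx))) hint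
  have hvar : ‖∫ x in c..d, (a' x : ℂ) * I x‖ ≤ (∫ x in c..d, |a' x|) * J := by
    rw [← intervalIntegral.integral_mul_const]
    refine intervalIntegral.norm_integral_le_of_norm_le hcd ?_ (hint.norm.mul_const J)
    refine Eventually.of_forall fun x hx => ?_
    rw [norm_mul, Complex.norm_real]
    exact mul_le_mul_of_nonneg_left (hIb x ⟨hx.1.le, hx.2⟩) (norm_nonneg _)
  have had : ‖(a d : ℂ) * I d‖ ≤ a d * J := by
    rw [norm_mul, Complex.norm_real, Real.norm_eq_abs, abs_of_nonneg (h0 d hd)]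
    exact mul_le_mul_of_nonneg_left (hIb d ⟨hcd, le_rfl⟩) (h0 d hd)
  rw [key, hIc0, mul_zero, sub_zero]
  refine (norm_sub_le _ _).trans ((add_le_add had hvar).trans ?_)
  have hac0 := h0 c hc
  have hac1 := h1 c hc
  have had0 := h0 d hd
  have had1 := h1 d hd
  rcases hmono with h | h
  · have : ∫ x in c..d, |a' x| = a d - a c := by
      rw [← hftc]
      exact intervalIntegral.integral_congr fun x hx => abs_of_nonneg (h x (hsub (hu ▸ hx)))
    rw [this]; nlinarith
  · have : ∫ x in c..d, |a' x| = -(a d - a c) := by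
      rw [← hftc, ← intervalIntegral.integral_neg]
      exact intervalIntegral.integral_congr fun x hx => abs_of_nonpos (h x (hsub (hu ▸ hx)))
    rw [this]; nlinarith

/-- First derivative test for oscillatory integrals. -/
theorem norm_integral_cexp_le_of_deriv_ge {φ φ' φ'' B B' : ℝ → ℝ} {c d μ : ℝ} (hcd : c ≤ d)
    (hμ : 0 < μ) (hφ : ∀ x ∈ Set.Icc c d, HasDerivAt φ (φ' x) x)
    (hφ' : ∀ x ∈ Set.Icc c d, HasDerivAt φ' (φ'' x) x) (hφ'' : ContinuousOn φ'' (Set.Icc c d))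
    (hge : ∀ x ∈ Set.Icc c d, μ ≤ φ' x) (hB : ∀ x ∈ Set.Icc c d, HasDerivAt B (B' x) x)
    (hB' : ContinuousOn B' (Set.Icc c d))
    (hle : ∀ x ∈ Set.Icc c d, |φ'' x| / (φ' x) ^ 2 ≤ B' x) :
    ‖∫ x in c..d, Complex.exp (Complex.I * φ x)‖ ≤ 2 / μ + (B d - B c) := by
  have hu : Set.uIcc c d = Set.Icc c d := Set.uIcc_of_le hcd
  have hpos : ∀ x ∈ Set.Icc c d, 0 < φ' x := fun x hx => hμ.trans_le (hge x hx)
  have hcφ : ContinuousOn φ (Set.Icc c d) :=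
    fun x hx => (hφ x hx).continuousAt.continuousWithinAt
  have hcφ' : ContinuousOn φ' (Set.Icc c d) :=
    fun x hx => (hφ' x hx).continuousAt.continuousWithinAt
  have hBint : IntervalIntegrable B' volume c d := (hu ▸ hB').intervalIntegrable
  set w : ℝ → ℝ := fun x => -φ'' x / (φ' x) ^ 2 with hw
  have hwc : ContinuousOn w (Set.Icc c d) :=
    hφ''.neg.div (hcφ'.pow 2) fun x hx => (pow_pos (hpos x hx) 2).ne'
  have hinv : ∀ x ∈ Set.Icc c d, HasDerivAt (fun y => (φ' y)⁻¹) (w x) x :=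
    fun x hx => (hφ' x hx).inv (hpos x hx).ne'
  set E : ℝ → ℂ := fun x => Complex.exp (Complex.I * φ x) with hE
  have hEn : ∀ x, ‖E x‖ = 1 := fun x => by
    simp only [hE]; rw [mul_comm, Complex.norm_exp_ofReal_mul_I]
  have hEd : ∀ x ∈ Set.Icc c d, HasDerivAt E (E x * (Complex.I * φ' x)) x := fun x hx =>
    (((hφ x hx).ofReal_comp).const_mul Complex.I).cexp
  have hEc : ContinuousOn E (Set.Icc c d) :=
    fun x hx => (hEd x hx).continuousAt.continuousWithinAt
  -- Write e^{iφ} as (iφ')⁻¹ times its own derivative. The increment of B dominates the variation of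
  -- 1/φ', so φ' need not be monotone; this freedom is needed for the transmission phase.
  have key := intervalIntegral.integral_mul_deriv_eq_deriv_mul
    (u := fun x => (((φ' x)⁻¹ : ℝ) : ℂ)) (u' := fun x => ((w x : ℝ) : ℂ)) (v := E)
    (v' := fun x => E x * (Complex.I * φ' x)) (a := c) (b := d)
    (fun x hx => (hinv x (hu ▸ hx)).ofReal_comp) (fun x hx => hEd x (hu ▸ hx))
    ((Complex.continuous_ofReal.comp_continuousOn (hu ▸ hwc)).intervalIntegrable)
    ((hu ▸ hEc.mul (continuousOn_const.mul
      (Complex.continuous_ofReal.comp_continuousOn hcφ'))).intervalIntegrable)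
  have hl : ∫ x in c..d, (((φ' x)⁻¹ : ℝ) : ℂ) * (E x * (Complex.I * φ' x))
      = Complex.I * ∫ x in c..d, E x := by
    rw [← intervalIntegral.integral_const_mul]
    refine intervalIntegral.integral_congr fun x hx => ?_
    have : (φ' x : ℂ) ≠ 0 := by exact_mod_cast (hpos x (hu ▸ hx)).ne'
    push_cast
    field_simp
  have hn : ‖∫ x in c..d, E x‖ = ‖Complex.I * ∫ x in c..d, E x‖ := by simp
  have hbd : ∀ x ∈ Set.Icc c d, ‖(((φ' x)⁻¹ : ℝ) : ℂ) * E x‖ ≤ 1 / μ := fun x hx => by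
    rw [norm_mul, hEn, mul_one, Complex.norm_real, Real.norm_eq_abs,
      abs_of_pos (inv_pos.2 (hpos x hx)), one_div]
    exact inv_anti₀ hμ (hge x hx)
  have hvar : ‖∫ x in c..d, ((w x : ℝ) : ℂ) * E x‖ ≤ B d - B c := by
    rw [← intervalIntegral.integral_eq_sub_of_hasDerivAt (fun x hx => hB x (hu ▸ hx)) hBint]
    refine intervalIntegral.norm_integral_le_of_norm_le hcd ?_ hBint
    refine Eventually.of_forall fun x hx => ?_
    have hx' : x ∈ Set.Icc c d := ⟨hx.1.le, hx.2⟩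
    rw [norm_mul, hEn, mul_one, Complex.norm_real, Real.norm_eq_abs, hw]
    simp only [abs_div, abs_neg, abs_pow, abs_of_pos (hpos x hx')]
    exact hle x hx'
  rw [hn, ← hl, key]
  refine (norm_sub_le _ _).trans (add_le_add ((norm_sub_le _ _).trans ?_) hvar)
  have := add_le_add (hbd d ⟨hcd, le_rfl⟩) (hbd c ⟨le_rfl, hcd⟩)
  calc _ ≤ 1 / μ + 1 / μ := this
    _ = 2 / μ := by ring

/-- The first 1/r of the interval is estimated by its length. Beyond it φ' ≥ r²(x − c) ≥ r, and the
first derivative test applies with B = −1/φ', giving 2/r + 1/r. -/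
theorem norm_integral_cexp_le_of_deriv_nonneg {φ φ' φ'' : ℝ → ℝ} {c d r : ℝ} (hcd : c ≤ d)
    (hr : 0 < r) (hφ : ∀ x ∈ Set.Icc c d, HasDerivAt φ (φ' x) x)
    (hφ' : ∀ x ∈ Set.Icc c d, HasDerivAt φ' (φ'' x) x) (hφ'' : ContinuousOn φ'' (Set.Icc c d))
    (hge : ∀ x ∈ Set.Icc c d, r ^ 2 ≤ φ'' x) (h0 : 0 ≤ φ' c) :
    ‖∫ x in c..d, Complex.exp (Complex.I * φ x)‖ ≤ 4 / r := by
  have hcφ : ContinuousOn φ (Set.Icc c d) :=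
    fun x hx => (hφ x hx).continuousAt.continuousWithinAt
  have hEc : ContinuousOn (fun x => Complex.exp (Complex.I * φ x)) (Set.Icc c d) :=
    Complex.continuous_exp.comp_continuousOn
      (continuousOn_const.mul (Complex.continuous_ofReal.comp_continuousOn hcφ))
  have hEn : ∀ x, ‖Complex.exp (Complex.I * φ x)‖ = 1 := fun x => by
    rw [mul_comm, Complex.norm_exp_ofReal_mul_I]
  have hgrow : ∀ x ∈ Set.Icc c d, r ^ 2 * (x - c) ≤ φ' x := by
    intro x hx
    have h1 : r ^ 2 * (x - c) ≤ φ' x - φ' c := by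
      refine Convex.mul_sub_le_image_sub_of_le_deriv (convex_Icc c d)
        (fun y hy => (hφ' y hy).continuousAt.continuousWithinAt)
        (fun y hy => (hφ' y (interior_subset hy)).differentiableAt.differentiableWithinAt)
        (fun y hy => ?_) c ⟨le_rfl, hcd⟩ x hx hx.1
      rw [(hφ' y (interior_subset hy)).deriv]
      exact hge y (interior_subset hy)
    linarith
  have hshort : ∀ e, c ≤ e → e ≤ c + 1 / r →
      ‖∫ x in c..e, Complex.exp (Complex.I * φ x)‖ ≤ 1 / r := by
    intro e hce he
    have := intervalIntegral.norm_integral_le_of_norm_le_const (a := c) (b := e) (C := 1)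
      (f := fun x => Complex.exp (Complex.I * φ x)) (fun x _ => (hEn x).le)
    rw [abs_of_nonneg (by linarith)] at this
    linarith
  rcases le_total d (c + 1 / r) with hd | hd
  · refine (hshort d hcd hd).trans ?_
    gcongr; norm_num
  · set e := c + 1 / r with he
    have hr' : 0 < 1 / r := by positivity
    have hce : c ≤ e := by linarith
    have hsub : Set.Icc e d ⊆ Set.Icc c d := Set.Icc_subset_Icc_left hce
    have hge' : ∀ x ∈ Set.Icc e d, r ≤ φ' x := by
      intro x hx
      refine le_trans ?_ (hgrow x (hsub hx))
      have : 1 / r ≤ x - c := by have := hx.1; linarith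
      calc r = r ^ 2 * (1 / r) := by field_simp
        _ ≤ _ := by gcongr
    have hpos : ∀ x ∈ Set.Icc e d, 0 < φ' x := fun x hx => hr.trans_le (hge' x hx)
    have h2 := norm_integral_cexp_le_of_deriv_ge (B := fun x => -(φ' x)⁻¹)
      (B' := fun x => -(-φ'' x / (φ' x) ^ 2)) hd hr
      (fun x hx => hφ x (hsub hx)) (fun x hx => hφ' x (hsub hx)) (hφ''.mono hsub) hge'
      (fun x hx => ((hφ' x (hsub hx)).inv (hpos x hx).ne').neg)
      ((((hφ''.mono hsub).neg.div (ContinuousOn.pow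
        (fun x hx => (hφ' x (hsub hx)).continuousAt.continuousWithinAt) 2)
        fun x hx => (pow_pos (hpos x hx) 2).ne')).neg)
      (fun x hx => by
        rw [abs_of_nonneg ((sq_nonneg r).trans (hge x (hsub hx)))]
        exact le_of_eq (by ring))
    have hed : (φ' e)⁻¹ ≤ 1 / r := by
      rw [one_div]; exact inv_anti₀ hr (hge' e ⟨le_rfl, hd⟩)
    have hdd : 0 ≤ (φ' d)⁻¹ := (inv_pos.2 (hpos d ⟨hd, le_rfl⟩)).le
    have hsplit : ∫ x in c..d, Complex.exp (Complex.I * φ x)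
        = (∫ x in c..e, Complex.exp (Complex.I * φ x))
          + ∫ x in e..d, Complex.exp (Complex.I * φ x) := by
      rw [intervalIntegral.integral_add_adjacent_intervals]
      · refine (hEc.mono ?_).intervalIntegrable
        rw [Set.uIcc_of_le hce]; exact Set.Icc_subset_Icc_right hd
      · refine (hEc.mono ?_).intervalIntegrable
        rw [Set.uIcc_of_le hd]; exact hsub
    rw [hsplit]
    refine (norm_add_le _ _).trans ((add_le_add (hshort e hce le_rfl) h2).trans ?_)
    have : 4 / r = 1 / r + (2 / r + 1 / r) := by ring
    rw [this]
    linarith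

/-- Second derivative test for oscillatory integrals. -/
theorem norm_integral_cexp_le_of_deriv2_ge {φ φ' φ'' : ℝ → ℝ} {c d r : ℝ} (hcd : c ≤ d)
    (hr : 0 < r) (hφ : ∀ x ∈ Set.Icc c d, HasDerivAt φ (φ' x) x)
    (hφ' : ∀ x ∈ Set.Icc c d, HasDerivAt φ' (φ'' x) x) (hφ'' : ContinuousOn φ'' (Set.Icc c d))
    (hge : ∀ x ∈ Set.Icc c d, r ^ 2 ≤ φ'' x) :
    ‖∫ x in c..d, Complex.exp (Complex.I * φ x)‖ ≤ 8 / r := by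
  have h84 : 4 / r ≤ 8 / r := by gcongr; norm_num
  have left : ∀ p ∈ Set.Icc c d, φ' p ≤ 0 →
      ‖∫ x in c..p, Complex.exp (Complex.I * φ x)‖ ≤ 4 / r := by
    intro p hp h0
    have hm : ∀ x ∈ Set.Icc (-p) (-c), -x ∈ Set.Icc c d := fun x hx =>
      ⟨by linarith [hx.2], by linarith [hx.1, hp.2]⟩
    have := norm_integral_cexp_le_of_deriv_nonneg (φ := fun x => φ (-x))
      (φ' := fun x => -φ' (-x)) (φ'' := fun x => φ'' (-x)) (c := -p) (d := -c)
      (by linarith [hp.1]) hr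
      (fun x hx => ((hφ (-x) (hm x hx)).scomp x (hasDerivAt_neg x)).congr_deriv (by simp))
      (fun x hx =>
        ((hφ' (-x) (hm x hx)).scomp x (hasDerivAt_neg x)).neg.congr_deriv (by simp))
      (hφ''.comp continuousOn_neg hm) (fun x hx => hge (-x) (hm x hx)) (by simpa using h0)
    rw [intervalIntegral.integral_comp_neg (fun x => Complex.exp (Complex.I * φ x))] at this
    simpa using this
  have right : ∀ p ∈ Set.Icc c d, 0 ≤ φ' p →
      ‖∫ x in p..d, Complex.exp (Complex.I * φ x)‖ ≤ 4 / r := by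
    intro p hp h0
    have hsub : Set.Icc p d ⊆ Set.Icc c d := Set.Icc_subset_Icc_left hp.1
    exact norm_integral_cexp_le_of_deriv_nonneg hp.2 hr (fun x hx => hφ x (hsub hx))
      (fun x hx => hφ' x (hsub hx)) (hφ''.mono hsub) (fun x hx => hge x (hsub hx)) h0
  rcases le_total 0 (φ' c) with h | h
  · exact (right c ⟨le_rfl, hcd⟩ h).trans h84
  rcases le_total (φ' d) 0 with h' | h'
  · exact (left d ⟨hcd, le_rfl⟩ h').trans h84
  have hcφ' : ContinuousOn φ' (Set.Icc c d) :=
    fun x hx => (hφ' x hx).continuousAt.continuousWithinAt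
  -- φ' changes sign, so split at a zero of φ'. The right piece is the previous lemma and the left
  -- one its mirror image, each costing 4/r.
  obtain ⟨p, hp, hp0⟩ := intermediate_value_Icc hcd hcφ' ⟨h, h'⟩
  have hcφ : ContinuousOn φ (Set.Icc c d) :=
    fun x hx => (hφ x hx).continuousAt.continuousWithinAt
  have hEc : ContinuousOn (fun x => Complex.exp (Complex.I * φ x)) (Set.Icc c d) :=
    Complex.continuous_exp.comp_continuousOn
      (continuousOn_const.mul (Complex.continuous_ofReal.comp_continuousOn hcφ))
  rw [← intervalIntegral.integral_add_adjacent_intervals (b := p)]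
  · refine (norm_add_le _ _).trans ((add_le_add (left p hp hp0.le) (right p hp hp0.ge)).trans ?_)
    exact le_of_eq (by ring)
  · refine (hEc.mono ?_).intervalIntegrable
    rw [Set.uIcc_of_le hp.1]; exact Set.Icc_subset_Icc_right hp.2
  · refine (hEc.mono ?_).intervalIntegrable
    rw [Set.uIcc_of_le hp.2]; exact Set.Icc_subset_Icc_left hp.1

/-- Replacing φ by −φ conjugates the integral. -/
theorem norm_integral_cexp_le_of_deriv2_le {φ φ' φ'' : ℝ → ℝ} {c d r : ℝ} (hcd : c ≤ d)
    (hr : 0 < r) (hφ : ∀ x ∈ Set.Icc c d, HasDerivAt φ (φ' x) x)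
    (hφ' : ∀ x ∈ Set.Icc c d, HasDerivAt φ' (φ'' x) x) (hφ'' : ContinuousOn φ'' (Set.Icc c d))
    (hle : ∀ x ∈ Set.Icc c d, φ'' x ≤ -r ^ 2) :
    ‖∫ x in c..d, Complex.exp (Complex.I * φ x)‖ ≤ 8 / r := by
  have h := norm_integral_cexp_le_of_deriv2_ge (φ := fun x => -φ x) (φ' := fun x => -φ' x)
    (φ'' := fun x => -φ'' x) hcd hr (fun x hx => (hφ x hx).neg) (fun x hx => (hφ' x hx).neg)
    hφ''.neg (fun x hx => by linarith [hle x hx])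
  have e : (fun x => Complex.exp (Complex.I * ((-φ x : ℝ) : ℂ)))
      = fun x => (starRingEnd ℂ) (Complex.exp (Complex.I * φ x)) := by
    funext x
    rw [← Complex.exp_conj]
    simp
  rw [intervalIntegral.integral_of_le hcd] at h ⊢
  rw [e, integral_conj, Complex.norm_conj] at h
  exact h

/-- Oscillatory bounds on the half line pass to the improper integral. -/
theorem OscBound.norm_integral_Ioi_le {F : ℝ → ℂ} {a J : ℝ} (h : OscBound F (Set.Ioi a) J)
    (hF : IntegrableOn F (Set.Ioi a)) : ‖∫ x in Set.Ioi a, F x‖ ≤ J := by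
  have h1 : ∀ c ∈ Set.Ioi a, ‖∫ x in Set.Ioi c, F x‖ ≤ J := by
    intro c hc
    have ht := intervalIntegral_tendsto_integral_Ioi c
      (hF.mono_set (Set.Ioi_subset_Ioi (le_of_lt hc))) tendsto_id
    refine le_of_tendsto ht.norm ?_
    filter_upwards [eventually_ge_atTop c] with d hd
    exact h.2 c hc d (lt_of_lt_of_le hc hd) hd
  have ht : Tendsto (fun n : ℕ => ∫ x in Set.Ioi (a + 1 / ((n : ℝ) + 1)), F x) atTop
      (𝓝 (∫ x in ⋃ n : ℕ, Set.Ioi (a + 1 / ((n : ℝ) + 1)), F x)) := by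
    have hU : (⋃ n : ℕ, Set.Ioi (a + 1 / ((n : ℝ) + 1))) ⊆ Set.Ioi a := by
      refine Set.iUnion_subset fun n x hx => ?_
      have : (0 : ℝ) < 1 / ((n : ℝ) + 1) := by positivity
      simp only [Set.mem_Ioi] at hx ⊢; linarith
    refine tendsto_setIntegral_of_monotone (fun n => measurableSet_Ioi) ?_ (hF.mono_set hU)
    intro m n hmn
    refine Set.Ioi_subset_Ioi ?_
    have : (m : ℝ) ≤ n := by exact_mod_cast hmn
    gcongr
  have hU : (⋃ n : ℕ, Set.Ioi (a + 1 / ((n : ℝ) + 1))) = Set.Ioi a := by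
    refine Set.Subset.antisymm (Set.iUnion_subset fun n x hx => ?_) fun x hx => ?_
    · have : (0 : ℝ) < 1 / ((n : ℝ) + 1) := by positivity
      simp only [Set.mem_Ioi] at hx ⊢; linarith
    · obtain ⟨n, hn⟩ := exists_nat_one_div_lt (sub_pos.2 (Set.mem_Ioi.1 hx))
      exact Set.mem_iUnion.2 ⟨n, by simp only [Set.mem_Ioi]; linarith⟩
  rw [hU] at ht
  refine le_of_tendsto ht.norm (Eventually.of_forall fun n => h1 _ ?_)
  have : (0 : ℝ) < 1 / ((n : ℝ) + 1) := by positivity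
  simp only [Set.mem_Ioi]; linarith

/-- Oscillatory bounds on an open interval pass to the integral over it. -/
theorem OscBound.norm_integral_Ioo_le {F : ℝ → ℂ} {a b J : ℝ} (h : OscBound F (Set.Ioo a b) J)
    (hab : a < b) (hF : IntegrableOn F (Set.Icc a b)) : ‖∫ x in a..b, F x‖ ≤ J := by
  have hu : Set.uIcc a b = Set.Icc a b := Set.uIcc_of_le hab.le
  have hc := intervalIntegral.continuousOn_primitive_interval (μ := volume) (f := F)
    (hu.symm ▸ hF : IntegrableOn F (Set.uIcc a b))
  rw [hu] at hc
  -- Both endpoints are approached from inside; δ n ≤ (b − a)/2 keeps the shrunken endpoints in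
  -- order.
  set δ : ℕ → ℝ := fun n => (b - a) / 2 / ((n : ℝ) + 1) with hδ
  have hδ0 : Tendsto δ atTop (𝓝 0) := by
    have h1 := tendsto_one_div_add_atTop_nhds_zero_nat (𝕜 := ℝ)
    have h2 := h1.const_mul ((b - a) / 2)
    simpa [hδ, div_eq_mul_inv] using h2
  have hδp : ∀ n, 0 < δ n := fun n => by simp only [hδ]; have := sub_pos.2 hab; positivity
  have hδl : ∀ n, δ n ≤ (b - a) / 2 := fun n => by
    simp only [hδ]
    refine div_le_self (by linarith) ?_
    have : (0 : ℝ) ≤ n := n.cast_nonneg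
    linarith
  have hi : ∀ c ∈ Set.Icc a b, ∀ d ∈ Set.Icc a b, IntervalIntegrable F volume c d := by
    intro c hc d hd
    refine (hF.mono_set ?_).intervalIntegrable
    exact Set.OrdConnected.uIcc_subset inferInstance hc hd
  have ha : a ∈ Set.Icc a b := ⟨le_rfl, hab.le⟩
  have hb : b ∈ Set.Icc a b := ⟨hab.le, le_rfl⟩
  have h1 : Tendsto (fun n => a + δ n) atTop (𝓝[Set.Icc a b] a) := by
    refine tendsto_nhdsWithin_iff.2 ⟨by simpa using hδ0.const_add a,
      Eventually.of_forall fun n => ?_⟩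
    have := hδp n; have := hδl n
    constructor <;> linarith
  have h2 : Tendsto (fun n => b - δ n) atTop (𝓝[Set.Icc a b] b) := by
    refine tendsto_nhdsWithin_iff.2 ⟨by simpa using hδ0.const_sub b,
      Eventually.of_forall fun n => ?_⟩
    have := hδp n; have := hδl n
    constructor <;> linarith
  have ht := ((hc b hb).tendsto.comp h2).sub ((hc a ha).tendsto.comp h1)
  simp only [intervalIntegral.integral_same, sub_zero] at ht
  refine le_of_tendsto ht.norm (Eventually.of_forall fun n => ?_)
  have h3 := hδp n
  have h4 := hδl n
  have e1 : a + δ n ∈ Set.Icc a b := ⟨by linarith, by linarith⟩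
  have e2 : b - δ n ∈ Set.Icc a b := ⟨by linarith, by linarith⟩
  simp only [Function.comp]
  rw [intervalIntegral.integral_interval_sub_left (hi a ha _ e2) (hi a ha _ e1)]
  exact h.2 _ ⟨by linarith, by linarith⟩ _ ⟨by linarith, by linarith⟩ (by linarith)

/-! ### The momentum behind the step as a holomorphic function on the upper half plane. -/

/-- The square root `√(z² - q²)` on the closed upper half plane, with nonnegative imaginary part;
it is the momentum behind a step of height `q²`. -/
noncomputable def stepMomentum (q : ℝ) (z : ℂ) : ℂ :=
  Complex.I * ((Complex.I * (q - z)) ^ (2⁻¹ : ℂ) * (-Complex.I * (q + z)) ^ (2⁻¹ : ℂ))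

theorem stepMomentum_sq (q : ℝ) (z : ℂ) : stepMomentum q z ^ 2 = z ^ 2 - q ^ 2 := by
  have h : ∀ w : ℂ, (w ^ (2⁻¹ : ℂ)) ^ 2 = w := fun w => by
    simp
  rw [stepMomentum, mul_pow, mul_pow, h, h, Complex.I_sq]
  linear_combination (-(z ^ 2 - q ^ 2 : ℂ)) * Complex.I_sq

theorem continuousAt_cpow_half {w : ℂ} (hw : 0 ≤ w.re) :
    ContinuousAt (fun z : ℂ => z ^ (2⁻¹ : ℂ)) w := by
  refine Complex.continuousAt_cpow_const_of_re_pos (Or.inl hw) (by norm_num)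

/-- Both i(q − z) and −i(q + z) have real part Im z ≥ 0, so the principal square roots stay away
from their cut. At the branch points ±q continuity holds because the exponent 1/2 has positive real
part. -/
theorem continuousOn_stepMomentum (q : ℝ) :
    ContinuousOn (stepMomentum q) {z : ℂ | 0 ≤ z.im} := by
  intro z hz
  refine ContinuousAt.continuousWithinAt ?_
  have hz' : 0 ≤ z.im := hz
  have h1 : ContinuousAt (fun w : ℂ => (Complex.I * (q - w)) ^ (2⁻¹ : ℂ)) z := by
    refine (continuousAt_cpow_half (w := Complex.I * (q - z)) (by simpa using hz')).comp
      (f := fun w : ℂ => Complex.I * (q - w)) ?_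
    fun_prop
  have h2 : ContinuousAt (fun w : ℂ => (-Complex.I * (q + w)) ^ (2⁻¹ : ℂ)) z := by
    refine (continuousAt_cpow_half (w := -Complex.I * (q + z)) (by simpa using hz')).comp
      (f := fun w : ℂ => -Complex.I * (q + w)) ?_
    fun_prop
  exact continuousAt_const.mul (h1.mul h2)

theorem differentiableAt_stepMomentum (q : ℝ) {z : ℂ} (hz : 0 < z.im) :
    DifferentiableAt ℂ (stepMomentum q) z := by
  unfold stepMomentum
  refine (differentiableAt_const _).mul (DifferentiableAt.mul ?_ ?_)
  · refine DifferentiableAt.cpow_const (by fun_prop) (Or.inl ?_)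
    simpa using hz
  · refine DifferentiableAt.cpow_const (by fun_prop) (Or.inl ?_)
    simpa using hz

/-- The square root of a number in the right half plane satisfies |Im| ≤ Re. The product of two such
roots therefore has nonnegative real part, and the factor i turns this into a nonnegative imaginary
part. -/
theorem stepMomentum_im_nonneg (q : ℝ) {z : ℂ} (hz : 0 ≤ z.im) : 0 ≤ (stepMomentum q z).im := by
  have key : ∀ w : ℂ, 0 ≤ w.re →
      0 ≤ (w ^ (2⁻¹ : ℂ)).re ∧ |(w ^ (2⁻¹ : ℂ)).im| ≤ (w ^ (2⁻¹ : ℂ)).re := by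
    intro w hw
    have h0 : 0 ≤ (w ^ (2⁻¹ : ℂ)).re := by
      rw [Complex.cpow_inv_two_re]; exact Real.sqrt_nonneg _
    refine ⟨h0, abs_le_of_sq_le_sq ?_ h0⟩
    have h1 : (w ^ (2⁻¹ : ℂ)) ^ 2 = w := by simp
    have h2 := congrArg Complex.re h1
    rw [sq, Complex.mul_re] at h2
    nlinarith
  obtain ⟨a0, a1⟩ := key (Complex.I * (q - z)) (by simpa using hz)
  obtain ⟨b0, b1⟩ := key (-Complex.I * (q + z)) (by simpa using hz)
  rw [stepMomentum, Complex.I_mul_im, Complex.mul_re]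
  have h3 := mul_le_mul a1 b1 (abs_nonneg _) a0
  rw [← abs_mul] at h3
  linarith [le_abs_self (((Complex.I * (q - z)) ^ (2⁻¹ : ℂ)).im
    * ((-Complex.I * (q + z)) ^ (2⁻¹ : ℂ)).im)]

theorem stepMomentum_re_im (q : ℝ) (z : ℂ) :
    (stepMomentum q z).re * (stepMomentum q z).im = z.re * z.im ∧
    (stepMomentum q z).re ^ 2 - (stepMomentum q z).im ^ 2 = z.re ^ 2 - z.im ^ 2 - q ^ 2 := by
  have h := stepMomentum_sq q z
  have h1 := congrArg Complex.re h
  have h2 := congrArg Complex.im h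
  simp [sq] at h1 h2
  constructor <;> nlinarith

/-- The imaginary part of `√(z² - q²)` exceeds that of `z`, and the real parts have the same
sign. -/
theorem stepMomentum_im_ge_of_pos {q : ℝ} {z : ℂ} (hz : 0 < z.im) :
    z.im ≤ (stepMomentum q z).im ∧ 0 ≤ z.re * (stepMomentum q z).re := by
  obtain ⟨h1, h2⟩ := stepMomentum_re_im q z
  have h0 := stepMomentum_im_nonneg q hz.le
  generalize (stepMomentum q z).re = a at *
  generalize (stepMomentum q z).im = b at *
  have hb : 0 < b := by
    rcases h0.lt_or_eq with h | h
    · exact h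
    · rw [← h, mul_zero] at h1
      have hre : z.re = 0 := by
        rcases mul_eq_zero.1 h1.symm with h | h
        · exact h
        · exact absurd h hz.ne'
      rw [← h, hre] at h2
      nlinarith [sq_nonneg a, sq_nonneg q, pow_pos hz 2]
  constructor
  -- With ℓ = a + ib: if b < Im z, the real part of ℓ² = z² − q² forces a² < (Re z)², which
  -- contradicts ab = Re z · Im z.
  · by_contra hlt
    push Not at hlt
    have h3 : (a * b) ^ 2 = (z.re * z.im) ^ 2 := by rw [h1]
    have h4 : b ^ 2 < z.im ^ 2 := by nlinarith
    have h5 : a ^ 2 < z.re ^ 2 := by nlinarith [sq_nonneg q]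
    have h6 : a ^ 2 * b ^ 2 < z.re ^ 2 * z.im ^ 2 :=
      mul_lt_mul'' h5 h4 (sq_nonneg _) (sq_nonneg _)
    nlinarith
  · have h3 : (z.re * a) * b = z.re ^ 2 * z.im := by linear_combination z.re * h1
    have h4 : 0 ≤ (z.re * a) * b := by rw [h3]; positivity
    exact nonneg_of_mul_nonneg_left h4 hb

/-- The real axis is reached by continuity from z + i/(n + 1). -/
theorem stepMomentum_im_ge {q : ℝ} {z : ℂ} (hz : 0 ≤ z.im) :
    z.im ≤ (stepMomentum q z).im ∧ 0 ≤ z.re * (stepMomentum q z).re := by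
  have ht : Tendsto (fun n : ℕ => z + ((1 / ((n : ℝ) + 1) : ℝ) : ℂ) * Complex.I) atTop
      (𝓝[{z : ℂ | 0 ≤ z.im}] z) := by
    refine tendsto_nhdsWithin_iff.2 ⟨?_, Eventually.of_forall fun n => ?_⟩
    · have h1 := tendsto_one_div_add_atTop_nhds_zero_nat (𝕜 := ℝ)
      have h2 := (Complex.continuous_ofReal.tendsto 0).comp h1
      simpa using (h2.mul_const Complex.I).const_add z
    · have : (0 : ℝ) < 1 / ((n : ℝ) + 1) := by positivity
      simp only [Set.mem_ofPred_eq, Complex.add_im, Complex.mul_im, Complex.ofReal_re,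
        Complex.I_im, Complex.ofReal_im, Complex.I_re]
      linarith
  have hl := (continuousOn_stepMomentum q z hz).tendsto.comp ht
  have hz' := tendsto_nhds_of_tendsto_nhdsWithin ht
  have hpos : ∀ n : ℕ, 0 < (z + ((1 / ((n : ℝ) + 1) : ℝ) : ℂ) * Complex.I).im := fun n => by
    have : (0 : ℝ) < 1 / ((n : ℝ) + 1) := by positivity
    simp only [Complex.add_im, Complex.mul_im, Complex.ofReal_re,
        Complex.I_im, Complex.ofReal_im, Complex.I_re]
    linarith
  constructor
  · exact le_of_tendsto_of_tendsto' ((Complex.continuous_im.tendsto _).comp hz')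
      ((Complex.continuous_im.tendsto _).comp hl)
      fun n => (stepMomentum_im_ge_of_pos (hpos n)).1
  · exact ge_of_tendsto' (((Complex.continuous_re.tendsto _).comp hz').mul
      ((Complex.continuous_re.tendsto _).comp hl))
      fun n => (stepMomentum_im_ge_of_pos (hpos n)).2

theorem norm_stepMomentum_le {q : ℝ} (hq : 0 ≤ q) (z : ℂ) : ‖stepMomentum q z‖ ≤ ‖z‖ + q := by
  refine le_of_sq_le_sq ?_ (by positivity)
  rw [← norm_pow, stepMomentum_sq]
  refine (norm_sub_le _ _).trans ?_
  rw [norm_pow, norm_pow, Complex.norm_real, Real.norm_eq_abs, sq_abs]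
  nlinarith [norm_nonneg z]

theorem stepMomentum_of_lt {q x : ℝ} (hq : 0 ≤ q) (hx : q < x) :
    stepMomentum q x = (√(x ^ 2 - q ^ 2) : ℝ) := by
  obtain ⟨h1, h2⟩ := stepMomentum_re_im q x
  have h3 := (stepMomentum_im_ge (q := q) (z := x) (by simp)).2
  simp only [Complex.ofReal_re, Complex.ofReal_im, mul_zero] at h1 h2 h3
  have hx0 : 0 < x := hq.trans_lt hx
  have hre : 0 ≤ (stepMomentum q x).re := nonneg_of_mul_nonneg_right h3 hx0
  have hpos : 0 < x ^ 2 - q ^ 2 := by nlinarith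
  have him : (stepMomentum q x).im = 0 := by
    rcases mul_eq_zero.1 h1 with h | h
    · rw [h] at h2; nlinarith [sq_nonneg (stepMomentum q x).im]
    · exact h
  apply Complex.ext
  · rw [Complex.ofReal_re]
    rw [him] at h2
    rw [show x ^ 2 - q ^ 2 = (stepMomentum q x).re ^ 2 by linarith, Real.sqrt_sq hre]
  · simp [him]

theorem stepMomentum_of_abs_lt {q x : ℝ} (hx : |x| < q) :
    stepMomentum q x = Complex.I * (√(q ^ 2 - x ^ 2) : ℝ) := by
  obtain ⟨h1, h2⟩ := stepMomentum_re_im q x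
  have h3 := stepMomentum_im_nonneg q (z := x) (by simp)
  simp only [Complex.ofReal_re, Complex.ofReal_im, mul_zero] at h1 h2
  have hpos : 0 < q ^ 2 - x ^ 2 := by
    have := sq_lt_sq' (by linarith [abs_nonneg x]) hx
    rw [sq_abs] at this; linarith
  have hre : (stepMomentum q x).re = 0 := by
    rcases mul_eq_zero.1 h1 with h | h
    · exact h
    · rw [h] at h2; nlinarith [sq_nonneg (stepMomentum q x).re]
  apply Complex.ext
  · simp [hre]
  · rw [Complex.I_mul_im, Complex.ofReal_re]
    rw [hre] at h2
    rw [show q ^ 2 - x ^ 2 = (stepMomentum q x).im ^ 2 by linarith, Real.sqrt_sq h3]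

/-- Neither root meets the cut of the principal branch for real x, so conjugation commutes with both
and exchanges the two factors. This reduces the negative half line to the positive one. -/
theorem stepMomentum_neg_ofReal (q x : ℝ) :
    stepMomentum q ((-x : ℝ) : ℂ) = -(starRingEnd ℂ) (stepMomentum q x) := by
  have hc : (starRingEnd ℂ) (2⁻¹ : ℂ) = 2⁻¹ := by
    rw [show (2⁻¹ : ℂ) = ((2⁻¹ : ℝ) : ℂ) by norm_num]; exact Complex.conj_ofReal _
  have key : ∀ w : ℂ, w.re = 0 →
      (starRingEnd ℂ) (w ^ (2⁻¹ : ℂ)) = ((starRingEnd ℂ) w) ^ (2⁻¹ : ℂ) := by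
    intro w hw
    rw [Complex.conj_cpow _ _ (by rw [ne_eq, Complex.arg_eq_pi_iff, hw]; simp), hc]
  rw [stepMomentum, stepMomentum, map_mul, map_mul, key _ (by simp), key _ (by simp)]
  simp only [map_mul, map_neg, map_sub, map_add, Complex.conj_I, Complex.conj_ofReal]
  push_cast
  rw [sub_neg_eq_add, ← sub_eq_add_neg, neg_neg]
  ring

/-! ### Growth classes and integrability against Gaussians. -/

/-- Continuous functions of at most linear growth. -/
def LinBdd (f : ℝ → ℂ) : Prop :=
  Continuous f ∧ ∃ A : ℝ, ∀ x, ‖f x‖ ≤ A * (1 + |x|)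

/-- Continuous functions of at most exponential growth. -/
def ExpBdd (f : ℝ → ℂ) : Prop :=
  Continuous f ∧ ∃ A B : ℝ, ∀ x, ‖f x‖ ≤ B * Real.exp (A * |x|)

theorem LinBdd.const (z : ℂ) : LinBdd fun _ => z :=
  ⟨continuous_const, ‖z‖, fun x => by nlinarith [norm_nonneg z, abs_nonneg x]⟩

theorem LinBdd.ofReal : LinBdd fun x => (x : ℂ) :=
  ⟨Complex.continuous_ofReal, 1, fun x => by
    rw [Complex.norm_real, Real.norm_eq_abs]; linarith⟩

theorem LinBdd.add {f g : ℝ → ℂ} (hf : LinBdd f) (hg : LinBdd g) :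
    LinBdd fun x => f x + g x := by
  obtain ⟨hfc, A, hA⟩ := hf
  obtain ⟨hgc, B, hB⟩ := hg
  refine ⟨hfc.add hgc, A + B, fun x => ?_⟩
  rw [add_mul]
  exact (norm_add_le _ _).trans (add_le_add (hA x) (hB x))

theorem LinBdd.const_mul {f : ℝ → ℂ} (hf : LinBdd f) (z : ℂ) : LinBdd fun x => z * f x := by
  obtain ⟨hfc, A, hA⟩ := hf
  refine ⟨continuous_const.mul hfc, ‖z‖ * A, fun x => ?_⟩
  rw [norm_mul, mul_assoc]
  exact mul_le_mul_of_nonneg_left (hA x) (norm_nonneg _)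

theorem LinBdd.exp {f : ℝ → ℂ} (hf : LinBdd f) : ExpBdd fun x => Complex.exp (f x) := by
  obtain ⟨hfc, A, hA⟩ := hf
  refine ⟨Complex.continuous_exp.comp hfc, A, Real.exp A, fun x => ?_⟩
  rw [Complex.norm_exp, ← Real.exp_add]
  refine Real.exp_le_exp.2 ?_
  have := (Complex.re_le_norm (f x)).trans (hA x)
  linarith

theorem LinBdd.expBdd {f : ℝ → ℂ} (hf : LinBdd f) : ExpBdd f := by
  obtain ⟨hfc, A, hA⟩ := hf
  refine ⟨hfc, 1, A, fun x => (hA x).trans ?_⟩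
  have hA0 : 0 ≤ A := by
    have := (norm_nonneg _).trans (hA 0)
    simpa using this
  refine mul_le_mul_of_nonneg_left ?_ hA0
  linarith [Real.add_one_le_exp (1 * |x|)]

theorem ExpBdd.mul {f g : ℝ → ℂ} (hf : ExpBdd f) (hg : ExpBdd g) :
    ExpBdd fun x => f x * g x := by
  obtain ⟨hfc, A, B, hA⟩ := hf
  obtain ⟨hgc, A', B', hA'⟩ := hg
  refine ⟨hfc.mul hgc, A + A', B * B', fun x => ?_⟩
  rw [norm_mul, add_mul, Real.exp_add]
  calc ‖f x‖ * ‖g x‖ ≤ (B * Real.exp (A * |x|)) * (B' * Real.exp (A' * |x|)) :=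
        mul_le_mul (hA x) (hA' x) (norm_nonneg _) ((norm_nonneg _).trans (hA x))
    _ = _ := by ring

theorem ExpBdd.add {f g : ℝ → ℂ} (hf : ExpBdd f) (hg : ExpBdd g) :
    ExpBdd fun x => f x + g x := by
  obtain ⟨hfc, A, B, hA⟩ := hf
  obtain ⟨hgc, A', B', hA'⟩ := hg
  refine ⟨hfc.add hgc, max A A', B + B', fun x => ?_⟩
  have hB : 0 ≤ B := by have := (norm_nonneg _).trans (hA 0); simpa using this
  have hB' : 0 ≤ B' := by have := (norm_nonneg _).trans (hA' 0); simpa using this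
  rw [add_mul]
  refine (norm_add_le _ _).trans (add_le_add ((hA x).trans ?_) ((hA' x).trans ?_))
  · gcongr; exact le_max_left _ _
  · gcongr; exact le_max_right _ _

theorem ExpBdd.const (z : ℂ) : ExpBdd fun _ => z := (LinBdd.const z).expBdd

/-- Exponentially bounded functions are integrable against a complex Gaussian, locally uniformly
in its imaginary part. -/
theorem ExpBdd.gaussian_bound {f : ℝ → ℂ} (hf : ExpBdd f) {ε : ℝ} (hε : 0 < ε) :
    ∃ g : ℝ → ℝ, Integrable g ∧ ∀ x, Real.exp (-ε * x ^ 2) * ‖f x‖ ≤ g x := by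
  obtain ⟨hfc, A, B, hA⟩ := hf
  have hB : 0 ≤ B := by have := (norm_nonneg _).trans (hA 0); simpa using this
  -- The constant comes from completing the square: A|x| ≤ A²/(2ε) + εx²/2, so half of the Gaussian
  -- remains.
  refine ⟨fun x => (B * Real.exp (A ^ 2 / (2 * ε))) * Real.exp (-(ε / 2) * x ^ 2),
    (integrable_exp_neg_mul_sq (half_pos hε)).const_mul _, fun x => ?_⟩
  calc Real.exp (-ε * x ^ 2) * ‖f x‖ ≤ Real.exp (-ε * x ^ 2) * (B * Real.exp (A * |x|)) := by
        gcongr; exact hA x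
    _ = B * Real.exp (-ε * x ^ 2 + A * |x|) := by rw [Real.exp_add]; ring
    _ ≤ B * Real.exp (A ^ 2 / (2 * ε) + -(ε / 2) * x ^ 2) := by
        refine mul_le_mul_of_nonneg_left (Real.exp_le_exp.2 ?_) hB
        have h1 : A ^ 2 / (2 * ε) + -(ε / 2) * x ^ 2 - (-ε * x ^ 2 + A * |x|)
            = (A - ε * |x|) ^ 2 / (2 * ε) := by
          rw [← sq_abs x]; field_simp; ring
        have h2 : 0 ≤ (A - ε * |x|) ^ 2 / (2 * ε) := by positivity
        linarith
    _ = _ := by rw [Real.exp_add]; ring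

theorem ExpBdd.integrable {f : ℝ → ℂ} (hf : ExpBdd f) {τ : ℂ} (hτ : 0 < τ.re) :
    Integrable fun x : ℝ => Complex.exp (-τ * (x : ℂ) ^ 2) * f x := by
  obtain ⟨g, hg, hfg⟩ := hf.gaussian_bound hτ
  have hc : Continuous fun x : ℝ => Complex.exp (-τ * (x : ℂ) ^ 2) * f x :=
    (by fun_prop : Continuous fun x : ℝ => Complex.exp (-τ * (x : ℂ) ^ 2)).mul hf.1
  refine hg.mono' hc.aestronglyMeasurable (Eventually.of_forall fun x => ?_)
  rw [norm_mul, norm_cexp_neg_mul_sq]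
  exact hfg x

theorem linBdd_stepMomentum {q : ℝ} (hq : 0 ≤ q) {η : ℝ} (hη : 0 ≤ η) :
    LinBdd fun x : ℝ => stepMomentum q (x + η * Complex.I) := by
  constructor
  · refine (continuousOn_stepMomentum q).comp_continuous (by fun_prop) fun x => ?_
    simpa using hη
  · refine ⟨1 + η + q, fun x => (norm_stepMomentum_le hq _).trans ?_⟩
    have h1 : ‖(x : ℂ) + η * Complex.I‖ ≤ |x| + η := by
      refine (norm_add_le _ _).trans ?_
      simp [abs_of_nonneg hη]
    nlinarith [abs_nonneg x]

/-! ### The transmission integral on the real axis: decay uniform in the height of the step. -/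

/-- The integrand of the transmitted wave at height `q`, with distances `X` and `Y` travelled to the
left and to the right of the step; the amplitude `z (z - ℓ) / q²` equals `z / (z + ℓ)`. -/
noncomputable def transmissionSymbol (q X Y : ℝ) (z : ℂ) : ℂ :=
  z * (z - stepMomentum q z) / q ^ 2 * Complex.exp (Complex.I * (z * X + stepMomentum q z * Y))

theorem expBdd_transmissionSymbol {q : ℝ} (hq : 0 ≤ q) (X Y : ℝ) {η : ℝ} (hη : 0 ≤ η) :
    ExpBdd fun x : ℝ => transmissionSymbol q X Y (x + η * Complex.I) := by
  have hz : LinBdd fun x : ℝ => (x + η * Complex.I : ℂ) := LinBdd.ofReal.add (LinBdd.const _)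
  have hl := linBdd_stepMomentum hq hη
  have h1 := (hz.expBdd.mul (hz.add (hl.const_mul (-1))).expBdd).mul
    (ExpBdd.const ((q ^ 2 : ℂ)⁻¹))
  have h2 := (((hz.const_mul X).add (hl.const_mul Y)).const_mul Complex.I).exp
  have h3 := h1.mul h2
  convert h3 using 2 with x
  simp only [transmissionSymbol, div_eq_mul_inv]
  ring_nf

section RealAxis

variable {q ε s X Y : ℝ}

theorem oscBound_quadratic (hs : s ≠ 0) (S : Set ℝ) [S.OrdConnected] (X : ℝ) :
    OscBound (fun x : ℝ => Complex.exp (Complex.I * ((s * x ^ 2 + x * X : ℝ) : ℂ))) S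
      (8 / √|s|) := by
  refine ⟨by fun_prop, fun c _ d _ hcd => ?_⟩
  have hr : 0 < √|s| := Real.sqrt_pos.2 (abs_pos.2 hs)
  have h2 : √|s| ^ 2 = |s| := Real.sq_sqrt (abs_nonneg s)
  have h1 : ∀ x ∈ Set.Icc c d,
      HasDerivAt (fun x : ℝ => s * x ^ 2 + x * X) (2 * s * x + X) x := fun x _ => by
    refine (((hasDerivAt_pow 2 x).const_mul s).add ((hasDerivAt_id x).mul_const X)).congr_deriv ?_
    simp; ring
  have h3 : ∀ x ∈ Set.Icc c d, HasDerivAt (fun x : ℝ => 2 * s * x + X) (2 * s) x :=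
    fun x _ => by simpa using ((hasDerivAt_id x).const_mul (2 * s)).add_const X
  rcases lt_or_gt_of_ne hs with h | h
  · refine norm_integral_cexp_le_of_deriv2_le hcd hr h1 h3 continuousOn_const fun x _ => ?_
    rw [h2, abs_of_neg h]; linarith
  · refine norm_integral_cexp_le_of_deriv2_ge hcd hr h1 h3 continuousOn_const fun x _ => ?_
    rw [h2, abs_of_pos h]; linarith

theorem hasDerivAt_sqrt_sq_sub {x : ℝ} (hq : 0 ≤ q) (hx : q < x) :
    0 < √(x ^ 2 - q ^ 2) ∧
    HasDerivAt (fun x => √(x ^ 2 - q ^ 2)) (x / √(x ^ 2 - q ^ 2)) x := by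
  have h : 0 < x ^ 2 - q ^ 2 := by nlinarith
  refine ⟨Real.sqrt_pos.2 h, ?_⟩
  refine (((hasDerivAt_pow 2 x).sub_const (q ^ 2)).sqrt h.ne').congr_deriv ?_
  have := Real.sqrt_pos.2 h
  simp only [Nat.cast_ofNat, Nat.add_one_sub_one, pow_one]
  field_simp

theorem hasDerivAt_sqrt_sub_sq {x : ℝ} (hx : x ∈ Set.Ioo 0 q) :
    0 < √(q ^ 2 - x ^ 2) ∧
    HasDerivAt (fun x => √(q ^ 2 - x ^ 2)) (-x / √(q ^ 2 - x ^ 2)) x := by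
  have h : 0 < q ^ 2 - x ^ 2 := by nlinarith [hx.1, hx.2]
  refine ⟨Real.sqrt_pos.2 h, ?_⟩
  refine (((hasDerivAt_pow 2 x).const_sub (q ^ 2)).sqrt h.ne').congr_deriv ?_
  have := Real.sqrt_pos.2 h
  simp only [Nat.cast_ofNat, Nat.add_one_sub_one, pow_one]
  field_simp

/-- The phase of the transmitted wave obeys the same bound as a quadratic phase. -/
theorem oscBound_transmission_phase (hq : 0 ≤ q) (hs : s ≠ 0) (hX : 0 ≤ X) (hY : 0 ≤ Y) :
    OscBound (fun x : ℝ =>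
      Complex.exp (Complex.I * ((s * x ^ 2 + x * X + √(x ^ 2 - q ^ 2) * Y : ℝ) : ℂ)))
      (Set.Ioi q) (8 / √|s|) := by
  refine ⟨by fun_prop, fun c hc d _ hcd => ?_⟩
  have hr : 0 < √|s| := Real.sqrt_pos.2 (abs_pos.2 hs)
  have h2 : √|s| ^ 2 = |s| := Real.sq_sqrt (abs_nonneg s)
  have hc : q < c := hc
  have hl : ∀ x ∈ Set.Icc c d, 0 < √(x ^ 2 - q ^ 2) := fun x hx =>
    (hasDerivAt_sqrt_sq_sub hq (hc.trans_le hx.1)).1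
  have hl2 : ∀ x ∈ Set.Icc c d, √(x ^ 2 - q ^ 2) ^ 2 = x ^ 2 - q ^ 2 := fun x hx =>
    Real.sq_sqrt (by nlinarith [hx.1])
  have h1 : ∀ x ∈ Set.Icc c d,
      HasDerivAt (fun x : ℝ => s * x ^ 2 + x * X + √(x ^ 2 - q ^ 2) * Y)
        (2 * s * x + X + x / √(x ^ 2 - q ^ 2) * Y) x := fun x hx => by
    refine ((((hasDerivAt_pow 2 x).const_mul s).add ((hasDerivAt_id x).mul_const X)).add
      ((hasDerivAt_sqrt_sq_sub hq (hc.trans_le hx.1)).2.mul_const Y)).congr_deriv ?_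
    simp; ring
  have hratio : ∀ x ∈ Set.Icc c d, HasDerivAt (fun x : ℝ => x / √(x ^ 2 - q ^ 2) * Y)
      (-(q ^ 2 * Y / √(x ^ 2 - q ^ 2) ^ 3)) x := fun x hx => by
    have hlx := hl x hx
    refine (((hasDerivAt_id x).div (hasDerivAt_sqrt_sq_sub hq (hc.trans_le hx.1)).2
      hlx.ne').mul_const Y).congr_deriv ?_
    have h := hl2 x hx
    simp only [id]
    generalize √(x ^ 2 - q ^ 2) = l at *
    field_simp
    linear_combination Y * h
  have h3 : ∀ x ∈ Set.Icc c d,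
      HasDerivAt (fun x : ℝ => 2 * s * x + X + x / √(x ^ 2 - q ^ 2) * Y)
        (2 * s - q ^ 2 * Y / √(x ^ 2 - q ^ 2) ^ 3) x := fun x hx => by
    refine ((((hasDerivAt_id x).const_mul (2 * s)).add_const X).add (hratio x hx)).congr_deriv ?_
    simp; ring
  have hcont : ContinuousOn (fun x => q ^ 2 * Y / √(x ^ 2 - q ^ 2) ^ 3) (Set.Icc c d) :=
    ContinuousOn.div (by fun_prop) (by fun_prop) fun x hx => (pow_pos (hl x hx) 3).ne'
  have hnn : ∀ x ∈ Set.Icc c d, 0 ≤ q ^ 2 * Y / √(x ^ 2 - q ^ 2) ^ 3 := fun x _ => by positivity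
  -- The second derivative of the phase is 2s − q²Y/ℓ³. For s < 0 both terms are nonpositive and the
  -- second derivative test applies. For s > 0 they compete, but φ' ≥ 2sx, so the first derivative
  -- test works for x ≥ 1/√s and the part below 1/√s is short.
  rcases lt_or_gt_of_ne hs with h | h
  · refine norm_integral_cexp_le_of_deriv2_le hcd hr h1 h3 (continuousOn_const.sub hcont)
      fun x hx => ?_
    have := hnn x hx
    rw [h2, abs_of_neg h]; linarith
  · rw [abs_of_pos h] at h2 hr ⊢
    set r := √s with hrdef
    have hcE : Continuous (fun x : ℝ =>
      Complex.exp (Complex.I * ((s * x ^ 2 + x * X + √(x ^ 2 - q ^ 2) * Y : ℝ) : ℂ))) := by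
      fun_prop
    have hEn : ∀ x : ℝ, ‖Complex.exp (Complex.I *
        ((s * x ^ 2 + x * X + √(x ^ 2 - q ^ 2) * Y : ℝ) : ℂ))‖ = 1 := fun x => by
      rw [mul_comm, Complex.norm_exp_ofReal_mul_I]
    have hshort : ∀ e, c ≤ e → e ≤ 1 / r → ‖∫ x in c..e, Complex.exp (Complex.I *
        ((s * x ^ 2 + x * X + √(x ^ 2 - q ^ 2) * Y : ℝ) : ℂ))‖ ≤ 1 / r := by
      intro e hce he
      refine (intervalIntegral.norm_integral_le_of_norm_le_const (C := 1)
        (fun x _ => (hEn x).le)).trans ?_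
      rw [abs_of_nonneg (by linarith)]
      linarith
    have hlong : ∀ e, c ≤ e → e ≤ d → 1 / r ≤ e → ‖∫ x in e..d, Complex.exp (Complex.I *
        ((s * x ^ 2 + x * X + √(x ^ 2 - q ^ 2) * Y : ℝ) : ℂ))‖ ≤ 2 / r := by
      intro e hce hed he
      have hsub : Set.Icc e d ⊆ Set.Icc c d := Set.Icc_subset_Icc_left hce
      have hx0 : ∀ x ∈ Set.Icc e d, 1 / r ≤ x := fun x hx => he.trans hx.1
      have hr' : 0 < 1 / r := by positivity
      have hrs : ∀ x ∈ Set.Icc e d, 2 * r ≤ 2 * s * x := fun x hx => by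
        calc 2 * r = 2 * s * (1 / r) := by rw [← h2]; field_simp
          _ ≤ _ := by have := hx0 x hx; gcongr
      have hrat : ∀ x ∈ Set.Icc e d, 0 ≤ x / √(x ^ 2 - q ^ 2) * Y := fun x hx => by
        have := hl x (hsub hx)
        have := hr'.le.trans (hx0 x hx)
        positivity
      -- With v = xY/ℓ decreasing, |φ''| ≤ 2s − v' and φ' ≥ 2sx + v. Bounding φ' below by 2r + v in
      -- one term and by 2sx in the other makes each an exact derivative, whose total increment is
      -- at most 1/r whatever q and Y are.
      have hB : ∀ x ∈ Set.Icc e d, HasDerivAt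
          (fun x : ℝ => (2 * r + x / √(x ^ 2 - q ^ 2) * Y)⁻¹ - (2 * s * x)⁻¹)
          (-(-(q ^ 2 * Y / √(x ^ 2 - q ^ 2) ^ 3)) / (2 * r + x / √(x ^ 2 - q ^ 2) * Y) ^ 2
            - -(2 * s * 1) / (2 * s * x) ^ 2) x := fun x hx => by
        have hp := hrs x hx
        have hp2 := hrat x hx
        refine (((hratio x (hsub hx)).const_add (2 * r)).inv (by linarith)).sub
          (((hasDerivAt_id x).const_mul (2 * s)).inv ?_)
        simp only [id]; linarith
      have h4 := norm_integral_cexp_le_of_deriv_ge hed (by linarith : 0 < 2 * r)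
        (fun x hx => h1 x (hsub hx)) (fun x hx => h3 x (hsub hx))
        ((continuousOn_const.sub hcont).mono hsub)
        (fun x hx => by have := hrs x hx; have := hrat x hx; linarith) hB ?_ ?_
      · refine h4.trans ?_
        have hd : d ∈ Set.Icc e d := ⟨hed, le_rfl⟩
        have he' : e ∈ Set.Icc e d := ⟨le_rfl, hed⟩
        have b1 : (2 * r + d / √(d ^ 2 - q ^ 2) * Y)⁻¹ ≤ (2 * r)⁻¹ :=
          inv_anti₀ (by linarith) (by have := hrat d hd; linarith)
        have b2 : 0 ≤ (2 * s * d)⁻¹ := by have := hrs d hd; apply inv_nonneg.2; linarith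
        have b3 : 0 ≤ (2 * r + e / √(e ^ 2 - q ^ 2) * Y)⁻¹ := by
          have := hrat e he'; apply inv_nonneg.2; linarith
        have b4 : (2 * s * e)⁻¹ ≤ (2 * r)⁻¹ := inv_anti₀ (by linarith) (hrs e he')
        have b5 : 2 / r = 2 / (2 * r) + ((2 * r)⁻¹ + (2 * r)⁻¹) := by field_simp; norm_num
        rw [b5]; linarith
      · refine ContinuousOn.sub (ContinuousOn.div (hcont.mono hsub).neg.neg
          ((ContinuousOn.add continuousOn_const fun x hx =>
            (hratio x (hsub hx)).continuousAt.continuousWithinAt).pow 2) fun x hx => ?_)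
          (ContinuousOn.div continuousOn_const (by fun_prop) fun x hx => ?_)
        · have := hrat x hx
          positivity
        · have := hrs x hx
          exact (pow_pos (by linarith) 2).ne'
      · intro x hx
        have p1 := hrs x hx
        have p2 := hrat x hx
        have p3 := hnn x (hsub hx)
        set v := x / √(x ^ 2 - q ^ 2) * Y
        set w := q ^ 2 * Y / √(x ^ 2 - q ^ 2) ^ 3
        have e1 : |2 * s - w| ≤ w + 2 * s := by
          rw [abs_le]; constructor <;> linarith
        have e2 : 0 < 2 * s * x := by linarith
        calc |2 * s - w| / (2 * s * x + X + v) ^ 2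
            ≤ (w + 2 * s) / (2 * s * x + X + v) ^ 2 := by gcongr
          _ = w / (2 * s * x + X + v) ^ 2 + 2 * s / (2 * s * x + X + v) ^ 2 := add_div _ _ _
          _ ≤ w / (2 * r + v) ^ 2 + 2 * s / (2 * s * x) ^ 2 := by
              gcongr
              · linarith
              · linarith
          _ = _ := by ring
    have h38 : 3 / r ≤ 8 / r := by gcongr; norm_num
    have h3r : 3 / r = 1 / r + 2 / r := by ring
    have hr1 : 0 < 1 / r := by positivity
    rcases le_total d (1 / r) with hd | hd
    · refine (hshort d hcd hd).trans ?_
      gcongr; norm_num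
    rcases le_total c (1 / r) with hc' | hc'
    · rw [← intervalIntegral.integral_add_adjacent_intervals (b := 1 / r)
        (hcE.intervalIntegrable _ _) (hcE.intervalIntegrable _ _)]
      refine (norm_add_le _ _).trans ((add_le_add (hshort _ hc' le_rfl)
        (hlong _ hc' hd le_rfl)).trans ?_)
      linarith
    · exact (hlong c le_rfl hcd hc').trans (by gcongr; norm_num)

theorem OscBound.mul_gaussian {F : ℝ → ℂ} {S : Set ℝ} [S.OrdConnected] {J : ℝ}
    (hF : OscBound F S J) (hε : 0 ≤ ε) (hS : S ⊆ Set.Ici 0) :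
    OscBound (fun x => (Real.exp (-ε * x ^ 2) : ℂ) * F x) S (2 * J) := by
  refine hF.mul_monotone (a' := fun x => Real.exp (-ε * x ^ 2) * (-ε * (2 * x)))
    (fun x _ => ?_) (by fun_prop) (fun x _ => (Real.exp_pos _).le) (fun x _ => ?_)
    (Or.inr fun x hx => ?_)
  · simpa using ((hasDerivAt_pow 2 x).const_mul (-ε)).exp
  · rw [Real.exp_le_one_iff]; nlinarith [sq_nonneg x]
  · have : 0 ≤ x := hS hx
    have := Real.exp_pos (-ε * x ^ 2)
    refine mul_nonpos_of_nonneg_of_nonpos this.le ?_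
    nlinarith

/-- The transmission integrand on the real axis with phase `exp (i s x²)` and damping
`exp (-ε x²)`. -/
noncomputable def realTransmission (q ε s X Y : ℝ) (x : ℝ) : ℂ :=
  Complex.exp (-(ε - s * Complex.I) * (x : ℂ) ^ 2) * transmissionSymbol q X Y x

/-- Beyond q the amplitude x(x − ℓ)/q² decreases from the value 1 at x = q. It and the Gaussian are
monotone factors, each costing 2, hence 8 · 2 · 2. -/
theorem oscBound_realTransmission_Ioi (hq : 0 < q) (hε : 0 ≤ ε) (hs : s ≠ 0) (hX : 0 ≤ X)
    (hY : 0 ≤ Y) : OscBound (realTransmission q ε s X Y) (Set.Ioi q) (32 / √|s|) := by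
  have h := ((oscBound_transmission_phase hq.le hs hX hY).mul_monotone
    (a := fun x => x * (x - √(x ^ 2 - q ^ 2)) / q ^ 2)
    (a' := fun x => -(x - √(x ^ 2 - q ^ 2)) ^ 2 / (√(x ^ 2 - q ^ 2) * q ^ 2))
    (fun x hx => ?_) ?_ (fun x hx => ?_) (fun x hx => ?_) (Or.inr fun x hx => ?_)).mul_gaussian
    hε (fun x hx => (hq.trans hx).le)
  · refine (h.mono (le_of_eq (by ring))).congr fun x hx => ?_
    have hx : q < x := hx
    rw [realTransmission, transmissionSymbol, stepMomentum_of_lt hq.le hx]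
    push_cast
    rw [show -((ε : ℂ) - s * Complex.I) * (x : ℂ) ^ 2
      = -ε * (x : ℂ) ^ 2 + Complex.I * (s * (x : ℂ) ^ 2) by ring, Complex.exp_add,
      show Complex.I * ((s : ℂ) * x ^ 2 + x * X + ((√(x ^ 2 - q ^ 2) : ℝ) : ℂ) * Y)
        = Complex.I * (s * (x : ℂ) ^ 2) + Complex.I * (x * X + ((√(x ^ 2 - q ^ 2) : ℝ) : ℂ) * Y)
        by ring, Complex.exp_add]
    ring
  · have hx : q < x := hx
    obtain ⟨hl, hd⟩ := hasDerivAt_sqrt_sq_sub hq.le hx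
    have hl2 : √(x ^ 2 - q ^ 2) ^ 2 = x ^ 2 - q ^ 2 := Real.sq_sqrt (by nlinarith)
    refine (((hasDerivAt_id x).mul ((hasDerivAt_id x).sub hd)).div_const (q ^ 2)).congr_deriv ?_
    simp only [id, Pi.sub_apply]
    generalize √(x ^ 2 - q ^ 2) = l at *
    field_simp
    ring
  · refine ContinuousOn.div (by fun_prop) (by fun_prop) fun x hx => ?_
    have := (hasDerivAt_sqrt_sq_sub hq.le hx).1
    positivity
  · have hx : q < x := hx
    have : √(x ^ 2 - q ^ 2) ≤ x := by
      rw [Real.sqrt_le_left (by linarith)]; nlinarith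
    have : 0 < x := hq.trans hx
    have : 0 ≤ x - √(x ^ 2 - q ^ 2) := by linarith
    positivity
  · have hx : q < x := hx
    obtain ⟨hl, hd⟩ := hasDerivAt_sqrt_sq_sub hq.le hx
    have hl2 : √(x ^ 2 - q ^ 2) ^ 2 = x ^ 2 - q ^ 2 := Real.sq_sqrt (by nlinarith)
    rw [div_le_one (by positivity)]
    have : √(x ^ 2 - q ^ 2) ≤ x := by
      rw [Real.sqrt_le_left (by linarith)]; nlinarith
    nlinarith
  · have := (hasDerivAt_sqrt_sq_sub hq.le hx).1
    rw [neg_div]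
    have : 0 ≤ (x - √(x ^ 2 - q ^ 2)) ^ 2 / (√(x ^ 2 - q ^ 2) * q ^ 2) := by positivity
    linarith

/-- In the tunnelling range ℓ = iκ with κ = √(q² − x²), so the phase is purely quadratic and e^{−Yκ}
is an increasing amplitude. The prefactor splits as (x/q)² − i (x/q)(κ/q), a sum of products of
monotone factors. Each summand carries four such factors in all, hence 2 · (8 · 2⁴). -/
theorem oscBound_realTransmission_Ioo (hq : 0 < q) (hε : 0 ≤ ε) (hs : s ≠ 0)
    (hY : 0 ≤ Y) : OscBound (realTransmission q ε s X Y) (Set.Ioo 0 q) (256 / √|s|) := by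
  have hlin : ∀ x ∈ Set.Ioo 0 q, 0 ≤ x / q ∧ x / q ≤ 1 := fun x hx => by
    have := hx.1
    exact ⟨by positivity, (div_le_one hq).2 hx.2.le⟩
  have hlin' : ∀ x ∈ Set.Ioo 0 q, HasDerivAt (fun x => x / q) (1 / q) x := fun x _ =>
    (hasDerivAt_id x).div_const q
  have hκc : ContinuousOn (fun x => -x / √(q ^ 2 - x ^ 2)) (Set.Ioo 0 q) :=
    ContinuousOn.div (by fun_prop) (by fun_prop) fun x hx => (hasDerivAt_sqrt_sub_sq hx).1.ne'
  have h1 := (((oscBound_quadratic hs (Set.Ioo 0 q) X).mul_monotone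
    (a := fun x => Real.exp (-Y * √(q ^ 2 - x ^ 2)))
    (a' := fun x => Real.exp (-Y * √(q ^ 2 - x ^ 2)) * (-Y * (-x / √(q ^ 2 - x ^ 2))))
    (fun x hx => ((hasDerivAt_sqrt_sub_sq hx).2.const_mul (-Y)).exp)
    (ContinuousOn.mul (by fun_prop) (continuousOn_const.mul hκc))
    (fun x _ => (Real.exp_pos _).le)
    (fun x _ => by
      rw [Real.exp_le_one_iff]
      have := mul_nonneg hY (Real.sqrt_nonneg (q ^ 2 - x ^ 2)); linarith)
    (Or.inl fun x hx => ?_)).mul_gaussian hε (fun x hx => hx.1.le)).mul_monotone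
    (a := fun x => x / q) (a' := fun _ => 1 / q) hlin' continuousOn_const
    (fun x hx => (hlin x hx).1) (fun x hx => (hlin x hx).2) (Or.inl fun x _ => by positivity)
  · have h2 := h1.mul_monotone (a := fun x => x / q) (a' := fun _ => 1 / q) hlin'
      continuousOn_const (fun x hx => (hlin x hx).1) (fun x hx => (hlin x hx).2)
      (Or.inl fun x _ => by positivity)
    have h3 := h1.mul_monotone (a := fun x => √(q ^ 2 - x ^ 2) / q)
      (a' := fun x => -x / √(q ^ 2 - x ^ 2) / q)
      (fun x hx => (hasDerivAt_sqrt_sub_sq hx).2.div_const q) (hκc.div_const q)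
      (fun x hx => by positivity)
      (fun x hx => by
        rw [div_le_one hq, Real.sqrt_le_left hq.le]; nlinarith [sq_nonneg x])
      (Or.inr fun x hx => by
        have := hx.1
        rw [neg_div, neg_div]
        have : 0 ≤ x / √(q ^ 2 - x ^ 2) / q := by positivity
        linarith)
    refine ((h2.add (h3.const_mul (-Complex.I))).mono (le_of_eq ?_)).congr fun x hx => ?_
    · simp; ring
    · have hxq : |x| < q := by rw [abs_of_pos hx.1]; exact hx.2
      rw [realTransmission, transmissionSymbol, stepMomentum_of_abs_lt hxq]
      push_cast
      rw [show -((ε : ℂ) - s * Complex.I) * (x : ℂ) ^ 2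
        = -ε * (x : ℂ) ^ 2 + Complex.I * (s * (x : ℂ) ^ 2) by ring, Complex.exp_add,
        mul_add Complex.I ((x : ℂ) * X),
        show Complex.I * (Complex.I * ((√(q ^ 2 - x ^ 2) : ℝ) : ℂ) * Y)
          = -Y * ((√(q ^ 2 - x ^ 2) : ℝ) : ℂ) by
            linear_combination (((√(q ^ 2 - x ^ 2) : ℝ) : ℂ) * Y) * Complex.I_sq,
        mul_add Complex.I ((s : ℂ) * x ^ 2), Complex.exp_add, Complex.exp_add]
      ring
  · have := hx.1
    refine mul_nonneg (Real.exp_pos _).le ?_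
    rw [neg_div, neg_mul_neg]
    positivity

theorem integrable_realTransmission (hq : 0 ≤ q) (hε : 0 < ε) :
    Integrable (realTransmission q ε s X Y) := by
  have h := expBdd_transmissionSymbol hq X Y (η := 0) le_rfl
  simp only [Complex.ofReal_zero, zero_mul, add_zero] at h
  exact h.integrable (τ := ε - s * Complex.I) (by simpa using hε)

/-- Since ℓ(−x) is minus the conjugate of ℓ(x), the negative half line repeats the positive one with
s reversed. The estimates cover both signs of s. -/
theorem realTransmission_neg (x : ℝ) :
    realTransmission q ε s X Y (-x) = (starRingEnd ℂ) (realTransmission q ε (-s) X Y x) := by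
  simp only [realTransmission, transmissionSymbol, stepMomentum_neg_ofReal]
  rw [map_mul, map_mul, ← Complex.exp_conj, ← Complex.exp_conj]
  simp only [map_mul, map_neg, map_sub, map_add, Complex.conj_I, Complex.conj_ofReal, map_pow,
    map_div₀]
  push_cast
  congr 2
  · ring_nf
  · ring
  · congr 1; ring

theorem norm_integral_Ioi_realTransmission_le (hq : 0 < q) (hε : 0 < ε) (hs : s ≠ 0) (hX : 0 ≤ X)
    (hY : 0 ≤ Y) : ‖∫ x in Set.Ioi 0, realTransmission q ε s X Y x‖ ≤ 288 / √|s| := by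
  have hi := integrable_realTransmission (s := s) (X := X) (Y := Y) hq.le hε
  rw [← intervalIntegral.integral_interval_add_Ioi hi.integrableOn hi.integrableOn (b := q)]
  refine (norm_add_le _ _).trans ((add_le_add
    ((oscBound_realTransmission_Ioo hq hε.le hs hY).norm_integral_Ioo_le hq hi.integrableOn)
    ((oscBound_realTransmission_Ioi hq hε.le hs hX hY).norm_integral_Ioi_le
      hi.integrableOn)).trans (le_of_eq (by ring)))

/-- Uniform decay of the transmission integral on the real axis. -/
theorem norm_integral_realTransmission_le (hq : 0 < q) (hε : 0 < ε) (hs : s ≠ 0) (hX : 0 ≤ X)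
    (hY : 0 ≤ Y) : ‖∫ x, realTransmission q ε s X Y x‖ ≤ 576 / √|s| := by
  have hi := integrable_realTransmission (s := s) (X := X) (Y := Y) hq.le hε
  rw [← intervalIntegral.integral_Iic_add_Ioi hi.integrableOn hi.integrableOn (b := 0),
    ← neg_zero, ← integral_comp_neg_Ioi, neg_zero]
  simp only [realTransmission_neg]
  rw [integral_conj]
  refine (norm_add_le _ _).trans ?_
  rw [Complex.norm_conj]
  have h1 := norm_integral_Ioi_realTransmission_le hq hε (neg_ne_zero.2 hs) hX hY
  have h2 := norm_integral_Ioi_realTransmission_le hq hε hs hX hY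
  rw [abs_neg] at h1
  exact (add_le_add h1 h2).trans (le_of_eq (by ring))

end RealAxis

/-! ### Contour shifts and the building blocks of the propagator in complex time. -/

/-- The integral of `F` over the horizontal line at height `η`. -/
noncomputable def lineIntegral (η : ℝ) (F : ℂ → ℂ) : ℂ := ∫ x : ℝ, F (x + η * Complex.I)

theorem norm_gaussian_line (τ : ℂ) (x y : ℝ) :
    ‖Complex.exp (-τ * ((x : ℂ) + y * Complex.I) ^ 2)‖
      = Real.exp (-τ.re * (x ^ 2 - y ^ 2) + 2 * τ.im * x * y) := by
  rw [Complex.norm_exp]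
  congr 1
  simp [sq]
  ring

theorem expBdd_gaussian_line (τ : ℂ) (η : ℝ) :
    ∃ f : ℝ → ℂ, ExpBdd f ∧ ∀ x : ℝ, Complex.exp (-τ * ((x : ℂ) + η * Complex.I) ^ 2)
      = Complex.exp (-τ * (x : ℂ) ^ 2) * f x := by
  refine ⟨fun x => Complex.exp (-(2 * τ * η * Complex.I) * x + τ * η ^ 2),
    ((LinBdd.ofReal.const_mul _).add (LinBdd.const _)).exp, fun x => ?_⟩
  rw [← Complex.exp_add]
  congr 1
  linear_combination (-τ * η ^ 2) * Complex.I_sq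

theorem integrable_gaussian_line {τ : ℂ} (hτ : 0 < τ.re) {η : ℝ} {G : ℂ → ℂ}
    (hG : ExpBdd fun x : ℝ => G (x + η * Complex.I)) :
    Integrable fun x : ℝ => Complex.exp (-τ * ((x : ℂ) + η * Complex.I) ^ 2)
      * G (x + η * Complex.I) := by
  obtain ⟨f, hf, hfe⟩ := expBdd_gaussian_line τ η
  simp_rw [hfe, mul_assoc]
  exact (hf.mul hG).integrable hτ

/-- Shifting the line of integration of a Gaussian integral. -/
theorem lineIntegral_gaussian_shift {G : ℂ → ℂ} {τ : ℂ} (hτ : 0 < τ.re) {a b : ℝ} (hab : a ≤ b)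
    (hc : ContinuousOn G {z : ℂ | a ≤ z.im ∧ z.im ≤ b})
    (hd : ∀ z : ℂ, a < z.im → z.im < b → DifferentiableAt ℂ G z)
    (hB : ∃ A B : ℝ, ∀ z : ℂ, a ≤ z.im → z.im ≤ b → ‖G z‖ ≤ B * Real.exp (A * |z.re|)) :
    lineIntegral a (fun z => Complex.exp (-τ * z ^ 2) * G z)
      = lineIntegral b (fun z => Complex.exp (-τ * z ^ 2) * G z) := by
  obtain ⟨A, B, hAB⟩ := hB
  set f : ℂ → ℂ := fun z => Complex.exp (-τ * z ^ 2) * G z with hf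
  have hline : ∀ η, a ≤ η → η ≤ b → ExpBdd fun x : ℝ => G (x + η * Complex.I) := by
    intro η h1 h2
    refine ⟨hc.comp_continuous (by fun_prop) fun x => by simpa using ⟨h1, h2⟩, A, B, fun x => ?_⟩
    have := hAB (x + η * Complex.I) (by simpa using h1) (by simpa using h2)
    simpa using this
  have hB0 : 0 ≤ B := by
    have h1 := hAB (a * Complex.I) (by simp) (by simpa using hab)
    have h2 := (norm_nonneg _).trans h1
    simpa using h2
  have hia : Integrable fun x : ℝ => f (x + a * Complex.I) :=
    integrable_gaussian_line hτ (hline a le_rfl hab)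
  have hib : Integrable fun x : ℝ => f (x + b * Complex.I) :=
    integrable_gaussian_line hτ (hline b hab le_rfl)
  have hnat : Tendsto (fun n : ℕ => (n : ℝ)) atTop atTop := tendsto_natCast_atTop_atTop
  have hta := intervalIntegral_tendsto_integral hia (tendsto_neg_atTop_atBot.comp hnat) hnat
  have htb := intervalIntegral_tendsto_integral hib (tendsto_neg_atTop_atBot.comp hnat) hnat
  set M := max |a| |b| with hM
  set K := 2 * |τ.im| * M + A with hK
  -- The vertical sides at ±n vanish: K collects the linear growth coming from the cross term of τz²
  -- and from G, and completing the square leaves a factor e^{−Re τ · n²/2}.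
  have hside : ∀ σ : ℝ, |σ| = 1 → Tendsto (fun n : ℕ => ∫ y in a..b,
      f (((σ * n : ℝ) : ℂ) + y * Complex.I)) atTop (𝓝 0) := by
    intro σ hσ
    have hbound : ∀ n : ℕ, ‖∫ y in a..b, f (((σ * n : ℝ) : ℂ) + y * Complex.I)‖
        ≤ (B * Real.exp (τ.re * M ^ 2 + K ^ 2 / (2 * τ.re))) * |b - a|
          * Real.exp (-(τ.re / 2) * (n : ℝ) ^ 2) := by
      intro n
      refine (intervalIntegral.norm_integral_le_of_norm_le_const
        (C := (B * Real.exp (τ.re * M ^ 2 + K ^ 2 / (2 * τ.re)))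
          * Real.exp (-(τ.re / 2) * (n : ℝ) ^ 2)) fun y hy => ?_).trans (le_of_eq (by ring))
      rw [Set.uIoc_of_le hab] at hy
      have hn : |σ * n| = n := by rw [abs_mul, hσ, one_mul, Nat.abs_cast]
      have hyM : |y| ≤ M := abs_le_max_abs_abs hy.1.le hy.2
      have hG := hAB (((σ * n : ℝ) : ℂ) + y * Complex.I) (by simpa using hy.1.le)
        (by simpa using hy.2)
      rw [show (((σ * n : ℝ) : ℂ) + y * Complex.I).re = σ * n by simp, hn] at hG
      rw [hf]
      simp only [norm_mul]
      rw [norm_gaussian_line]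
      have h1 : 2 * τ.im * (σ * n) * y ≤ 2 * |τ.im| * n * M := by
        refine (le_abs_self _).trans ?_
        rw [abs_mul, abs_mul, abs_mul, hn, abs_two]
        gcongr
      have h2 : y ^ 2 ≤ M ^ 2 := sq_le_sq.2 (hyM.trans (le_abs_self _))
      have h3 : (σ * n) ^ 2 = (n : ℝ) ^ 2 := by rw [← sq_abs, hn]
      have h4 : K * n ≤ τ.re / 2 * (n : ℝ) ^ 2 + K ^ 2 / (2 * τ.re) := by
        have e : τ.re / 2 * (n : ℝ) ^ 2 + K ^ 2 / (2 * τ.re) - K * n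
            = (K - τ.re * n) ^ 2 / (2 * τ.re) := by field_simp; ring
        have : 0 ≤ (K - τ.re * n) ^ 2 / (2 * τ.re) := by positivity
        linarith
      calc _ ≤ Real.exp (-τ.re * ((σ * n) ^ 2 - y ^ 2) + 2 * τ.im * (σ * n) * y)
            * (B * Real.exp (A * n)) := by gcongr
        _ = B * Real.exp (-τ.re * ((σ * n) ^ 2 - y ^ 2) + 2 * τ.im * (σ * n) * y + A * n) := by
            rw [Real.exp_add _ (A * n)]; ring
        _ ≤ B * Real.exp (τ.re * M ^ 2 + K ^ 2 / (2 * τ.re) + -(τ.re / 2) * (n : ℝ) ^ 2) := by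
            refine mul_le_mul_of_nonneg_left (Real.exp_le_exp.2 ?_) hB0
            rw [h3]
            have := mul_le_mul_of_nonneg_left h2 hτ.le
            rw [hK] at h4
            nlinarith
        _ = _ := by rw [Real.exp_add]; ring
    refine squeeze_zero_norm hbound ?_
    rw [← mul_zero ((B * Real.exp (τ.re * M ^ 2 + K ^ 2 / (2 * τ.re))) * |b - a|)]
    refine Tendsto.const_mul _ (Real.tendsto_exp_atBot.comp ?_)
    have : Tendsto (fun n : ℕ => (n : ℝ) ^ 2) atTop atTop :=
      (tendsto_pow_atTop two_ne_zero).comp hnat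
    exact this.const_mul_atTop_of_neg (by linarith)
  have hrect : ∀ n : ℕ, (∫ x in (-(n : ℝ))..n, f (x + a * Complex.I))
      - (∫ x in (-(n : ℝ))..n, f (x + b * Complex.I))
      + Complex.I * (∫ y in a..b, f ((((1 : ℝ) * n : ℝ) : ℂ) + y * Complex.I))
      - Complex.I * (∫ y in a..b, f ((((-1 : ℝ) * n : ℝ) : ℂ) + y * Complex.I)) = 0 := by
    intro n
    have hcf : ContinuousOn f {z : ℂ | a ≤ z.im ∧ z.im ≤ b} :=
      ContinuousOn.mul (by fun_prop) hc
    have h := Complex.integral_boundary_rect_eq_zero_of_continuousOn_of_differentiableOn f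
      ⟨-n, a⟩ ⟨n, b⟩ (hcf.mono fun z hz => ?_) fun z hz => ?_
    · simpa [smul_eq_mul] using h
    · rw [Complex.mem_reProdIm] at hz
      simp only [Set.uIcc_of_le hab] at hz
      exact hz.2
    · rw [Complex.mem_reProdIm] at hz
      simp only [min_eq_left hab, max_eq_right hab] at hz
      refine DifferentiableAt.differentiableWithinAt ?_
      exact DifferentiableAt.mul (by fun_prop) (hd z hz.2.1 hz.2.2)
  have hlim := ((hta.sub htb).add ((hside 1 (by simp)).const_mul Complex.I)).sub
    ((hside (-1) (by simp)).const_mul Complex.I)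
  have h0 := tendsto_nhds_unique (hlim.congr hrect) tendsto_const_nhds
  simp only [mul_zero, add_zero, sub_zero] at h0
  exact sub_eq_zero.1 h0

/-- Re z and Re ℓ have the same sign and both imaginary parts are nonnegative, so |z| ≤ |z + ℓ| and
the amplitude z/(z + ℓ) is at most 1. The decay in Y uses Im ℓ ≥ Im z. -/
theorem norm_transmissionSymbol_le {q X Y : ℝ} (hq : 0 < q) (hY : 0 ≤ Y) {z : ℂ}
    (hz : 0 ≤ z.im) : ‖transmissionSymbol q X Y z‖ ≤ Real.exp (-z.im * (X + Y)) := by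
  obtain ⟨h1, h2⟩ := stepMomentum_im_ge (q := q) hz
  have hs := stepMomentum_sq q z
  rw [transmissionSymbol, norm_mul]
  set l := stepMomentum q z
  have hle : ‖z‖ ≤ ‖z + l‖ := by
    refine le_of_sq_le_sq ?_ (norm_nonneg _)
    rw [Complex.sq_norm, Complex.sq_norm, Complex.normSq_apply, Complex.normSq_apply,
      Complex.add_re, Complex.add_im]
    nlinarith [mul_nonneg hz (hz.trans h1), sq_nonneg l.re, sq_nonneg l.im]
  have hm : ‖z * (z - l) / (q : ℂ) ^ 2‖ ≤ 1 := by
    rw [norm_div, div_le_one (by rw [norm_pos_iff]; exact_mod_cast (pow_pos hq 2).ne'), norm_mul]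
    calc ‖z‖ * ‖z - l‖ ≤ ‖z + l‖ * ‖z - l‖ := by gcongr
      _ = ‖(q : ℂ) ^ 2‖ := by
        rw [← norm_mul]; congr 1; linear_combination -hs
  have he : ‖Complex.exp (Complex.I * (z * X + l * Y))‖ ≤ Real.exp (-z.im * (X + Y)) := by
    rw [Complex.norm_exp, Complex.I_mul_re, Complex.add_im, Complex.im_mul_ofReal,
      Complex.im_mul_ofReal]
    refine Real.exp_le_exp.2 ?_
    nlinarith [mul_le_mul_of_nonneg_right h1 hY]
  calc _ ≤ 1 * Real.exp (-z.im * (X + Y)) := mul_le_mul hm he (norm_nonneg _) zero_le_one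
    _ = _ := one_mul _

theorem continuousOn_transmissionSymbol (q X Y : ℝ) :
    ContinuousOn (transmissionSymbol q X Y) {z : ℂ | 0 ≤ z.im} := by
  have := continuousOn_stepMomentum q
  unfold transmissionSymbol
  fun_prop

theorem differentiableAt_transmissionSymbol (q X Y : ℝ) {z : ℂ} (hz : 0 < z.im) :
    DifferentiableAt ℂ (transmissionSymbol q X Y) z := by
  have := differentiableAt_stepMomentum q hz
  unfold transmissionSymbol
  fun_prop

/-- The transmission part of the propagator in complex time `τ`. -/
noncomputable def transmission (q : ℝ) (τ : ℂ) (X Y : ℝ) : ℂ :=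
  lineIntegral 1 fun z => Complex.exp (-τ * z ^ 2) * transmissionSymbol q X Y z

/-- The free propagator in complex time `τ`, up to the factor `2π`. -/
noncomputable def freeWave (τ : ℂ) (X : ℝ) : ℂ :=
  lineIntegral 1 fun z => Complex.exp (-τ * z ^ 2) * Complex.exp (Complex.I * (z * X))

/-- The symbol is bounded and holomorphic above the real axis, so the height is free: 0 serves the
oscillatory bound, 1 the matching at the step, and 1/√ε the decay at real τ. -/
theorem lineIntegral_transmission {q : ℝ} {τ : ℂ} {X Y : ℝ} (hq : 0 < q) (hτ : 0 < τ.re)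
    (hX : 0 ≤ X) (hY : 0 ≤ Y) {η : ℝ} (hη : 0 ≤ η) :
    lineIntegral η (fun z => Complex.exp (-τ * z ^ 2) * transmissionSymbol q X Y z)
      = transmission q τ X Y := by
  have key : ∀ a b : ℝ, 0 ≤ a → a ≤ b →
      lineIntegral a (fun z => Complex.exp (-τ * z ^ 2) * transmissionSymbol q X Y z)
        = lineIntegral b (fun z => Complex.exp (-τ * z ^ 2) * transmissionSymbol q X Y z) := by
    intro a b ha hab
    refine lineIntegral_gaussian_shift hτ hab
      ((continuousOn_transmissionSymbol q X Y).mono fun z hz => ha.trans hz.1)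
      (fun z hz _ => differentiableAt_transmissionSymbol q X Y (ha.trans_lt hz))
      ⟨0, 1, fun z hz _ => (norm_transmissionSymbol_le hq hY (ha.trans hz)).trans ?_⟩
    rw [zero_mul, Real.exp_zero, one_mul, Real.exp_le_one_iff]
    nlinarith [ha.trans hz]
  rcases le_total η 1 with h | h
  · exact key η 1 hη h
  · exact (key 1 η zero_le_one h).symm

/-- Without a branch point the line may also enter the lower half plane. This lets the direct wave
be written with exponentials decaying to the left. -/
theorem lineIntegral_entire {τ : ℂ} (hτ : 0 < τ.re) (X : ℝ) {p : ℂ → ℂ} (hp : Differentiable ℂ p)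
    (hpb : ∀ z, ‖p z‖ ≤ 1 + ‖z‖) (a b : ℝ) :
    lineIntegral a (fun z => Complex.exp (-τ * z ^ 2) * (p z * Complex.exp (Complex.I * (z * X))))
      = lineIntegral b
        (fun z => Complex.exp (-τ * z ^ 2) * (p z * Complex.exp (Complex.I * (z * X)))) := by
  have key : ∀ a b : ℝ, a ≤ b →
      lineIntegral a (fun z => Complex.exp (-τ * z ^ 2) * (p z * Complex.exp (Complex.I * (z * X))))
      = lineIntegral b
        (fun z => Complex.exp (-τ * z ^ 2) * (p z * Complex.exp (Complex.I * (z * X)))) := by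
    intro a b hab
    have hd : Differentiable ℂ fun z : ℂ => p z * Complex.exp (Complex.I * (z * X)) := by fun_prop
    set M := max |a| |b|
    refine lineIntegral_gaussian_shift hτ hab hd.continuous.continuousOn (fun z _ _ => hd z)
      ⟨1, (1 + M) * Real.exp (M * |X|), fun z h1 h2 => ?_⟩
    have hM : |z.im| ≤ M := abs_le_max_abs_abs h1 h2
    have hM0 : 0 ≤ M := (abs_nonneg _).trans hM
    rw [norm_mul, Complex.norm_exp, Complex.I_mul_re, Complex.im_mul_ofReal, one_mul]
    have e1 : ‖p z‖ ≤ (1 + M) * Real.exp |z.re| := by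
      have h3 := (hpb z).trans (add_le_add le_rfl (Complex.norm_le_abs_re_add_abs_im z))
      have h4 := Real.add_one_le_exp |z.re|
      nlinarith [abs_nonneg z.re]
    have e2 : Real.exp (-(z.im * X)) ≤ Real.exp (M * |X|) := by
      refine Real.exp_le_exp.2 ((neg_le_abs _).trans ?_)
      rw [abs_mul]; gcongr
    calc _ ≤ ((1 + M) * Real.exp |z.re|) * Real.exp (M * |X|) :=
          mul_le_mul e1 e2 (Real.exp_pos _).le (by positivity)
      _ = _ := by ring
  rcases le_total a b with h | h
  · exact key a b h
  · exact (key b a h).symm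

theorem lineIntegral_freeWave {τ : ℂ} (hτ : 0 < τ.re) (X η : ℝ) :
    lineIntegral η (fun z => Complex.exp (-τ * z ^ 2) * Complex.exp (Complex.I * (z * X)))
      = freeWave τ X := by
  have := lineIntegral_entire hτ X (p := fun _ => 1) (by fun_prop)
    (fun z => by simp) η 1
  simpa [freeWave] using this

theorem freeWave_eq {τ : ℂ} (hτ : 0 < τ.re) (X : ℝ) :
    freeWave τ X = (Real.pi / τ) ^ (1 / 2 : ℂ) * Complex.exp (-(X : ℂ) ^ 2 / (4 * τ)) := by
  rw [← lineIntegral_freeWave hτ X 0, ← fourierIntegral_gaussian hτ X, lineIntegral]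
  congr 1
  funext x
  simp only [Complex.ofReal_zero, zero_mul, add_zero]
  rw [mul_comm]
  congr 2
  ring

theorem freeWave_neg {τ : ℂ} (hτ : 0 < τ.re) (X : ℝ) : freeWave τ (-X) = freeWave τ X := by
  rw [freeWave_eq hτ, freeWave_eq hτ]
  push_cast
  rw [neg_sq]

theorem norm_pi_div_cpow_half {τ : ℂ} (hτ : 0 < τ.re) :
    ‖((Real.pi : ℂ) / τ) ^ (1 / 2 : ℂ)‖ = √(Real.pi / ‖τ‖) := by
  have h := Complex.norm_cpow_of_ne_zero (z := (Real.pi : ℂ) / τ) (div_ne_zero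
    (by exact_mod_cast Real.pi_ne_zero) (by rintro rfl; simp at hτ)) (1 / 2)
  rw [h]
  have e1 : (1 / 2 : ℂ).re = 1 / 2 := by norm_num
  have e2 : (1 / 2 : ℂ).im = 0 := by norm_num
  rw [e1, e2, mul_zero, Real.exp_zero, div_one, Real.sqrt_eq_rpow, norm_div, Complex.norm_real,
    Real.norm_eq_abs, abs_of_pos Real.pi_pos]

theorem norm_freeWave_le {τ : ℂ} (hτ : 0 < τ.re) (hs : τ.im ≠ 0) (X : ℝ) :
    ‖freeWave τ X‖ ≤ 2 / √|τ.im| := by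
  rw [freeWave_eq hτ, norm_mul, norm_pi_div_cpow_half hτ]
  have hs' : 0 < |τ.im| := abs_pos.2 hs
  have h1 : ‖Complex.exp (-(X : ℂ) ^ 2 / (4 * τ))‖ ≤ 1 := by
    rw [Complex.norm_exp, Real.exp_le_one_iff]
    have h4 : -(X : ℂ) ^ 2 / (4 * τ) = ((-(X ^ 2 / 4) : ℝ) : ℂ) * τ⁻¹ := by
      push_cast; rw [div_eq_mul_inv, mul_inv]; ring
    rw [h4, Complex.re_ofReal_mul, Complex.inv_re]
    have : 0 ≤ X ^ 2 / 4 * (τ.re / Complex.normSq τ) :=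
      mul_nonneg (by positivity) (div_nonneg hτ.le (Complex.normSq_nonneg _))
    linarith
  have h2 : √(Real.pi / ‖τ‖) ≤ 2 / √|τ.im| := by
    rw [show (2 : ℝ) = √4 by rw [show (4 : ℝ) = 2 ^ 2 by norm_num]; simp, ← Real.sqrt_div' _ hs'.le]
    refine Real.sqrt_le_sqrt ?_
    exact div_le_div₀ (by norm_num) Real.pi_le_four hs' (Complex.abs_im_le_norm τ)
  calc _ ≤ 2 / √|τ.im| * 1 := mul_le_mul h2 h1 (norm_nonneg _) (by positivity)
    _ = _ := mul_one _

theorem norm_transmission_le {q : ℝ} {τ : ℂ} {X Y : ℝ} (hq : 0 < q) (hτ : 0 < τ.re)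
    (hs : τ.im ≠ 0) (hX : 0 ≤ X) (hY : 0 ≤ Y) : ‖transmission q τ X Y‖ ≤ 576 / √|τ.im| := by
  rw [← lineIntegral_transmission hq hτ hX hY le_rfl]
  have h := norm_integral_realTransmission_le (s := -τ.im) hq hτ (neg_ne_zero.2 hs) hX hY
  rw [abs_neg] at h
  convert h using 2
  rw [lineIntegral]
  congr 1
  funext x
  rw [realTransmission]
  have : ((τ.re : ℂ) - ((-τ.im : ℝ) : ℂ) * Complex.I) = τ := by
    push_cast; rw [neg_mul, sub_neg_eq_add]; exact Complex.re_add_im τ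
  rw [this]
  simp

/-- Completing the square gives X²/(4ε) ≥ X/√ε − 1; the −1 accounts for the factor e. -/
theorem norm_freeWave_real_le {ε X : ℝ} (hε : 0 < ε) :
    ‖freeWave ε X‖ ≤ Real.exp 1 * √(Real.pi / ε) * Real.exp (-X / √ε) := by
  rw [freeWave_eq (by simpa using hε), norm_mul, norm_pi_div_cpow_half (by simpa using hε),
    Complex.norm_real, Real.norm_eq_abs, abs_of_pos hε]
  have h : ‖Complex.exp (-(X : ℂ) ^ 2 / (4 * (ε : ℂ)))‖ ≤ Real.exp 1 * Real.exp (-X / √ε) := by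
    have : -(X : ℂ) ^ 2 / (4 * (ε : ℂ)) = ((-X ^ 2 / (4 * ε) : ℝ) : ℂ) := by push_cast; ring
    rw [this, Complex.norm_exp, Complex.ofReal_re, ← Real.exp_add]
    refine Real.exp_le_exp.2 ?_
    obtain ⟨r, hr, rfl⟩ : ∃ r : ℝ, 0 < r ∧ ε = r ^ 2 :=
      ⟨√ε, Real.sqrt_pos.2 hε, (Real.sq_sqrt hε.le).symm⟩
    rw [Real.sqrt_sq hr.le]
    have e : 1 + -X / r - -X ^ 2 / (4 * r ^ 2) = (2 * r - X) ^ 2 / (4 * r ^ 2) := by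
      field_simp; ring
    have : 0 ≤ (2 * r - X) ^ 2 / (4 * r ^ 2) := by positivity
    linarith
  calc _ ≤ √(Real.pi / ε) * (Real.exp 1 * Real.exp (-X / √ε)) := by gcongr
    _ = _ := by ring

/-- On the line at height 1/√ε the Gaussian grows by only e^{ε·(1/ε)} = e, while the symbol gains
e^{−(X+Y)/√ε}. -/
theorem norm_transmission_real_le {q ε X Y : ℝ} (hq : 0 < q) (hε : 0 < ε) (hX : 0 ≤ X)
    (hY : 0 ≤ Y) : ‖transmission q ε X Y‖
      ≤ Real.exp 1 * √(Real.pi / ε) * Real.exp (-(X + Y) / √ε) := by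
  have hr : 0 < √ε := Real.sqrt_pos.2 hε
  have hη : 0 < 1 / √ε := by positivity
  rw [← lineIntegral_transmission hq (by simpa using hε) hX hY hη.le, lineIntegral]
  refine (norm_integral_le_of_norm_le ((integrable_exp_neg_mul_sq hε).const_mul
    (Real.exp 1 * Real.exp (-(X + Y) / √ε))) (Eventually.of_forall fun x => ?_)).trans ?_
  · rw [norm_mul, norm_gaussian_line]
    have h1 := norm_transmissionSymbol_le (X := X) hq hY
      (z := (x : ℂ) + ((1 / √ε : ℝ) : ℂ) * Complex.I) (by simp)
    have h2 : ((x : ℂ) + ((1 / √ε : ℝ) : ℂ) * Complex.I).im = 1 / √ε := by simp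
    rw [h2] at h1
    have h3 : ε * (1 / √ε) ^ 2 = 1 := by
      rw [div_pow, Real.sq_sqrt hε.le]; field_simp
    have h4 : -(ε : ℂ).re * (x ^ 2 - (1 / √ε) ^ 2) + 2 * (ε : ℂ).im * x * (1 / √ε)
        = 1 + -ε * x ^ 2 := by
      simp only [Complex.ofReal_re, Complex.ofReal_im]; linear_combination h3
    rw [h4, Real.exp_add]
    calc _ ≤ Real.exp 1 * Real.exp (-ε * x ^ 2) * Real.exp (-(1 / √ε) * (X + Y)) := by gcongr
      _ = _ := by
        rw [show -(1 / √ε) * (X + Y) = -(X + Y) / √ε by ring]; ring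
  · rw [integral_const_mul, integral_gaussian]
    exact le_of_eq (by field_simp)

theorem integral_eq_integral_Ioi_add_neg {F : ℝ → ℂ} (hF : Integrable F) :
    ∫ x, F x = ∫ x in Set.Ioi 0, (F x + F (-x)) := by
  rw [integral_add hF.integrableOn hF.comp_neg.integrableOn, integral_comp_neg_Ioi, neg_zero,
    add_comm, intervalIntegral.integral_Iic_add_Ioi hF.integrableOn hF.integrableOn]

/-- Changing variables from the momentum in front of the step to the one behind it. -/
theorem lineIntegral_stepMomentum_exp {q Y : ℝ} {τ : ℂ} (hq : 0 < q) (hτ : 0 < τ.re)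
    (hY : 0 ≤ Y) :
    lineIntegral 1 (fun z => Complex.exp (-τ * z ^ 2) *
        (z * Complex.exp (Complex.I * (stepMomentum q z * Y))))
      = Complex.exp (-τ * q ^ 2) * lineIntegral 1 (fun z => Complex.exp (-τ * z ^ 2) *
        (z * Complex.exp (Complex.I * (z * Y)))) := by
  have hshift : lineIntegral 0 (fun z => Complex.exp (-τ * z ^ 2) *
        (z * Complex.exp (Complex.I * (stepMomentum q z * Y))))
      = lineIntegral 1 (fun z => Complex.exp (-τ * z ^ 2) *
        (z * Complex.exp (Complex.I * (stepMomentum q z * Y)))) := by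
    refine lineIntegral_gaussian_shift hτ zero_le_one ?_ (fun z hz _ => ?_)
      ⟨1, 2, fun z h0 h1 => ?_⟩
    · have := (continuousOn_stepMomentum q).mono
        (fun z hz => hz.1 : {z : ℂ | 0 ≤ z.im ∧ z.im ≤ 1} ⊆ {z : ℂ | 0 ≤ z.im})
      fun_prop
    · have := differentiableAt_stepMomentum q hz
      fun_prop
    · have h2 : ‖Complex.exp (Complex.I * (stepMomentum q z * Y))‖ ≤ 1 := by
        rw [Complex.norm_exp, Complex.I_mul_re, Complex.im_mul_ofReal, Real.exp_le_one_iff]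
        have := mul_nonneg (stepMomentum_im_nonneg q h0) hY
        linarith
      have h3 : ‖z‖ ≤ 2 * Real.exp (1 * |z.re|) := by
        refine (Complex.norm_le_abs_re_add_abs_im z).trans ?_
        rw [abs_of_nonneg h0, one_mul]
        have := Real.add_one_le_exp |z.re|
        have := abs_nonneg z.re
        linarith
      rw [norm_mul]
      calc ‖z‖ * _ ≤ (2 * Real.exp (1 * |z.re|)) * 1 :=
            mul_le_mul h3 h2 (norm_nonneg _) (by positivity)
        _ = _ := mul_one _
  rw [← hshift, lineIntegral_entire hτ Y (p := fun z => z) (by fun_prop) (fun z => by simp) 1 0]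
  simp only [lineIntegral, Complex.ofReal_zero, zero_mul, add_zero]
  set F : ℝ → ℂ := fun x => Complex.exp (-τ * (x : ℂ) ^ 2) *
    ((x : ℂ) * Complex.exp (Complex.I * (stepMomentum q x * Y))) with hFdef
  set G : ℝ → ℂ := fun x => Complex.exp (-τ * (x : ℂ) ^ 2) *
    ((x : ℂ) * Complex.exp (Complex.I * ((x : ℂ) * Y))) with hGdef
  have hF : Integrable F := by
    have hl := linBdd_stepMomentum hq.le (η := 0) le_rfl
    simp only [Complex.ofReal_zero, zero_mul, add_zero] at hl
    have := (LinBdd.ofReal.expBdd.mul ((hl.const_mul (Complex.I * Y)).exp)).integrable hτ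
    refine this.congr (Eventually.of_forall fun x => ?_)
    simp only [hFdef]
    ring_nf
  have hG : Integrable G := by
    have := (LinBdd.ofReal.expBdd.mul ((LinBdd.ofReal.const_mul (Complex.I * Y)).exp)).integrable hτ
    refine this.congr (Eventually.of_forall fun x => ?_)
    simp only [hGdef]
    ring_nf
  rw [integral_eq_integral_Ioi_add_neg hF, integral_eq_integral_Ioi_add_neg hG]
  set g : ℝ → ℂ := fun x => Complex.exp (-τ * (x : ℂ) ^ 2) * ((x : ℂ) *
    (Complex.exp (Complex.I * ((√(x ^ 2 - q ^ 2) : ℝ) * Y))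
      - Complex.exp (-(Complex.I * ((√(x ^ 2 - q ^ 2) : ℝ) * Y))))) with hg
  have hlq : stepMomentum q q = 0 := by
    have := stepMomentum_sq q q
    rw [sub_self] at this
    exact pow_eq_zero_iff two_ne_zero |>.1 this
  have hFg : ∀ x ∈ Set.Ici q, F x + F (-x) = g x := by
    intro x hx
    simp only [hFdef, hg, stepMomentum_neg_ofReal]
    rcases (Set.mem_Ici.1 hx).eq_or_lt with rfl | hlt
    · simp [hlq]
    · rw [stepMomentum_of_lt hq.le hlt, Complex.conj_ofReal]
      push_cast
      rw [neg_sq, neg_mul _ (Y : ℂ), mul_neg]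
      ring
  -- For 0 < x < q, ℓ is imaginary and takes the same value at x and −x, so the integrand is odd and
  -- the gap contributes nothing after folding.
  have hF0 : ∀ x ∈ Set.Ioi 0 \ Set.Ioi q, F x + F (-x) = 0 := by
    intro x hx
    have h0 : 0 < x := hx.1
    have h1 : x ≤ q := not_lt.1 hx.2
    simp only [hFdef, stepMomentum_neg_ofReal]
    rcases h1.eq_or_lt with rfl | hlt
    · simp [hlq]
    · rw [stepMomentum_of_abs_lt (by rwa [abs_of_pos h0])]
      simp
  have hsub : Set.Ioi q ⊆ Set.Ioi (0 : ℝ) := Set.Ioi_subset_Ioi hq.le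
  rw [setIntegral_eq_of_subset_of_forall_sdiff_eq_zero measurableSet_Ioi hsub hF0,
    setIntegral_congr_fun measurableSet_Ioi fun x hx => hFg x (le_of_lt hx)]
  have hpos : ∀ p : ℝ, 0 < p ^ 2 + q ^ 2 := fun p => by positivity
  -- The substitution is x = √(p² + q²): x dx = p dp, ℓ(x) = p, and e^{−τx²} splits off e^{−τq²}.
  have hsub2 : ∀ p ∈ Set.Ici (0 : ℝ), (p / √(p ^ 2 + q ^ 2)) • (g ∘ fun p => √(p ^ 2 + q ^ 2)) p
      = Complex.exp (-τ * q ^ 2) * (G p + G (-p)) := by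
    intro p hp
    have h1 := Real.sqrt_pos.2 (hpos p)
    have h2 : √(p ^ 2 + q ^ 2) ^ 2 = p ^ 2 + q ^ 2 := Real.sq_sqrt (hpos p).le
    have h3 : √(√(p ^ 2 + q ^ 2) ^ 2 - q ^ 2) = p := by
      rw [h2, add_sub_cancel_right, Real.sqrt_sq hp]
    simp only [Function.comp, hg, hGdef, h3, Complex.real_smul]
    rw [← Complex.ofReal_pow √(p ^ 2 + q ^ 2), h2]
    push_cast
    rw [show -τ * ((p : ℂ) ^ 2 + (q : ℂ) ^ 2) = -τ * q ^ 2 + -τ * p ^ 2 by ring, Complex.exp_add,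
      neg_sq, neg_mul _ (Y : ℂ), mul_neg Complex.I]
    have h4 : ((√(p ^ 2 + q ^ 2) : ℝ) : ℂ) ≠ 0 := by exact_mod_cast h1.ne'
    field_simp
    ring
  have hgi : IntegrableOn g (Set.Ici q) :=
    (hF.add hF.comp_neg).integrableOn.congr_fun hFg measurableSet_Ici
  have himg : (fun p => √(p ^ 2 + q ^ 2)) '' Set.Ici (0 : ℝ) ⊆ Set.Ici q := by
    rintro _ ⟨p, _, rfl⟩
    exact Real.le_sqrt_of_sq_le (by nlinarith [sq_nonneg p])
  have hsubst := integral_deriv_smul_comp_Ioi (f := fun p => √(p ^ 2 + q ^ 2))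
    (f' := fun p => p / √(p ^ 2 + q ^ 2)) (g := g) (a := 0) (by fun_prop)
    (tendsto_atTop_mono (fun p => Real.le_sqrt_of_sq_le
      (by nlinarith [sq_nonneg q] : p ^ 2 ≤ p ^ 2 + q ^ 2)) tendsto_id)
    (fun p _ => by
      refine HasDerivAt.hasDerivWithinAt ?_
      refine (((hasDerivAt_pow 2 p).add_const (q ^ 2)).sqrt (hpos p).ne').congr_deriv ?_
      have := Real.sqrt_pos.2 (hpos p)
      simp only [Nat.cast_ofNat, Nat.add_one_sub_one, pow_one]
      field_simp)
    (by simp only [hg]; fun_prop) (hgi.mono_set himg)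
    (((hG.add hG.comp_neg).const_mul (Complex.exp (-τ * q ^ 2))).integrableOn.congr_fun
      (fun p hp => (hsub2 p hp).symm) measurableSet_Ici)
  have h0 : √((0 : ℝ) ^ 2 + q ^ 2) = q := by
    rw [zero_pow two_ne_zero, zero_add, Real.sqrt_sq hq.le]
  rw [h0] at hsubst
  rw [← hsubst, setIntegral_congr_fun measurableSet_Ioi
    fun p hp => hsub2 p (Set.mem_Ici.2 (le_of_lt hp)), integral_const_mul]

/-! ### Superpositions of exponentials solving the adjoint equation on a half line. -/

theorem expBdd_exp_of_re {f : ℝ → ℂ} (hf : Continuous f) {A : ℝ}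
    (hA : ∀ x, (f x).re ≤ A * (1 + |x|)) : ExpBdd fun x => Complex.exp (f x) := by
  refine ⟨Complex.continuous_exp.comp hf, A, Real.exp A, fun x => ?_⟩
  rw [Complex.norm_exp, ← Real.exp_add]
  exact Real.exp_le_exp.2 (by linarith [hA x])

/-- Differentiation of Gaussian integrals with respect to a parameter in the exponent. -/
theorem hasDerivAt_integral_gaussian_exp {M c : ℝ → ℂ} {ε A : ℝ} (hε : 0 < ε) (hM : ExpBdd M)
    (hc : ExpBdd c) (hcr : ∀ p, |(c p).re| ≤ A * (1 + |p|)) (θ : ℝ) :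
    HasDerivAt (fun θ : ℝ => ∫ p : ℝ, Complex.exp (-ε * (p : ℂ) ^ 2) * (M p *
        Complex.exp (θ * c p)))
      (∫ p : ℝ, Complex.exp (-ε * (p : ℂ) ^ 2) * ((M p * c p) * Complex.exp (θ * c p))) θ := by
  have hexp : ∀ θ : ℝ, ExpBdd fun p => Complex.exp (θ * c p) := fun θ =>
    expBdd_exp_of_re (A := |θ| * A) (continuous_const.mul hc.1) fun p => by
      rw [Complex.re_ofReal_mul, mul_assoc]
      refine (le_abs_self _).trans ?_
      rw [abs_mul]
      exact mul_le_mul_of_nonneg_left (hcr p) (abs_nonneg _)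
  have hε' : 0 < (ε : ℂ).re := by simpa using hε
  -- This bounds the growth rate of e^{θ'c} for all θ' within distance 1 of θ, giving one majorant
  -- for the derivative.
  set K : ℝ := (|θ| + 1) * A with hK
  have hdom : ExpBdd fun p : ℝ => (M p * c p) * Complex.exp ((K * (1 + |p|) : ℝ) : ℂ) := by
    refine (hM.mul hc).mul (expBdd_exp_of_re (A := K) (by fun_prop) fun p => ?_)
    rw [Complex.ofReal_re]
  obtain ⟨g, hgi, hg⟩ := hdom.gaussian_bound hε
  refine (hasDerivAt_integral_of_dominated_loc_of_deriv_le (bound := g)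
    (F' := fun θ p => Complex.exp (-ε * (p : ℂ) ^ 2) * ((M p * c p) * Complex.exp (θ * c p)))
    (Metric.ball_mem_nhds θ one_pos)
    (Eventually.of_forall fun θ' => ((hM.mul (hexp θ')).integrable hε').aestronglyMeasurable)
    ((hM.mul (hexp θ)).integrable hε')
    (((hM.mul hc).mul (hexp θ)).integrable hε').aestronglyMeasurable
    (Eventually.of_forall fun p θ' hθ' => ?_) hgi
    (Eventually.of_forall fun p θ' _ => ?_)).2
  · refine le_trans ?_ (hg p)
    rw [norm_mul, norm_cexp_neg_mul_sq, Complex.ofReal_re, norm_mul, norm_mul (M p * c p)]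
    gcongr
    rw [Complex.norm_exp, Complex.norm_exp, Complex.ofReal_re, Complex.re_ofReal_mul]
    refine Real.exp_le_exp.2 ((le_abs_self _).trans ?_)
    rw [abs_mul, hK, mul_assoc]
    refine mul_le_mul ?_ (hcr p) (abs_nonneg _) (by positivity)
    have h1 : |θ' - θ| < 1 := by simpa [Real.dist_eq] using hθ'
    have h2 := abs_sub_abs_le_abs_sub θ' θ
    linarith
  · have h1 : HasDerivAt (fun θ : ℝ => (θ : ℂ) * c p) (c p) θ' := by
      simpa using (Complex.ofRealCLM.hasDerivAt (x := θ')).mul_const (c p)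
    refine ((h1.cexp.const_mul (M p)).const_mul _).congr_deriv ?_
    ring

/-- A smooth family `f s x` solving `∂ₛ f = i (∂ₓ² - V) f`, which together with its derivatives
`f1`, `f2` in `x` decays exponentially on the half line `0 ≤ σ x`. -/
structure HalfWave (V σ : ℝ) (f f1 f2 : ℝ → ℝ → ℂ) : Prop where
  dx : ∀ s x, HasDerivAt (f s) (f1 s x) x
  dxx : ∀ s x, HasDerivAt (f1 s) (f2 s x) x
  ds : ∀ s x, HasDerivAt (fun s => f s x) (Complex.I * (f2 s x - V * f s x)) s
  cont_x : ∀ s, Continuous (f2 s)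
  cont_s : ∀ x, Continuous fun s => f2 s x
  bound : ∀ S, ∃ C δ, 0 < δ ∧ ∀ s, |s| ≤ S → ∀ x, 0 ≤ σ * x →
    ‖f s x‖ ≤ C * Real.exp (-δ * (σ * x)) ∧ ‖f1 s x‖ ≤ C * Real.exp (-δ * (σ * x)) ∧
    ‖f2 s x‖ ≤ C * Real.exp (-δ * (σ * x))

theorem HalfWave.const_mul {V σ : ℝ} {f f1 f2 : ℝ → ℝ → ℂ} (h : HalfWave V σ f f1 f2) (z : ℂ) :
    HalfWave V σ (fun s x => z * f s x) (fun s x => z * f1 s x) (fun s x => z * f2 s x) where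
  dx s x := (h.dx s x).const_mul z
  dxx s x := (h.dxx s x).const_mul z
  ds s x := ((h.ds s x).const_mul z).congr_deriv (by ring)
  cont_x s := continuous_const.mul (h.cont_x s)
  cont_s x := continuous_const.mul (h.cont_s x)
  bound S := by
    obtain ⟨C, δ, hδ, hb⟩ := h.bound S
    refine ⟨‖z‖ * C, δ, hδ, fun s hs x hx => ?_⟩
    obtain ⟨h0, h1, h2⟩ := hb s hs x hx
    simp only [norm_mul, mul_assoc]
    exact ⟨mul_le_mul_of_nonneg_left h0 (norm_nonneg _),
      mul_le_mul_of_nonneg_left h1 (norm_nonneg _), mul_le_mul_of_nonneg_left h2 (norm_nonneg _)⟩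

theorem HalfWave.add {V σ : ℝ} {f f1 f2 g g1 g2 : ℝ → ℝ → ℂ} (h : HalfWave V σ f f1 f2)
    (k : HalfWave V σ g g1 g2) : HalfWave V σ (fun s x => f s x + g s x)
      (fun s x => f1 s x + g1 s x) (fun s x => f2 s x + g2 s x) where
  dx s x := (h.dx s x).add (k.dx s x)
  dxx s x := (h.dxx s x).add (k.dxx s x)
  ds s x := ((h.ds s x).add (k.ds s x)).congr_deriv (by ring)
  cont_x s := (h.cont_x s).add (k.cont_x s)
  cont_s x := (h.cont_s x).add (k.cont_s x)
  bound S := by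
    obtain ⟨C, δ, hδ, hb⟩ := h.bound S
    obtain ⟨D, δ', hδ', hb'⟩ := k.bound S
    refine ⟨|C| + |D|, min δ δ', lt_min hδ hδ', fun s hs x hx => ?_⟩
    have key : ∀ {a b : ℂ}, ‖a‖ ≤ C * Real.exp (-δ * (σ * x)) →
        ‖b‖ ≤ D * Real.exp (-δ' * (σ * x)) →
        ‖a + b‖ ≤ (|C| + |D|) * Real.exp (-min δ δ' * (σ * x)) := by
      intro a b ha hb
      rw [add_mul]
      refine (norm_add_le _ _).trans (add_le_add (ha.trans ?_) (hb.trans ?_))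
      · refine mul_le_mul (le_abs_self _) (Real.exp_le_exp.2 ?_) (Real.exp_pos _).le (abs_nonneg _)
        have := mul_le_mul_of_nonneg_right (min_le_left δ δ') hx
        linarith
      · refine mul_le_mul (le_abs_self _) (Real.exp_le_exp.2 ?_) (Real.exp_pos _).le (abs_nonneg _)
        have := mul_le_mul_of_nonneg_right (min_le_right δ δ') hx
        linarith
    obtain ⟨h0, h1, h2⟩ := hb s hs x hx
    obtain ⟨k0, k1, k2⟩ := hb' s hs x hx
    exact ⟨key h0 k0, key h1 k1, key h2 k2⟩

/-- Superposition of exponentials `exp (x c)` with amplitudes `a` and energies `z² + v` along the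
line at height `η`, in complex time `ε + i (s - t)`. -/
noncomputable def waveIntegral (ε t η v : ℝ) (a c : ℝ → ℂ) (s x : ℝ) : ℂ :=
  ∫ p : ℝ, Complex.exp (-(ε + Complex.I * (s - t)) * ((p + η * Complex.I) ^ 2 + v)) *
    (a p * Complex.exp (x * c p))

section WaveIntegral

variable {ε t η v V σ δ : ℝ} {a c : ℝ → ℂ}

/-- On the line Im z = η, z² = p² − η² + 2iηp. Once e^{−εp²} is removed, the real part is affine in
p, so the remaining factor is only exponentially bounded. -/
theorem re_energy_exponent (s p : ℝ) :
    (-(ε + Complex.I * (s - t)) * (((p : ℂ) + η * Complex.I) ^ 2 + v) + ε * (p : ℂ) ^ 2).re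
      = ε * (η ^ 2 - v) + 2 * (s - t) * η * p := by
  simp [sq]
  ring

theorem energy_exponent_eq (s p : ℝ) :
    Complex.exp (-(ε + Complex.I * (s - t)) * (((p : ℂ) + η * Complex.I) ^ 2 + v))
      = Complex.exp (-ε * (p : ℂ) ^ 2) * Complex.exp
        (-(ε + Complex.I * (s - t)) * (((p : ℂ) + η * Complex.I) ^ 2 + v) + ε * (p : ℂ) ^ 2) := by
  rw [← Complex.exp_add]; congr 1; ring

theorem expBdd_energy_exponent (s : ℝ) : ExpBdd fun p : ℝ => Complex.exp
    (-(ε + Complex.I * (s - t)) * (((p : ℂ) + η * Complex.I) ^ 2 + v) + ε * (p : ℂ) ^ 2) := by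
  refine expBdd_exp_of_re (A := |ε * (η ^ 2 - v)| + |2 * (s - t) * η|) (by fun_prop) fun p => ?_
  rw [re_energy_exponent]
  have h1 := le_abs_self (ε * (η ^ 2 - v))
  have h2 : 2 * (s - t) * η * p ≤ |2 * (s - t) * η| * |p| := by
    rw [← abs_mul]; exact le_abs_self _
  nlinarith [abs_nonneg p, abs_nonneg (ε * (η ^ 2 - v)), abs_nonneg (2 * (s - t) * η),
    mul_nonneg (abs_nonneg (ε * (η ^ 2 - v))) (abs_nonneg p)]

theorem hasDerivAt_waveIntegral_x (hε : 0 < ε) (ha : ExpBdd a) (hc : LinBdd c) (s x : ℝ) :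
    HasDerivAt (waveIntegral ε t η v a c s)
      (waveIntegral ε t η v (fun p => a p * c p) c s x) x := by
  obtain ⟨A, hA⟩ := hc.2
  have h := hasDerivAt_integral_gaussian_exp hε
    ((expBdd_energy_exponent (ε := ε) (t := t) (η := η) (v := v) s).mul ha) hc.expBdd
    (fun p => (Complex.abs_re_le_norm _).trans (hA p)) x
  convert h using 1
  · funext y
    simp only [waveIntegral, energy_exponent_eq]
    congr 1; funext p; ring
  · simp only [waveIntegral, energy_exponent_eq]
    congr 1; funext p; ring

theorem hasDerivAt_waveIntegral_s (hε : 0 < ε) (ha : ExpBdd a) (hc : LinBdd c) (s x : ℝ) :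
    HasDerivAt (fun s => waveIntegral ε t η v a c s x) (waveIntegral ε t η v
      (fun p => a p * (-Complex.I * (((p : ℂ) + η * Complex.I) ^ 2 + v))) c s x) s := by
  have hz : LinBdd fun p : ℝ => ((p : ℂ) + η * Complex.I) := LinBdd.ofReal.add (LinBdd.const _)
  have hE : ExpBdd fun p : ℝ => -Complex.I * (((p : ℂ) + η * Complex.I) ^ 2 + v) := by
    have := (ExpBdd.const (-Complex.I)).mul ((hz.expBdd.mul hz.expBdd).add (ExpBdd.const v))
    convert this using 3
    ring
  have hxc : ExpBdd fun p => Complex.exp (x * c p) := (hc.const_mul (x : ℂ)).exp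
  have h := hasDerivAt_integral_gaussian_exp (A := |2 * η|) hε
    ((expBdd_energy_exponent (ε := ε) (t := t) (η := η) (v := v) 0).mul (ha.mul hxc)) hE
    (fun p => ?_) s
  · have hsplit : ∀ s p : ℝ,
        Complex.exp (-(ε + Complex.I * (s - t)) * (((p : ℂ) + η * Complex.I) ^ 2 + v))
        = Complex.exp (-ε * (p : ℂ) ^ 2) * Complex.exp
          (-(ε + Complex.I * ((0 : ℝ) - t)) * (((p : ℂ) + η * Complex.I) ^ 2 + v)
            + ε * (p : ℂ) ^ 2)
          * Complex.exp (s * (-Complex.I * (((p : ℂ) + η * Complex.I) ^ 2 + v))) := by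
      intro s p
      rw [← Complex.exp_add, ← Complex.exp_add]
      congr 1
      push_cast
      ring
    convert h using 1
    · funext y
      simp only [waveIntegral, hsplit]
      congr 1; funext p; ring
    · simp only [waveIntegral, hsplit]
      congr 1; funext p; ring
  · have : (-Complex.I * (((p : ℂ) + η * Complex.I) ^ 2 + v)).re = 2 * η * p := by
      simp [sq]; ring
    rw [this, abs_mul]
    nlinarith [abs_nonneg (2 * η), abs_nonneg p]

theorem norm_waveIntegral_le (hε : 0 < ε) (ha : ExpBdd a)
    (hδ : ∀ p, σ * (c p).re ≤ -δ) (hσ : σ ^ 2 = 1) (S : ℝ) :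
    ∃ C, 0 ≤ C ∧ ∀ s, |s| ≤ S → ∀ x, 0 ≤ σ * x →
      ‖waveIntegral ε t η v a c s x‖ ≤ C * Real.exp (-δ * (σ * x)) := by
  set K : ℝ := |ε * (η ^ 2 - v)| + 2 * (S + |t|) * |η| with hK
  have hdom : ExpBdd fun p : ℝ => a p * Complex.exp ((K * (1 + |p|) : ℝ) : ℂ) :=
    ha.mul (expBdd_exp_of_re (A := K) (by fun_prop) fun p => by rw [Complex.ofReal_re])
  obtain ⟨g, hgi, hg⟩ := hdom.gaussian_bound hε
  refine ⟨∫ p, g p, integral_nonneg fun p => le_trans (by positivity) (hg p),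
    fun s hs x hx => ?_⟩
  rw [← integral_mul_const]
  refine norm_integral_le_of_norm_le (hgi.mul_const _) (Eventually.of_forall fun p => ?_)
  have h1 : ‖Complex.exp (x * c p)‖ ≤ Real.exp (-δ * (σ * x)) := by
    rw [Complex.norm_exp, Complex.re_ofReal_mul]
    refine Real.exp_le_exp.2 ?_
    have h := mul_le_mul_of_nonneg_right (hδ p) hx
    have h' : x * (c p).re = σ * (c p).re * (σ * x) := by
      linear_combination (-(x * (c p).re)) * hσ
    rwa [h']
  have h2 : ‖Complex.exp (-(ε + Complex.I * (s - t)) * (((p : ℂ) + η * Complex.I) ^ 2 + v))‖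
      ≤ Real.exp (-ε * p ^ 2) * ‖Complex.exp ((K * (1 + |p|) : ℝ) : ℂ)‖ := by
    rw [energy_exponent_eq, norm_mul, norm_cexp_neg_mul_sq, Complex.ofReal_re]
    gcongr
    rw [Complex.norm_exp, Complex.norm_exp, re_energy_exponent, Complex.ofReal_re]
    refine Real.exp_le_exp.2 ?_
    have e1 := le_abs_self (ε * (η ^ 2 - v))
    have e2 : 2 * (s - t) * η * p ≤ 2 * (S + |t|) * |η| * |p| := by
      refine (le_abs_self _).trans ?_
      rw [abs_mul, abs_mul, abs_mul, abs_two]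
      gcongr
      exact (abs_sub _ _).trans (by linarith)
    have e3 : 0 ≤ 2 * (S + |t|) * |η| := by
      have := (abs_nonneg s).trans hs
      positivity
    nlinarith [abs_nonneg p, abs_nonneg (ε * (η ^ 2 - v)),
      mul_nonneg (abs_nonneg (ε * (η ^ 2 - v))) (abs_nonneg p)]
  rw [norm_mul, norm_mul]
  calc _ ≤ (Real.exp (-ε * p ^ 2) * ‖Complex.exp ((K * (1 + |p|) : ℝ) : ℂ)‖)
        * (‖a p‖ * Real.exp (-δ * (σ * x))) := by gcongr
    _ = (Real.exp (-ε * p ^ 2) * ‖a p * Complex.exp ((K * (1 + |p|) : ℝ) : ℂ)‖)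
        * Real.exp (-δ * (σ * x)) := by rw [norm_mul]; ring
    _ ≤ _ := by gcongr; exact hg p

/-- The dispersion relation c² = V − (z² + v) says that each exponential solves the equation. Decay
comes from keeping the contour off the real axis, where σ Re c ≤ −δ uniformly in p. -/
theorem halfWave_waveIntegral (hε : 0 < ε) (ha : ExpBdd a) (hc : LinBdd c)
    (hδ : 0 < δ) (hcδ : ∀ p, σ * (c p).re ≤ -δ) (hσ : σ ^ 2 = 1)
    (hdisp : ∀ p : ℝ, c p ^ 2 = V - (((p : ℂ) + η * Complex.I) ^ 2 + v)) :
    HalfWave V σ (waveIntegral ε t η v a c) (waveIntegral ε t η v (fun p => a p * c p) c)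
      (waveIntegral ε t η v (fun p => a p * c p * c p) c) where
  dx := hasDerivAt_waveIntegral_x hε ha hc
  dxx := hasDerivAt_waveIntegral_x hε (ha.mul hc.expBdd) hc
  ds s x := by
    refine (hasDerivAt_waveIntegral_s hε ha hc s x).congr_deriv ?_
    have hint : ∀ {b : ℝ → ℂ}, ExpBdd b → Integrable fun p : ℝ =>
        Complex.exp (-(ε + Complex.I * (s - t)) * (((p : ℂ) + η * Complex.I) ^ 2 + v)) *
          (b p * Complex.exp (x * c p)) := by
      intro b hb
      have := ((expBdd_energy_exponent (ε := ε) (t := t) (η := η) (v := v) s).mul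
        (hb.mul ((hc.const_mul (x : ℂ)).exp))).integrable (τ := ε) (by simpa using hε)
      refine this.congr (Eventually.of_forall fun p => ?_)
      simp only [energy_exponent_eq (ε := ε)]
      ring
    unfold waveIntegral
    rw [← integral_const_mul, ← integral_sub, ← integral_const_mul]
    · congr 1
      funext p
      have h := hdisp p
      linear_combination (-Complex.I * a p * Complex.exp (x * c p) *
        Complex.exp (-(ε + Complex.I * (s - t)) * (((p : ℂ) + η * Complex.I) ^ 2 + v))) * h
    · exact hint ((ha.mul hc.expBdd).mul hc.expBdd)
    · exact (hint ha).const_mul _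
  cont_x s := continuous_iff_continuousAt.2 fun x =>
    (hasDerivAt_waveIntegral_x hε ((ha.mul hc.expBdd).mul hc.expBdd) hc s x).continuousAt
  cont_s x := continuous_iff_continuousAt.2 fun s =>
    (hasDerivAt_waveIntegral_s hε ((ha.mul hc.expBdd).mul hc.expBdd) hc s x).continuousAt
  bound S := by
    obtain ⟨C0, h00, h0⟩ := norm_waveIntegral_le (t := t) (η := η) (v := v) hε ha hcδ hσ S
    obtain ⟨C1, h10, h1⟩ := norm_waveIntegral_le (t := t) (η := η) (v := v) hε
      (ha.mul hc.expBdd) hcδ hσ S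
    obtain ⟨C2, h20, h2⟩ := norm_waveIntegral_le (t := t) (η := η) (v := v) hε
      ((ha.mul hc.expBdd).mul hc.expBdd) hcδ hσ S
    refine ⟨C0 + C1 + C2, δ, hδ, fun s hs x hx => ⟨(h0 s hs x hx).trans ?_,
      (h1 s hs x hx).trans ?_, (h2 s hs x hx).trans ?_⟩⟩ <;> gcongr <;> linarith

end WaveIntegral

/-! ### L² pairings, and the weak equation for test functions with a jump in the second derivative.
-/

theorem integrable_exp_neg_mul_abs {δ : ℝ} (hδ : 0 < δ) :
    Integrable fun x : ℝ => Real.exp (-δ * |x|) := by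
  rw [← integrableOn_univ, ← Set.Iic_union_Ioi (a := (0 : ℝ))]
  refine IntegrableOn.union ?_ ?_
  · refine (integrableOn_exp_mul_Iic hδ 0).congr_fun (fun x hx => ?_) measurableSet_Iic
    simp only [abs_of_nonpos (Set.mem_Iic.1 hx), neg_mul_neg]
  · refine (integrableOn_exp_mul_Ioi (neg_lt_zero.2 hδ) 0).congr_fun (fun x hx => ?_)
      measurableSet_Ioi
    simp only [abs_of_pos (Set.mem_Ioi.1 hx)]

theorem memLp_exp_neg_mul_abs {δ : ℝ} (hδ : 0 < δ) (C : ℝ) :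
    MemLp (fun x : ℝ => C * Real.exp (-δ * |x|)) 2 volume := by
  rw [memLp_two_iff_integrable_sq (by fun_prop)]
  refine ((integrable_exp_neg_mul_abs (δ := 2 * δ) (by positivity)).const_mul (C ^ 2)).congr
    (Eventually.of_forall fun x => ?_)
  simp only [mul_pow, ← Real.exp_nat_mul]
  congr 2
  push_cast; ring

theorem memLp_of_exp_bound {w : ℝ → ℂ} (hw : AEStronglyMeasurable w volume) {C δ : ℝ} (hδ : 0 < δ)
    (hb : ∀ x, ‖w x‖ ≤ C * Real.exp (-δ * |x|)) : MemLp w 2 volume :=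
  (memLp_exp_neg_mul_abs hδ C).mono' hw (Eventually.of_forall hb)

/-- Bilinear pairing with a square integrable function is represented by an inner product. -/
theorem exists_pairing {w : ℝ → ℂ} (hw : MemLp w 2 volume) :
    ∃ W : Lp ℂ 2 (volume : Measure ℝ), ‖W‖ = (eLpNorm w 2 volume).toReal ∧
      ∀ v : Lp ℂ 2 (volume : Measure ℝ), ∫ x, v x * w x = inner ℂ W v := by
  have hc : MemLp (fun x => (starRingEnd ℂ) (w x)) 2 volume :=
    hw.congr_norm (Complex.continuous_conj.comp_aestronglyMeasurable hw.1)
      (Eventually.of_forall fun x => (Complex.norm_conj _).symm)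
  refine ⟨hc.toLp _, ?_, fun v => ?_⟩
  · rw [Lp.norm_toLp]
    congr 1
    exact eLpNorm_congr_norm_ae (Eventually.of_forall fun x => Complex.norm_conj _)
  · rw [L2.inner_def]
    refine integral_congr_ae ?_
    filter_upwards [hc.coeFn_toLp] with x hx
    rw [RCLike.inner_apply, hx, Complex.conj_conj]

theorem integrable_pairing {w : ℝ → ℂ} (hw : MemLp w 2 volume)
    (v : Lp ℂ 2 (volume : Measure ℝ)) : Integrable fun x => v x * w x :=
  (Lp.memLp v).integrable_mul hw

theorem norm_pairing_le {w : ℝ → ℂ} (hw : AEStronglyMeasurable w volume) {g : ℝ → ℝ}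
    (hg : MemLp g 2 volume) (hb : ∀ x, ‖w x‖ ≤ g x) (v : Lp ℂ 2 (volume : Measure ℝ)) :
    ‖∫ x, v x * w x‖ ≤ (eLpNorm g 2 volume).toReal * ‖v‖ := by
  obtain ⟨W, hW, hpair⟩ := exists_pairing (hg.mono' hw (Eventually.of_forall hb))
  rw [hpair]
  refine (norm_inner_le_norm _ _).trans ?_
  rw [hW]
  gcongr
  · exact hg.2.ne
  · exact eLpNorm_mono_real hb

theorem continuous_pairing {w : ℝ → ℂ} (hw : MemLp w 2 volume)
    {u : ℝ → Lp ℂ 2 (volume : Measure ℝ)} (hu : Continuous u) :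
    Continuous fun t => ∫ x, u t x * w x := by
  obtain ⟨W, _, hpair⟩ := exists_pairing hw
  simp_rw [hpair]
  exact continuous_const.inner hu

theorem pairing_sub {w : ℝ → ℂ} (hw : MemLp w 2 volume) (v v' : Lp ℂ 2 (volume : Measure ℝ)) :
    ∫ x, (v - v') x * w x = (∫ x, v x * w x) - ∫ x, v' x * w x := by
  obtain ⟨W, _, hpair⟩ := exists_pairing hw
  simp_rw [hpair]
  exact inner_sub_right _ _ _

/-- Exponentially decaying functions of class `C^{1,1}` whose second derivative may jump at the
origin. -/
structure PiecewiseTest (φ φ1 φ2 : ℝ → ℂ) : Prop where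
  d1 : ∀ x, HasDerivAt φ (φ1 x) x
  d2 : ∀ x, x ≠ 0 → HasDerivAt φ1 (φ2 x) x
  lip : ∃ K, LipschitzWith K φ1
  cont : ∀ x, x ≠ 0 → ContinuousAt φ2 x
  meas : Measurable φ2
  bound : ∃ C δ, 0 < δ ∧ ∀ x, ‖φ x‖ ≤ C * Real.exp (-δ * |x|) ∧
    ‖φ1 x‖ ≤ C * Real.exp (-δ * |x|) ∧ ‖φ2 x‖ ≤ C * Real.exp (-δ * |x|)

/-- Convolution with a normalized bump function. -/
noncomputable def mollify (ρ : ContDiffBump (0 : ℝ)) (F : ℝ → ℂ) (x : ℝ) : ℂ :=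
  ∫ t, ρ.normed volume t • F (x - t)

theorem mollify_eq_convolution (ρ : ContDiffBump (0 : ℝ)) (F : ℝ → ℂ) :
    mollify ρ F = convolution (ρ.normed volume) F (ContinuousLinearMap.lsmul ℝ ℝ) volume := rfl

/-- The Lipschitz bound dominates the difference quotients, so differentiability away from one point
is enough. This places the second derivative, including its jump, under the mollifier. -/
theorem hasDerivAt_mollify (ρ : ContDiffBump (0 : ℝ)) {F F' : ℝ → ℂ} {K : NNReal}
    (hF : LipschitzWith K F) (hd : ∀ x, x ≠ 0 → HasDerivAt F (F' x) x) (hm : Measurable F')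
    (x : ℝ) : HasDerivAt (mollify ρ F) (mollify ρ F' x) x := by
  have hρc : Continuous (ρ.normed volume) := ρ.continuous_normed
  have hcont : ∀ y, Continuous fun t => ρ.normed volume t • F (y - t) := fun y =>
    hρc.smul (hF.continuous.comp (continuous_const.sub continuous_id))
  refine (hasDerivAt_integral_of_dominated_loc_of_lip (s := Set.univ)
    (bound := fun t => ρ.normed volume t * K) (F' := fun t => ρ.normed volume t • F' (x - t))
    univ_mem
    (Eventually.of_forall fun y => (hcont y).aestronglyMeasurable)
    ((hcont x).integrable_of_hasCompactSupport
      (ρ.hasCompactSupport_normed.smul_right))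
    (hρc.measurable.smul (hm.comp (measurable_const.sub measurable_id))).aestronglyMeasurable
    (Eventually.of_forall fun t => ?_) (ρ.integrable_normed.mul_const _) ?_).2
  · refine LipschitzOnWith.of_dist_le_mul fun y _ z _ => ?_
    have h0 : 0 ≤ ρ.normed volume t := ρ.nonneg_normed t
    have e : |ρ.normed volume t * (K : ℝ)| = ρ.normed volume t * K :=
      abs_of_nonneg (mul_nonneg h0 K.coe_nonneg)
    rw [dist_smul₀, Real.norm_eq_abs, abs_of_nonneg h0, Real.coe_nnabs, e, mul_assoc]
    refine mul_le_mul_of_nonneg_left ?_ h0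
    have := hF.dist_le_mul (y - t) (z - t)
    rwa [dist_sub_right] at this
  · have : ∀ᵐ t : ℝ, t ≠ x := by simp [ae_iff]
    filter_upwards [this] with t ht
    exact ((hd (x - t) (sub_ne_zero.2 (Ne.symm ht))).comp_sub_const x t).const_smul
      (ρ.normed volume t)

/-- The bump lives in |t| < 1, so |x − t| ≥ |x| − 1 and the exponential bound loses only e^δ,
uniformly in the radius. -/
theorem norm_mollify_le (ρ : ContDiffBump (0 : ℝ)) (hρ : ρ.rOut ≤ 1) {F : ℝ → ℂ} {C δ : ℝ}
    (hδ : 0 ≤ δ) (hb : ∀ x, ‖F x‖ ≤ C * Real.exp (-δ * |x|)) (x : ℝ) :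
    ‖mollify ρ F x‖ ≤ C * Real.exp δ * Real.exp (-δ * |x|) := by
  have hC : 0 ≤ C := by have := (norm_nonneg _).trans (hb 0); simpa using this
  have h : ∀ t, ‖ρ.normed volume t • F (x - t)‖
      ≤ ρ.normed volume t * (C * Real.exp δ * Real.exp (-δ * |x|)) := by
    intro t
    have h0 : 0 ≤ ρ.normed volume t := ρ.nonneg_normed t
    rw [norm_smul, Real.norm_eq_abs, abs_of_nonneg h0]
    by_cases ht : ρ.normed volume t = 0
    · rw [ht, zero_mul, zero_mul]
    · refine mul_le_mul_of_nonneg_left ((hb _).trans ?_) h0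
      have ht' : t ∈ Metric.ball (0 : ℝ) ρ.rOut := by
        rw [← ρ.support_normed_eq (μ := volume)]; exact ht
      have ht1 : |t| < ρ.rOut := by simpa using ht'
      rw [mul_assoc, ← Real.exp_add]
      refine mul_le_mul_of_nonneg_left (Real.exp_le_exp.2 ?_) hC
      have := abs_sub_abs_le_abs_sub x t
      nlinarith
  refine (norm_integral_le_of_norm_le (ρ.integrable_normed.mul_const _)
    (Eventually.of_forall h)).trans (le_of_eq ?_)
  rw [integral_mul_const, ρ.integral_normed, one_mul]

theorem PiecewiseTest.lipschitz {φ φ1 φ2 : ℝ → ℂ} (h : PiecewiseTest φ φ1 φ2) :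
    ∃ K, LipschitzWith K φ := by
  obtain ⟨C, δ, hδ, hb⟩ := h.bound
  refine ⟨Real.toNNReal C, lipschitzWith_of_nnnorm_deriv_le (𝕜 := ℝ)
    (fun x => (h.d1 x).differentiableAt) fun x => ?_⟩
  have hC : 0 ≤ C := by have := (norm_nonneg _).trans (hb 0).1; simpa using this
  rw [(h.d1 x).deriv, ← NNReal.coe_le_coe, coe_nnnorm, Real.coe_toNNReal _ hC]
  refine (hb x).2.1.trans (mul_le_of_le_one_right hC ?_)
  rw [Real.exp_le_one_iff]
  nlinarith [abs_nonneg x]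

theorem exists_bound_cutoff (χ : ContDiffBump (0 : ℝ)) :
    ∃ D : ℝ, 0 ≤ D ∧ ∀ x, |deriv χ x| ≤ D ∧ |deriv (deriv χ) x| ≤ D := by
  have h1 : ContDiff ℝ 1 (deriv χ) := by
    have : ContDiff ℝ (1 + 1) χ := χ.contDiff
    exact ((contDiff_succ_iff_deriv.1 this).2).2
  have h2 : Continuous (deriv (deriv χ)) := (contDiff_one_iff_deriv.1 h1).2
  obtain ⟨A, hA⟩ := (χ.hasCompactSupport.deriv).exists_bound_of_continuous h1.continuous
  obtain ⟨B, hB⟩ := (χ.hasCompactSupport.deriv.deriv).exists_bound_of_continuous h2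
  refine ⟨max A B, ((norm_nonneg _).trans (hA 0)).trans (le_max_left _ _), fun x => ?_⟩
  exact ⟨(hA x).trans (le_max_left _ _), (hB x).trans (le_max_right _ _)⟩

/-- Approximation by test functions in the graph norm of the second derivative. -/
theorem PiecewiseTest.exists_approx {φ φ1 φ2 : ℝ → ℂ} (h : PiecewiseTest φ φ1 φ2) :
    ∃ ψ : ℕ → ℝ → ℂ, ∃ C δ : ℝ, 0 < δ ∧ (∀ n, IsTestFunction (ψ n)) ∧
      (∀ n x, ‖ψ n x‖ ≤ C * Real.exp (-δ * |x|) ∧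
        ‖deriv (deriv (ψ n)) x‖ ≤ C * Real.exp (-δ * |x|)) ∧
      (∀ x, Tendsto (fun n => ψ n x) atTop (𝓝 (φ x))) ∧
      (∀ x, x ≠ 0 → Tendsto (fun n => deriv (deriv (ψ n)) x) atTop (𝓝 (φ2 x))) := by
  obtain ⟨C, δ, hδ, hb⟩ := h.bound
  have hC : 0 ≤ C := by have := (norm_nonneg _).trans (hb 0).1; simpa using this
  obtain ⟨K, hK⟩ := h.lipschitz
  obtain ⟨K1, hK1⟩ := h.lip
  set r : ℕ → ℝ := fun n => 1 / ((n : ℝ) + 1) with hr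
  have hr0 : ∀ n, 0 < r n := fun n => by simp only [hr]; positivity
  have hr1 : ∀ n, r n ≤ 1 := fun n => by
    simp only [hr]
    rw [div_le_one (by positivity)]
    linarith [(n.cast_nonneg : (0 : ℝ) ≤ n)]
  have hrt : Tendsto r atTop (𝓝 0) := tendsto_one_div_add_atTop_nhds_zero_nat
  set ρ : ℕ → ContDiffBump (0 : ℝ) := fun n => ⟨r n / 2, r n, half_pos (hr0 n),
    half_lt_self (hr0 n)⟩ with hρ
  set χ : ContDiffBump (0 : ℝ) := ⟨1, 2, one_pos, one_lt_two⟩ with hχ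
  obtain ⟨D, hD0, hD⟩ := exists_bound_cutoff χ
  have hχd : ∀ x, HasDerivAt χ (deriv χ x) x := fun x =>
    ((χ.contDiff (n := 1)).differentiable one_ne_zero x).hasDerivAt
  have hχd2 : ∀ x, HasDerivAt (deriv χ) (deriv (deriv χ) x) x := fun x => by
    have : ContDiff ℝ (1 + 1) χ := χ.contDiff
    exact (((contDiff_succ_iff_deriv.1 this).2).2.differentiable one_ne_zero x).hasDerivAt
  set m0 : ℕ → ℝ → ℂ := fun n => mollify (ρ n) φ
  set m1 : ℕ → ℝ → ℂ := fun n => mollify (ρ n) φ1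
  set m2 : ℕ → ℝ → ℂ := fun n => mollify (ρ n) φ2
  have hm1meas : Measurable φ1 := hK1.continuous.measurable
  have hd0 : ∀ n x, HasDerivAt (m0 n) (m1 n x) x := fun n x =>
    hasDerivAt_mollify (ρ n) hK (fun y _ => h.d1 y) hm1meas x
  have hd1 : ∀ n x, HasDerivAt (m1 n) (m2 n x) x := fun n x =>
    hasDerivAt_mollify (ρ n) hK1 h.d2 h.meas x
  have hscale : ∀ n x, HasDerivAt (fun y : ℝ => r n * y) (r n) x := fun n x => by
    simpa using (hasDerivAt_id x).const_mul (r n)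
  have hc0 : ∀ n x, HasDerivAt (fun y => ((χ (r n * y) : ℝ) : ℂ))
      (((deriv χ (r n * x) * r n : ℝ) : ℂ)) x := fun n x =>
    (HasDerivAt.comp x (hχd (r n * x)) (hscale n x)).ofReal_comp
  have hc1 : ∀ n x, HasDerivAt (fun y => ((deriv χ (r n * y) * r n : ℝ) : ℂ))
      (((deriv (deriv χ) (r n * x) * r n * r n : ℝ) : ℂ)) x := fun n x =>
    ((HasDerivAt.comp x (hχd2 (r n * x)) (hscale n x)).mul_const (r n)).ofReal_comp
  -- Mollify at radius r n and cut off at scale 1/r n. Each derivative of the cutoff brings a factor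
  -- r n → 0, so only the mollified second derivative survives in the limit.
  set ψ : ℕ → ℝ → ℂ := fun n x => ((χ (r n * x) : ℝ) : ℂ) * m0 n x with hψ
  set ψ1 : ℕ → ℝ → ℂ := fun n x => ((deriv χ (r n * x) * r n : ℝ) : ℂ) * m0 n x
    + ((χ (r n * x) : ℝ) : ℂ) * m1 n x with hψ1
  set ψ2 : ℕ → ℝ → ℂ := fun n x =>
    ((deriv (deriv χ) (r n * x) * r n * r n : ℝ) : ℂ) * m0 n x
    + ((deriv χ (r n * x) * r n : ℝ) : ℂ) * m1 n x
    + (((deriv χ (r n * x) * r n : ℝ) : ℂ) * m1 n x + ((χ (r n * x) : ℝ) : ℂ) * m2 n x) with hψ2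
  have hψd : ∀ n x, HasDerivAt (ψ n) (ψ1 n x) x := fun n x => (hc0 n x).mul (hd0 n x)
  have hψd1 : ∀ n x, HasDerivAt (ψ1 n) (ψ2 n x) x := fun n x =>
    ((hc1 n x).mul (hd0 n x)).add ((hc0 n x).mul (hd1 n x))
  have hderiv : ∀ n, deriv (deriv (ψ n)) = ψ2 n := fun n => by
    have : deriv (ψ n) = ψ1 n := funext fun x => (hψd n x).deriv
    rw [this]
    exact funext fun x => (hψd1 n x).deriv
  have hχ1 : ∀ y, |χ y| ≤ 1 := fun y => by rw [abs_of_nonneg χ.nonneg]; exact χ.le_one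
  set C' := C * Real.exp δ with hC'
  have hC'0 : 0 ≤ C' := by positivity
  refine ⟨ψ, (1 + 3 * D) * C', δ, hδ, fun n => ⟨?_, ?_⟩, fun n x => ?_, fun x => ?_,
    fun x hx => ?_⟩
  · have h1 : ContDiff ℝ ∞ (m0 n) := by
      simp only [m0, mollify_eq_convolution]
      exact (ρ n).hasCompactSupport_normed.contDiff_convolution_left _ (ρ n).contDiff_normed
        hK.continuous.locallyIntegrable
    have h2 : ContDiff ℝ ∞ fun x => χ (r n * x) :=
      χ.contDiff.comp (contDiff_const.mul contDiff_id)
    exact (Complex.ofRealCLM.contDiff.comp h2).mul h1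
  · refine HasCompactSupport.intro (K := Set.Icc (-(2 / r n)) (2 / r n)) isCompact_Icc
      fun x hx => ?_
    have h3 : 2 / r n < |x| := by
      by_contra hle
      exact hx (abs_le.1 (not_lt.1 hle))
    have h4 : χ (r n * x) = 0 := by
      refine χ.zero_of_le_dist ?_
      rw [dist_zero_right, Real.norm_eq_abs, abs_mul, abs_of_pos (hr0 n)]
      rw [div_lt_iff₀ (hr0 n)] at h3
      have : (2 : ℝ) ≤ r n * |x| := by linarith
      simpa [hχ] using this
    simp only [hψ, h4, Complex.ofReal_zero, zero_mul]
  · have b0 : ‖m0 n x‖ ≤ C' * Real.exp (-δ * |x|) :=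
      norm_mollify_le (ρ n) (hr1 n) hδ.le (fun y => (hb y).1) x
    have b1 : ‖m1 n x‖ ≤ C' * Real.exp (-δ * |x|) :=
      norm_mollify_le (ρ n) (hr1 n) hδ.le (fun y => (hb y).2.1) x
    have b2 : ‖m2 n x‖ ≤ C' * Real.exp (-δ * |x|) :=
      norm_mollify_le (ρ n) (hr1 n) hδ.le (fun y => (hb y).2.2) x
    set e := Real.exp (-δ * |x|)
    have he : 0 ≤ C' * e := by positivity
    have key : ∀ {a : ℝ} {z : ℂ} {A : ℝ}, |a| ≤ A → ‖z‖ ≤ C' * e →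
        ‖(a : ℂ) * z‖ ≤ A * (C' * e) := by
      intro a z A ha hz
      rw [norm_mul, Complex.norm_real, Real.norm_eq_abs]
      exact mul_le_mul ha hz (norm_nonneg _) ((abs_nonneg _).trans ha)
    have k1 : |deriv χ (r n * x) * r n| ≤ D := by
      rw [abs_mul, abs_of_pos (hr0 n)]
      calc _ ≤ D * 1 := mul_le_mul (hD _).1 (hr1 n) (hr0 n).le hD0
        _ = D := mul_one _
    have k2 : |deriv (deriv χ) (r n * x) * r n * r n| ≤ D := by
      rw [abs_mul, abs_mul, abs_of_pos (hr0 n)]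
      calc _ ≤ D * 1 * 1 := by
            refine mul_le_mul (mul_le_mul (hD _).2 (hr1 n) (hr0 n).le hD0) (hr1 n) (hr0 n).le
              (by linarith)
        _ = D := by ring
    constructor
    · have := key (hχ1 (r n * x)) b0
      have := mul_nonneg hD0 he
      simp only [hψ]
      linarith
    · rw [hderiv]
      have e1 := key k2 b0
      have e2 := key k1 b1
      have e3 := key (hχ1 (r n * x)) b2
      refine (norm_add_le _ _).trans ((add_le_add (norm_add_le _ _) (norm_add_le _ _)).trans ?_)
      linarith
  all_goals
    have hrx : Tendsto (fun n => r n * x) atTop (𝓝 0) := by simpa using hrt.mul_const x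
    have t0 : Tendsto (fun n => ((χ (r n * x) : ℝ) : ℂ)) atTop (𝓝 1) := by
      have h1 := (χ.continuous.tendsto 0).comp hrx
      have h2 : χ (0 : ℝ) = 1 := χ.one_of_mem_closedBall (by simp [hχ])
      rw [h2] at h1
      exact_mod_cast (Complex.continuous_ofReal.tendsto 1).comp h1
    have hout : Tendsto (fun n => (ρ n).rOut) atTop (𝓝 0) := hrt
    have l0 : Tendsto (fun n => m0 n x) atTop (𝓝 (φ x)) := by
      simp only [m0, mollify_eq_convolution]
      exact ContDiffBump.convolution_tendsto_right_of_continuous hout hK.continuous x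
  · simpa using t0.mul l0
  · have l1 : Tendsto (fun n => m1 n x) atTop (𝓝 (φ1 x)) := by
      simp only [m1, mollify_eq_convolution]
      exact ContDiffBump.convolution_tendsto_right_of_continuous hout hK1.continuous x
    have l2 : Tendsto (fun n => m2 n x) atTop (𝓝 (φ2 x)) := by
      simp only [m2, mollify_eq_convolution]
      exact ContDiffBump.convolution_tendsto_right hout
        (Eventually.of_forall fun _ => h.meas.aestronglyMeasurable)
        ((h.cont x hx).tendsto.comp tendsto_snd) tendsto_const_nhds
    have s1 : Tendsto (fun n => ((deriv χ (r n * x) * r n : ℝ) : ℂ)) atTop (𝓝 0) := by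
      refine squeeze_zero_norm (a := fun n => D * r n) (fun n => ?_)
        (by simpa using hrt.const_mul D)
      rw [Complex.norm_real, Real.norm_eq_abs, abs_mul, abs_of_pos (hr0 n)]
      exact mul_le_mul_of_nonneg_right (hD _).1 (hr0 n).le
    have s2 : Tendsto (fun n => ((deriv (deriv χ) (r n * x) * r n * r n : ℝ) : ℂ)) atTop
        (𝓝 0) := by
      refine squeeze_zero_norm (a := fun n => D * r n * r n) (fun n => ?_)
        (by simpa using (hrt.const_mul D).mul hrt)
      rw [Complex.norm_real, Real.norm_eq_abs, abs_mul, abs_mul, abs_of_pos (hr0 n)]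
      have := hr0 n
      gcongr
      exact (hD _).2
    simp only [hderiv, hψ2]
    have := ((s2.mul l0).add (s1.mul l1)).add ((s1.mul l1).add (t0.mul l2))
    simpa using this

theorem measurable_stepPotential (Vm Vp : ℝ) : Measurable (stepPotential Vm Vp) :=
  Measurable.ite measurableSet_Iio measurable_const measurable_const

theorem abs_stepPotential_le (Vm Vp x : ℝ) : |stepPotential Vm Vp x| ≤ |Vm| + |Vp| := by
  unfold stepPotential
  split_ifs
  · linarith [abs_nonneg Vp]
  · linarith [abs_nonneg Vm]

theorem norm_schrodinger_le {Vm Vp x B : ℝ} {a b : ℂ} (ha : ‖a‖ ≤ B) (hb : ‖b‖ ≤ B) :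
    ‖a - (stepPotential Vm Vp x : ℂ) * b‖ ≤ (1 + |Vm| + |Vp|) * B := by
  refine (norm_sub_le _ _).trans ?_
  rw [norm_mul, Complex.norm_real, Real.norm_eq_abs]
  have := mul_le_mul (abs_stepPotential_le Vm Vp x) hb (norm_nonneg _) (by positivity)
  linarith

/-- The weak equation, tested against functions of class `C^{1,1}` with a jump of the second
derivative at the step. -/
theorem IsL2Solution.hasDerivAt_pairing {Vm Vp : ℝ} {u : ℝ → Lp ℂ 2 (volume : Measure ℝ)}
    (hu : IsL2Solution Vm Vp u) {φ φ1 φ2 : ℝ → ℂ} (h : PiecewiseTest φ φ1 φ2) (t : ℝ) :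
    HasDerivAt (fun t => ∫ x, u t x * φ x)
      (-Complex.I * ∫ x, u t x * (φ2 x - (stepPotential Vm Vp x : ℂ) * φ x)) t := by
  obtain ⟨ψ, C, δ, hδ, hψ, hb, hlim, hlim2⟩ := h.exists_approx
  have hVm : Measurable fun x => (stepPotential Vm Vp x : ℂ) :=
    Complex.measurable_ofReal.comp (measurable_stepPotential Vm Vp)
  have hψm : ∀ n, AEStronglyMeasurable (ψ n) volume := fun n =>
    (hψ n).1.continuous.aestronglyMeasurable
  have hψm2 : ∀ n, AEStronglyMeasurable (deriv (deriv (ψ n))) volume := fun n =>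
    (measurable_deriv _).aestronglyMeasurable
  have hψL : ∀ n, MemLp (ψ n) 2 volume := fun n =>
    memLp_of_exp_bound (hψm n) hδ fun x => (hb n x).1
  have hψL2 : ∀ n, MemLp (deriv (deriv (ψ n))) 2 volume := fun n =>
    memLp_of_exp_bound (hψm2 n) hδ fun x => (hb n x).2
  have hVψL : ∀ n, MemLp (fun x => (stepPotential Vm Vp x : ℂ) * ψ n x) 2 volume := fun n => by
    refine memLp_of_exp_bound (C := (|Vm| + |Vp|) * C)
      (hVm.aestronglyMeasurable.mul (hψm n)) hδ fun x => ?_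
    rw [norm_mul, Complex.norm_real, Real.norm_eq_abs, mul_assoc]
    exact mul_le_mul (abs_stepPotential_le Vm Vp x) (hb n x).1 (norm_nonneg _) (by positivity)
  set Sψ : ℕ → ℝ → ℂ := fun n x => deriv (deriv (ψ n)) x - (stepPotential Vm Vp x : ℂ) * ψ n x
    with hSψ
  set Sφ : ℝ → ℂ := fun x => φ2 x - (stepPotential Vm Vp x : ℂ) * φ x with hSφ
  have hSL : ∀ n, MemLp (Sψ n) 2 volume := fun n => (hψL2 n).sub (hVψL n)
  set B : ℝ := (1 + |Vm| + |Vp|) * C with hB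
  have hSb : ∀ n x, ‖Sψ n x‖ ≤ B * Real.exp (-δ * |x|) := fun n x => by
    rw [hB, mul_assoc]; exact norm_schrodinger_le (hb n x).2 (hb n x).1
  have hderiv : ∀ n t, HasDerivAt (fun t => ∫ x, u t x * ψ n x)
      (-Complex.I * ∫ x, u t x * Sψ n x) t := by
    intro n t
    have h1 := (hu.differentiable (ψ n) (hψ n) t).hasDerivAt
    have h2 := hu.equation (ψ n) (hψ n) t
    refine h1.congr_deriv ?_
    have e1 : ∫ x, u t x * Sψ n x = (∫ x, u t x * deriv (deriv (ψ n)) x)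
        - ∫ x, (stepPotential Vm Vp x : ℂ) * u t x * ψ n x := by
      rw [← integral_sub (integrable_pairing (hψL2 n) (u t))]
      · congr 1; funext x; simp only [hSψ]; ring
      · refine (integrable_pairing (hVψL n) (u t)).congr (Eventually.of_forall fun x => ?_)
        simp only; ring
    rw [e1]
    linear_combination (-Complex.I) * h2 + (deriv (fun s => ∫ x, u s x * ψ n x) t) * Complex.I_sq
  have hg0 : MemLp (fun x : ℝ => C * Real.exp (-δ * |x|)) 2 volume := memLp_exp_neg_mul_abs hδ C
  have hg1 : MemLp (fun x : ℝ => B * Real.exp (-δ * |x|)) 2 volume := memLp_exp_neg_mul_abs hδ B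
  have hne : ∀ᵐ x : ℝ, x ≠ 0 := by simp [ae_iff]
  have conv : ∀ {w : ℕ → ℝ → ℂ} {w' : ℝ → ℂ} {D : ℝ}, (∀ n, AEStronglyMeasurable (w n) volume) →
      (∀ n x, ‖w n x‖ ≤ D * Real.exp (-δ * |x|)) →
      (∀ x, x ≠ 0 → Tendsto (fun n => w n x) atTop (𝓝 (w' x))) → ∀ t,
      Tendsto (fun n => ∫ x, u t x * w n x) atTop (𝓝 (∫ x, u t x * w' x)) := by
    intro w w' D hw hwb hwt t
    refine tendsto_integral_of_dominated_convergence
      (fun x => ‖u t x‖ * (D * Real.exp (-δ * |x|)))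
      (fun n => (Lp.aestronglyMeasurable (u t)).mul (hw n))
      ((Lp.memLp (u t)).norm.integrable_mul (memLp_exp_neg_mul_abs hδ D)) (fun n => ?_) ?_
    · refine Eventually.of_forall fun x => ?_
      rw [norm_mul]
      exact mul_le_mul_of_nonneg_left (hwb n x) (norm_nonneg _)
    · filter_upwards [hne] with x hx
      exact (hwt x hx).const_mul _
  have lim0 := conv hψm (fun n x => (hb n x).1) (fun x _ => hlim x)
  have limS : ∀ t, Tendsto (fun n => ∫ x, u t x * Sψ n x) atTop (𝓝 (∫ x, u t x * Sφ x)) :=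
    conv (fun n => (hSL n).1) hSb fun x hx => (hlim2 x hx).sub ((hlim x).const_mul _)
  have hφc : Continuous φ := continuous_iff_continuousAt.2 fun x => (h.d1 x).continuousAt
  have hSφL : MemLp Sφ 2 volume := by
    obtain ⟨C', δ', hδ', hb'⟩ := h.bound
    refine memLp_of_exp_bound (C := (1 + |Vm| + |Vp|) * C')
      (h.meas.sub (hVm.mul hφc.measurable)).aestronglyMeasurable hδ' fun x => ?_
    rw [mul_assoc]
    exact norm_schrodinger_le (hb' x).2.2 (hb' x).1
  have hcont : Continuous fun t => -Complex.I * ∫ x, u t x * Sφ x :=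
    continuous_const.mul (continuous_pairing hSφL hu.continuous)
  -- Derivatives in time need not pass to the limit, but the integrated equation does. Its integrand
  -- is continuous in time, so differentiating it back recovers the equation for φ.
  have hint : ∀ a b : ℝ, (∫ x, u b x * φ x) - (∫ x, u a x * φ x)
      = ∫ s in a..b, -Complex.I * ∫ x, u s x * Sφ x := by
    intro a b
    have hn : ∀ n, (∫ x, u b x * ψ n x) - (∫ x, u a x * ψ n x)
        = ∫ s in a..b, -Complex.I * ∫ x, u s x * Sψ n x := fun n =>
      (intervalIntegral.integral_eq_sub_of_hasDerivAt (fun s _ => hderiv n s)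
        ((continuous_const.mul
          (continuous_pairing (hSL n) hu.continuous)).intervalIntegrable _ _)).symm
    refine tendsto_nhds_unique ((lim0 b).sub (lim0 a)) ?_
    simp_rw [hn]
    refine intervalIntegral.tendsto_integral_filter_of_dominated_convergence
      (fun s => (eLpNorm (fun x : ℝ => B * Real.exp (-δ * |x|)) 2 volume).toReal * ‖u s‖)
      (Eventually.of_forall fun n => (continuous_const.mul
          (continuous_pairing (hSL n) hu.continuous)).aestronglyMeasurable)
      (Eventually.of_forall fun n => Eventually.of_forall fun s _ => ?_)
      ((continuous_const.mul hu.continuous.norm).intervalIntegrable _ _)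
      (Eventually.of_forall fun s _ => (limS s).const_mul _)
    rw [norm_mul, norm_neg, Complex.norm_I, one_mul]
    exact norm_pairing_le (hSL n).1 hg1 (hSb n) (u s)
  have hF : (fun t => ∫ x, u t x * φ x) = fun b =>
      (∫ x, u 0 x * φ x) + ∫ s in (0 : ℝ)..b, -Complex.I * ∫ x, u s x * Sφ x := by
    funext b
    rw [← hint 0 b]; ring
  rw [hF]
  exact (intervalIntegral.integral_hasDerivAt_right (hcont.intervalIntegrable _ _)
    hcont.stronglyMeasurable.stronglyMeasurableAtFilter hcont.continuousAt).const_add _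

/-! ### Gluing half waves at the step, and conservation of the pairing. -/

/-- The function equal to `f` on the negative and to `g` on the nonnegative half line. -/
noncomputable def glue (f g : ℝ → ℂ) (x : ℝ) : ℂ := if x < 0 then f x else g x

theorem glue_of_neg {f g : ℝ → ℂ} {x : ℝ} (hx : x < 0) : glue f g x = f x := if_pos hx

theorem glue_of_nonneg {f g : ℝ → ℂ} {x : ℝ} (hx : 0 ≤ x) : glue f g x = g x :=
  if_neg (not_lt.2 hx)

theorem glue_eventuallyEq_left {f g : ℝ → ℂ} {x : ℝ} (hx : x < 0) : glue f g =ᶠ[𝓝 x] f := by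
  filter_upwards [Iio_mem_nhds hx] with y hy using glue_of_neg hy

theorem glue_eventuallyEq_right {f g : ℝ → ℂ} {x : ℝ} (hx : 0 < x) : glue f g =ᶠ[𝓝 x] g := by
  filter_upwards [Ioi_mem_nhds hx] with y hy using glue_of_nonneg (le_of_lt hy)

theorem measurable_glue {f g : ℝ → ℂ} (hf : Measurable f) (hg : Measurable g) :
    Measurable (glue f g) := Measurable.ite measurableSet_Iio hf hg

theorem hasDerivAt_glue_of_ne {f g f' g' : ℝ → ℂ} (hf : ∀ x, HasDerivAt f (f' x) x)
    (hg : ∀ x, HasDerivAt g (g' x) x) {x : ℝ} (hx : x ≠ 0) :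
    HasDerivAt (glue f g) (glue f' g' x) x := by
  rcases lt_or_gt_of_ne hx with h | h
  · rw [glue_of_neg h]; exact (hf x).congr_of_eventuallyEq (glue_eventuallyEq_left h)
  · rw [glue_of_nonneg h.le]; exact (hg x).congr_of_eventuallyEq (glue_eventuallyEq_right h)

theorem hasDerivWithinAt_glue {f g f' g' : ℝ → ℂ} (hf : ∀ x, HasDerivAt f (f' x) x)
    (hg : ∀ x, HasDerivAt g (g' x) x) (x : ℝ) :
    HasDerivWithinAt (glue f g) (glue f' g' x) (Set.Ici x) x := by
  rcases eq_or_ne x 0 with rfl | hx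
  · rw [glue_of_nonneg le_rfl]
    exact (hg 0).hasDerivWithinAt.congr (fun y hy => glue_of_nonneg hy) (glue_of_nonneg le_rfl)
  · exact (hasDerivAt_glue_of_ne hf hg hx).hasDerivWithinAt

theorem hasDerivAt_glue {f g f' g' : ℝ → ℂ} (hf : ∀ x, HasDerivAt f (f' x) x)
    (hg : ∀ x, HasDerivAt g (g' x) x) (h0 : f 0 = g 0) (h0' : f' 0 = g' 0) (x : ℝ) :
    HasDerivAt (glue f g) (glue f' g' x) x := by
  rcases eq_or_ne x 0 with rfl | hx
  · have h1 : HasDerivWithinAt (glue f g) (glue f' g' 0) (Set.Iic 0) 0 := by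
      rw [glue_of_nonneg le_rfl, ← h0']
      refine (hf 0).hasDerivWithinAt.congr (fun y hy => ?_) ?_
      · rcases (Set.mem_Iic.1 hy).lt_or_eq with h | rfl
        · exact glue_of_neg h
        · rw [glue_of_nonneg le_rfl, h0]
      · rw [glue_of_nonneg le_rfl, h0]
    have h2 := h1.union (hasDerivWithinAt_glue hf hg 0)
    rw [Set.Iic_union_Ici] at h2
    exact hasDerivWithinAt_univ.1 h2
  · exact hasDerivAt_glue_of_ne hf hg hx

/-- The slopes f' and g' may differ at the origin. Only the right derivative is available there, and
the mean value inequality needs no more. -/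
theorem lipschitzWith_glue {f g f' g' : ℝ → ℂ} (hf : ∀ x, HasDerivAt f (f' x) x)
    (hg : ∀ x, HasDerivAt g (g' x) x) (h0 : f 0 = g 0) {C : NNReal}
    (hC : ∀ x, ‖glue f' g' x‖ ≤ C) : LipschitzWith C (glue f g) := by
  have hc : Continuous (glue f g) := by
    refine continuous_iff_continuousAt.2 fun x => ?_
    rcases eq_or_ne x 0 with rfl | hx
    · have hf0 : Continuous f := continuous_iff_continuousAt.2 fun x => (hf x).continuousAt
      have hg0 : Continuous g := continuous_iff_continuousAt.2 fun x => (hg x).continuousAt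
      refine (Continuous.if (fun a ha => ?_) hf0 hg0).continuousAt
      have : frontier {x : ℝ | x < 0} = {0} := frontier_Iio
      rw [this, Set.mem_singleton_iff] at ha
      rw [ha, h0]
    · exact (hasDerivAt_glue_of_ne hf hg hx).continuousAt
  refine LipschitzWith.of_dist_le_mul fun x y => ?_
  wlog hxy : x ≤ y generalizing x y
  · rw [dist_comm, dist_comm x]; exact this y x (le_of_not_ge hxy)
  have := norm_image_sub_le_of_norm_deriv_right_le_segment (f := glue f g) (a := x) (b := y)
    hc.continuousOn (fun z _ => hasDerivWithinAt_glue hf hg z) (fun z _ => hC z) y ⟨hxy, le_rfl⟩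
  rw [dist_comm, dist_eq_norm, dist_comm x, Real.dist_eq, abs_of_nonneg (sub_nonneg.2 hxy)]
  exact this

/-- Two half waves fitting together continuously differentiably at the step. -/
structure MatchedWaves (Vm Vp : ℝ) (L L1 L2 R R1 R2 : ℝ → ℝ → ℂ) : Prop where
  left : HalfWave Vm (-1) L L1 L2
  right : HalfWave Vp 1 R R1 R2
  value : ∀ s, L s 0 = R s 0
  slope : ∀ s, L1 s 0 = R1 s 0

section MatchedWaves

variable {Vm Vp : ℝ} {L L1 L2 R R1 R2 : ℝ → ℝ → ℂ}

theorem MatchedWaves.bound (h : MatchedWaves Vm Vp L L1 L2 R R1 R2) (S : ℝ) :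
    ∃ C δ, 0 < δ ∧ ∀ s, |s| ≤ S → ∀ x, ‖glue (L s) (R s) x‖ ≤ C * Real.exp (-δ * |x|) ∧
      ‖glue (L1 s) (R1 s) x‖ ≤ C * Real.exp (-δ * |x|) ∧
      ‖glue (L2 s) (R2 s) x‖ ≤ C * Real.exp (-δ * |x|) := by
  obtain ⟨C, δ, hδ, hC⟩ := h.left.bound S
  obtain ⟨D, γ, hγ, hD⟩ := h.right.bound S
  refine ⟨max |C| |D|, min δ γ, lt_min hδ hγ, fun s hs x => ?_⟩
  rcases lt_or_ge x 0 with hx | hx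
  · have hx' : 0 ≤ -1 * x := by linarith
    have habs : |x| = -1 * x := by rw [abs_of_neg hx]; ring
    have key : C * Real.exp (-δ * (-1 * x)) ≤ max |C| |D| * Real.exp (-min δ γ * |x|) := by
      rw [habs]
      refine mul_le_mul ((le_abs_self C).trans (le_max_left _ _)) (Real.exp_le_exp.2 ?_)
        (Real.exp_pos _).le ((abs_nonneg C).trans (le_max_left _ _))
      have := mul_le_mul_of_nonneg_right (min_le_left δ γ) hx'
      linarith
    obtain ⟨h0, h1, h2⟩ := hC s hs x hx'
    rw [glue_of_neg hx, glue_of_neg hx, glue_of_neg hx]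
    exact ⟨h0.trans key, h1.trans key, h2.trans key⟩
  · have hx' : 0 ≤ 1 * x := by linarith
    have habs : |x| = 1 * x := by rw [abs_of_nonneg hx]; ring
    have key : D * Real.exp (-γ * (1 * x)) ≤ max |C| |D| * Real.exp (-min δ γ * |x|) := by
      rw [habs]
      refine mul_le_mul ((le_abs_self D).trans (le_max_right _ _)) (Real.exp_le_exp.2 ?_)
        (Real.exp_pos _).le ((abs_nonneg C).trans (le_max_left _ _))
      have := mul_le_mul_of_nonneg_right (min_le_right δ γ) hx'
      linarith
    obtain ⟨h0, h1, h2⟩ := hD s hs x hx'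
    rw [glue_of_nonneg hx, glue_of_nonneg hx, glue_of_nonneg hx]
    exact ⟨h0.trans key, h1.trans key, h2.trans key⟩

theorem MatchedWaves.piecewiseTest (h : MatchedWaves Vm Vp L L1 L2 R R1 R2) (s : ℝ) :
    PiecewiseTest (glue (L s) (R s)) (glue (L1 s) (R1 s)) (glue (L2 s) (R2 s)) where
  d1 := hasDerivAt_glue (h.left.dx s) (h.right.dx s) (h.value s) (h.slope s)
  d2 _ hx := hasDerivAt_glue_of_ne (h.left.dxx s) (h.right.dxx s) hx
  lip := by
    obtain ⟨C, δ, hδ, hb⟩ := h.bound |s|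
    have hC : 0 ≤ C := by
      have := (norm_nonneg _).trans (hb s le_rfl 0).1
      simpa using this
    refine ⟨Real.toNNReal C, lipschitzWith_glue (h.left.dxx s) (h.right.dxx s) (h.slope s)
      fun x => ?_⟩
    rw [Real.coe_toNNReal _ hC]
    refine (hb s le_rfl x).2.2.trans (mul_le_of_le_one_right hC ?_)
    rw [Real.exp_le_one_iff]
    nlinarith [abs_nonneg x]
  cont x hx := by
    rcases lt_or_gt_of_ne hx with hx | hx
    · exact (h.left.cont_x s).continuousAt.congr (glue_eventuallyEq_left hx).symm
    · exact (h.right.cont_x s).continuousAt.congr (glue_eventuallyEq_right hx).symm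
  meas := measurable_glue (h.left.cont_x s).measurable (h.right.cont_x s).measurable
  bound := by
    obtain ⟨C, δ, hδ, hb⟩ := h.bound |s|
    exact ⟨C, δ, hδ, fun x => hb s le_rfl x⟩

/-- The gluing and the potential both assign the origin to the right half line, so no point is
exceptional. -/
theorem MatchedWaves.hasDerivAt_s (h : MatchedWaves Vm Vp L L1 L2 R R1 R2) (s x : ℝ) :
    HasDerivAt (fun s => glue (L s) (R s) x) (Complex.I * (glue (L2 s) (R2 s) x
      - (stepPotential Vm Vp x : ℂ) * glue (L s) (R s) x)) s := by
  rcases lt_or_ge x 0 with hx | hx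
  · simp only [glue_of_neg hx, stepPotential, if_pos hx]
    exact h.left.ds s x
  · simp only [glue_of_nonneg hx, stepPotential, if_neg (not_lt.2 hx)]
    exact h.right.ds s x

/-- Pairing a solution with a matched wave evolving by the adjoint equation is conserved. -/
theorem IsL2Solution.pairing_conserved {u : ℝ → Lp ℂ 2 (volume : Measure ℝ)}
    (hu : IsL2Solution Vm Vp u) (h : MatchedWaves Vm Vp L L1 L2 R R1 R2) (a b : ℝ) :
    ∫ x, u a x * glue (L a) (R a) x = ∫ x, u b x * glue (L b) (R b) x := by
  set g : ℝ → ℝ → ℂ := fun s x => glue (L s) (R s) x with hg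
  set S : ℝ → ℝ → ℂ := fun s x => glue (L2 s) (R2 s) x
    - (stepPotential Vm Vp x : ℂ) * glue (L s) (R s) x with hS
  -- The times of u and of the wave are separated, because u is differentiable in time only in the
  -- weak sense. The two partial derivatives of Φ are −iA and iA and cancel on the diagonal.
  set Φ : ℝ → ℝ → ℂ := fun σ s => ∫ x, u σ x * g s x with hΦ
  set A : ℝ → ℝ → ℂ := fun σ s => ∫ x, u σ x * S s x with hA
  have hgm : ∀ s, AEStronglyMeasurable (g s) volume := fun s =>
    (measurable_glue
      (continuous_iff_continuousAt.2 fun x => (h.left.dx s x).continuousAt).measurable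
      (continuous_iff_continuousAt.2
        fun x => (h.right.dx s x).continuousAt).measurable).aestronglyMeasurable
  have hSm : ∀ s, AEStronglyMeasurable (S s) volume := fun s =>
    (measurable_glue (h.left.cont_x s).measurable
      (h.right.cont_x s).measurable).aestronglyMeasurable.sub
      ((Complex.measurable_ofReal.comp
        (measurable_stepPotential Vm Vp)).aestronglyMeasurable.mul (hgm s))
  have hbound : ∀ s0 : ℝ, ∃ C δ, 0 < δ ∧ ∀ s ∈ Metric.ball s0 1, ∀ x,
      ‖g s x‖ ≤ C * Real.exp (-δ * |x|) ∧ ‖S s x‖ ≤ C * Real.exp (-δ * |x|) := by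
    intro s0
    obtain ⟨C, δ, hδ, hb⟩ := h.bound (|s0| + 1)
    refine ⟨(1 + |Vm| + |Vp|) * C, δ, hδ, fun s hs x => ?_⟩
    have hs' : |s| ≤ |s0| + 1 := by
      have h1 : |s - s0| < 1 := by simpa [Real.dist_eq] using hs
      have := abs_sub_abs_le_abs_sub s s0
      linarith
    obtain ⟨h0, -, h2⟩ := hb s hs' x
    rw [mul_assoc]
    refine ⟨h0.trans ?_, norm_schrodinger_le h2 h0⟩
    have := (norm_nonneg _).trans h0
    nlinarith [abs_nonneg Vm, abs_nonneg Vp, mul_nonneg (abs_nonneg Vm) this,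
      mul_nonneg (abs_nonneg Vp) this]
  have d1 : ∀ σ s, HasDerivAt (fun σ => Φ σ s) (-Complex.I * A σ s) σ := fun σ s =>
    hu.hasDerivAt_pairing (h.piecewiseTest s) σ
  have d2 : ∀ σ s, HasDerivAt (fun s => Φ σ s) (Complex.I * A σ s) s := by
    intro σ s
    obtain ⟨C, δ, hδ, hb⟩ := hbound s
    have := (hasDerivAt_integral_of_dominated_loc_of_deriv_le (μ := volume)
      (F := fun s x => u σ x * g s x) (F' := fun s x => u σ x * (Complex.I * S s x))
      (bound := fun x => ‖u σ x‖ * (C * Real.exp (-δ * |x|))) (x₀ := s)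
      (Metric.ball_mem_nhds s one_pos)
      (Eventually.of_forall fun s => (Lp.aestronglyMeasurable (u σ)).mul (hgm s))
      (integrable_pairing (memLp_of_exp_bound (hgm s) hδ
        fun x => (hb s (Metric.mem_ball_self one_pos) x).1) (u σ))
      ((Lp.aestronglyMeasurable (u σ)).mul ((hSm s).const_mul _))
      (Eventually.of_forall fun x s' hs' => ?_)
      ((Lp.memLp (u σ)).norm.integrable_mul (memLp_exp_neg_mul_abs hδ C))
      (Eventually.of_forall fun x s' _ => (h.hasDerivAt_s s' x).const_mul _)).2
    · refine this.congr_deriv ?_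
      rw [hA, ← integral_const_mul]
      congr 1; funext x; ring
    · rw [norm_mul, norm_mul, Complex.norm_I, one_mul]
      exact mul_le_mul_of_nonneg_left (hb s' hs' x).2 (norm_nonneg _)
  have hSs : ∀ x, Continuous fun s => S s x := by
    intro x
    have hgs : Continuous fun s => g s x :=
      continuous_iff_continuousAt.2 fun s => (h.hasDerivAt_s s x).continuousAt
    refine Continuous.sub ?_ (continuous_const.mul hgs)
    rcases lt_or_ge x 0 with hx | hx
    · simp only [glue_of_neg hx]; exact h.left.cont_s x
    · simp only [glue_of_nonneg hx]; exact h.right.cont_s x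
  -- Continuity of the partial derivatives on the diagonal upgrades them to a total derivative
  -- there. The variation of u is controlled in L² norm, that of S by dominated convergence.
  have hAc : ∀ s0, ContinuousAt (fun p : ℝ × ℝ => A p.1 p.2) (s0, s0) := by
    intro s0
    obtain ⟨C, δ, hδ, hb⟩ := hbound s0
    have hgL := memLp_exp_neg_mul_abs hδ C
    set G := (eLpNorm (fun x : ℝ => C * Real.exp (-δ * |x|)) 2 volume).toReal
    have hnhds : ∀ᶠ p : ℝ × ℝ in 𝓝 (s0, s0), p.2 ∈ Metric.ball s0 1 :=
      continuous_snd.continuousAt.preimage_mem_nhds (Metric.ball_mem_nhds s0 one_pos)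
    have t1 : Tendsto (fun p : ℝ × ℝ => ∫ x, (u p.1 - u s0) x * S p.2 x) (𝓝 (s0, s0)) (𝓝 0) := by
      refine squeeze_zero_norm' (a := fun p : ℝ × ℝ => G * ‖u p.1 - u s0‖) ?_ ?_
      · filter_upwards [hnhds] with p hp
        exact norm_pairing_le (hSm p.2) hgL (fun x => (hb p.2 hp x).2) _
      · have : Continuous fun p : ℝ × ℝ => G * ‖u p.1 - u s0‖ :=
          continuous_const.mul (((hu.continuous.comp continuous_fst).sub continuous_const).norm)
        simpa using this.tendsto (s0, s0)
    have t2 : Tendsto (fun s => A s0 s) (𝓝 s0) (𝓝 (A s0 s0)) := by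
      refine tendsto_integral_filter_of_dominated_convergence
        (fun x => ‖u s0 x‖ * (C * Real.exp (-δ * |x|)))
        (Eventually.of_forall fun s => (Lp.aestronglyMeasurable (u s0)).mul (hSm s)) ?_
        ((Lp.memLp (u s0)).norm.integrable_mul hgL)
        (Eventually.of_forall fun x => ((hSs x).tendsto s0).const_mul _)
      filter_upwards [Metric.ball_mem_nhds s0 one_pos] with s hs
      refine Eventually.of_forall fun x => ?_
      rw [norm_mul]
      exact mul_le_mul_of_nonneg_left (hb s hs x).2 (norm_nonneg _)
    have t3 := t1.add (t2.comp (continuous_snd.tendsto (s0, s0)))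
    rw [zero_add] at t3
    refine t3.congr' ?_
    filter_upwards [hnhds] with p hp
    have hSL : MemLp (S p.2) 2 volume :=
      memLp_of_exp_bound (hSm p.2) hδ fun x => (hb p.2 hp x).2
    rw [pairing_sub hSL]
    simp [hA]
  have hdiag : ∀ s, HasDerivAt (fun s => Φ s s) 0 s := by
    intro s
    have hT : Continuous fun z : ℂ => ContinuousLinearMap.toSpanSingleton ℝ z :=
      (ContinuousLinearMap.toSpanSingletonLIE ℝ ℂ).continuous
    have hF := hasStrictFDerivAt_uncurry_coprod (𝕜 := ℝ) (u := (s, s)) (f := Φ)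
      (f₁ := fun σ s => ContinuousLinearMap.toSpanSingleton ℝ (-Complex.I * A σ s))
      (f₂ := fun σ s => ContinuousLinearMap.toSpanSingleton ℝ (Complex.I * A σ s))
      (Eventually.of_forall fun v => (d1 v.1 v.2).hasFDerivAt)
      (Eventually.of_forall fun v => (d2 v.1 v.2).hasFDerivAt)
      (hT.continuousAt.comp (f := fun v : ℝ × ℝ => -Complex.I * A v.1 v.2)
        (continuousAt_const.mul (hAc s)))
      (hT.continuousAt.comp (f := fun v : ℝ × ℝ => Complex.I * A v.1 v.2)
        (continuousAt_const.mul (hAc s)))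
    have hp : HasDerivAt (fun s : ℝ => (s, s)) (1, 1) s :=
      (hasDerivAt_id s).prodMk (hasDerivAt_id s)
    have hd := HasFDerivAt.comp_hasDerivAt (f := fun s : ℝ => (s, s)) s hF.hasFDerivAt hp
    refine hd.congr_deriv ?_
    rw [ContinuousLinearMap.coprod_apply]
    change (ContinuousLinearMap.toSpanSingleton ℝ (-Complex.I * A s s)) 1
      + (ContinuousLinearMap.toSpanSingleton ℝ (Complex.I * A s s)) 1 = 0
    simp
  exact is_const_of_deriv_eq_zero (fun s => (hdiag s).differentiableAt)
    (fun s => (hdiag s).deriv) a b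

end MatchedWaves

/-! ### The kernel of a point source on either side of the step. -/

theorem transmissionSymbol_mul_exp_left (q X Y x : ℝ) (z : ℂ) :
    transmissionSymbol q X Y z * Complex.exp (x * (-Complex.I * z))
      = transmissionSymbol q (X - x) Y z := by
  rw [transmissionSymbol, transmissionSymbol, mul_assoc, ← Complex.exp_add]
  congr 2
  push_cast
  ring

theorem transmissionSymbol_mul_exp_right (q X Y x : ℝ) (z : ℂ) :
    transmissionSymbol q X Y z * Complex.exp (x * (Complex.I * stepMomentum q z))
      = transmissionSymbol q X (Y + x) z := by
  rw [transmissionSymbol, transmissionSymbol, mul_assoc, ← Complex.exp_add]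
  congr 2
  push_cast
  ring

/-- Multiplying by z + ℓ clears the denominator of z/(z + ℓ). This is the algebra behind continuity
of the slope at the step. -/
theorem add_stepMomentum_mul_transmissionSymbol {q : ℝ} (hq : 0 < q) (X Y : ℝ) (z : ℂ) :
    z * transmissionSymbol q X Y z + stepMomentum q z * transmissionSymbol q X Y z
      = z * Complex.exp (Complex.I * (z * X + stepMomentum q z * Y)) := by
  have hs := stepMomentum_sq q z
  have hq' : (q : ℂ) ≠ 0 := by exact_mod_cast hq.ne'
  rw [transmissionSymbol]
  field_simp
  linear_combination (-z) * hs

theorem lineIntegral_transmission_slope {q : ℝ} {τ : ℂ} (hq : 0 < q) (hτ : 0 < τ.re) (X Y : ℝ) :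
    lineIntegral 1 (fun z => Complex.exp (-τ * z ^ 2) * (z * transmissionSymbol q X Y z))
      + lineIntegral 1
        (fun z => Complex.exp (-τ * z ^ 2) * (stepMomentum q z * transmissionSymbol q X Y z))
      = lineIntegral 1 (fun z => Complex.exp (-τ * z ^ 2) *
        (z * Complex.exp (Complex.I * (z * X + stepMomentum q z * Y)))) := by
  have hz : LinBdd fun x : ℝ => (x + (1 : ℝ) * Complex.I : ℂ) :=
    LinBdd.ofReal.add (LinBdd.const _)
  have hT := expBdd_transmissionSymbol hq.le X Y (η := 1) zero_le_one
  have h1 := integrable_gaussian_line hτ (G := fun z => z * transmissionSymbol q X Y z)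
    (hz.expBdd.mul hT)
  have h2 := integrable_gaussian_line hτ
    (G := fun z => stepMomentum q z * transmissionSymbol q X Y z)
    ((linBdd_stepMomentum hq.le zero_le_one).expBdd.mul hT)
  unfold lineIntegral
  rw [← integral_add h1 h2]
  congr 1
  funext x
  rw [← mul_add, add_stepMomentum_mul_transmissionSymbol hq]

/-- The reflection z ↦ −z changes the sign of the odd factor and sends the line at height 1 to
height −1; the integrand is entire, so the line can be moved back. -/
theorem lineIntegral_mul_exp_neg {τ : ℂ} (hτ : 0 < τ.re) (Y : ℝ) :
    lineIntegral 1 (fun z => Complex.exp (-τ * z ^ 2) *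
        (z * Complex.exp (Complex.I * (z * (-Y : ℝ)))))
      = -lineIntegral 1 (fun z => Complex.exp (-τ * z ^ 2) *
        (z * Complex.exp (Complex.I * (z * Y)))) := by
  rw [← lineIntegral_entire hτ Y (p := fun z => z) (by fun_prop) (fun z => by simp) (-1) 1]
  unfold lineIntegral
  rw [← integral_neg, ← integral_neg_eq_self]
  congr 1
  funext x
  beta_reduce
  have e : ((-x : ℝ) : ℂ) + (1 : ℝ) * Complex.I = -((x : ℂ) + (-1 : ℝ) * Complex.I) := by
    push_cast; ring
  have e2 : ∀ w : ℂ, Complex.I * (-w * (-Y : ℝ)) = Complex.I * (w * Y) := fun w => by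
    push_cast; ring
  rw [e, neg_sq, e2]
  ring

section Kernel

variable {ε t η v : ℝ} {a c : ℝ → ℂ}

theorem waveIntegral_eq_lineIntegral {s x : ℝ} {G : ℂ → ℂ} (k : ℂ)
    (hG : ∀ p : ℝ, a p * Complex.exp (x * c p) = k * G (p + η * Complex.I)) :
    waveIntegral ε t η v a c s x = k * (Complex.exp (-(ε + Complex.I * (s - t)) * v) *
      lineIntegral η (fun z => Complex.exp (-(ε + Complex.I * (s - t)) * z ^ 2) * G z)) := by
  rw [waveIntegral, lineIntegral, ← mul_assoc, ← integral_const_mul]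
  congr 1
  funext p
  rw [hG, mul_add, Complex.exp_add]
  ring

theorem complexTime_re (ε t s : ℝ) : ((ε : ℂ) + Complex.I * (s - t)).re = ε := by simp

theorem complexTime_im (ε t s : ℝ) : ((ε : ℂ) + Complex.I * (s - t)).im = s - t := by simp

/-- Matched waves issued by a point source at `-Y`, to the left of the step. -/
theorem exists_matchedWaves_left {Vm q Y : ℝ} (hq : 0 < q) (hY : 0 < Y) (hε : 0 < ε) (t : ℝ) :
    ∃ L L1 L2 R R1 R2, MatchedWaves Vm (Vm + q ^ 2) L L1 L2 R R1 R2 ∧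
      (∀ s x, x ≤ 0 → L s x = Complex.exp (-(ε + Complex.I * (s - t)) * Vm) *
        (freeWave (ε + Complex.I * (s - t)) (x + Y) - freeWave (ε + Complex.I * (s - t)) (Y - x)
          + 2 * transmission q (ε + Complex.I * (s - t)) (Y - x) 0)) ∧
      (∀ s x, 0 ≤ x → R s x = Complex.exp (-(ε + Complex.I * (s - t)) * Vm) *
        (2 * transmission q (ε + Complex.I * (s - t)) Y x)) := by
  have hz : ∀ η : ℝ, LinBdd fun x : ℝ => (x + η * Complex.I : ℂ) := fun η =>
    LinBdd.ofReal.add (LinBdd.const _)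
  have hl := linBdd_stepMomentum hq.le zero_le_one
  have hT := expBdd_transmissionSymbol hq.le Y 0 (η := 1) zero_le_one
  have he : ∀ η : ℝ, ExpBdd fun p : ℝ =>
      Complex.exp (Complex.I * (((p : ℂ) + η * Complex.I) * Y)) := fun η => by
    have := (((hz η).const_mul Y).const_mul Complex.I).exp
    simpa only [mul_comm (Y : ℂ)] using this
  have hI : ∀ z : ℂ, (Complex.I * z) ^ 2 = -z ^ 2 := fun z => by
    rw [mul_pow, Complex.I_sq]; ring
  have hI' : ∀ z : ℂ, (-Complex.I * z) ^ 2 = -z ^ 2 := fun z => by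
    rw [mul_pow, neg_sq, Complex.I_sq]; ring
  -- The three pieces are the direct wave, minus its mirror image, and twice the transmission
  -- integral. The direct wave e^{iz(x+Y)} decays to the left only below the real axis, hence height
  -- −1; the others involve e^{−izx} and use height 1.
  have A1 := halfWave_waveIntegral (t := t) (η := -1) (v := Vm) (V := Vm) (σ := -1) (δ := 1) hε
    (he (-1)) ((hz (-1)).const_mul Complex.I) one_pos (fun p => by simp) (by norm_num)
    (fun p => by rw [hI]; push_cast; ring)
  have A2 := halfWave_waveIntegral (t := t) (η := 1) (v := Vm) (V := Vm) (σ := -1) (δ := 1) hε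
    (he 1) ((hz 1).const_mul (-Complex.I)) one_pos (fun p => by simp) (by norm_num)
    (fun p => by rw [hI']; push_cast; ring)
  have A3 := halfWave_waveIntegral (t := t) (η := 1) (v := Vm) (V := Vm) (σ := -1) (δ := 1) hε
    hT ((hz 1).const_mul (-Complex.I)) one_pos (fun p => by simp) (by norm_num)
    (fun p => by rw [hI']; push_cast; ring)
  have B := halfWave_waveIntegral (t := t) (η := 1) (v := Vm) (V := Vm + q ^ 2) (σ := 1) (δ := 1)
    hε hT (hl.const_mul Complex.I) one_pos
    (fun p => by
      have := (stepMomentum_im_ge (q := q) (z := (p : ℂ) + (1 : ℝ) * Complex.I) (by simp)).1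
      simpa using this)
    (by norm_num)
    (fun p => by rw [hI, stepMomentum_sq]; push_cast; ring)
  have vL : ∀ s x : ℝ, x ≤ 0 →
      waveIntegral ε t (-1) Vm
        (fun p : ℝ => Complex.exp (Complex.I * (((p : ℂ) + (-1 : ℝ) * Complex.I) * Y)))
        (fun p : ℝ => Complex.I * (p + (-1 : ℝ) * Complex.I)) s x
      + -1 * waveIntegral ε t 1 Vm
        (fun p : ℝ => Complex.exp (Complex.I * (((p : ℂ) + (1 : ℝ) * Complex.I) * Y)))
        (fun p : ℝ => -Complex.I * (p + (1 : ℝ) * Complex.I)) s x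
      + 2 * waveIntegral ε t 1 Vm (fun p : ℝ => transmissionSymbol q Y 0 (p + (1 : ℝ) * Complex.I))
        (fun p : ℝ => -Complex.I * (p + (1 : ℝ) * Complex.I)) s x
      = Complex.exp (-(ε + Complex.I * (s - t)) * Vm) *
        (freeWave (ε + Complex.I * (s - t)) (x + Y) - freeWave (ε + Complex.I * (s - t)) (Y - x)
          + 2 * transmission q (ε + Complex.I * (s - t)) (Y - x) 0) := by
    intro s x hx
    have hτ : 0 < ((ε : ℂ) + Complex.I * (s - t)).re := by rwa [complexTime_re]
    rw [waveIntegral_eq_lineIntegral (a := fun p : ℝ =>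
        Complex.exp (Complex.I * (((p : ℂ) + (-1 : ℝ) * Complex.I) * Y)))
        (c := fun p : ℝ => Complex.I * (p + (-1 : ℝ) * Complex.I)) 1
        (G := fun z => Complex.exp (Complex.I * (z * (x + Y : ℝ)))) (fun p => by
        rw [← Complex.exp_add, one_mul]; congr 1; push_cast; ring),
      waveIntegral_eq_lineIntegral (a := fun p : ℝ =>
        Complex.exp (Complex.I * (((p : ℂ) + (1 : ℝ) * Complex.I) * Y)))
        (c := fun p : ℝ => -Complex.I * (p + (1 : ℝ) * Complex.I)) 1
        (G := fun z => Complex.exp (Complex.I * (z * (Y - x : ℝ)))) (fun p => by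
        rw [← Complex.exp_add, one_mul]; congr 1; push_cast; ring),
      waveIntegral_eq_lineIntegral (a := fun p : ℝ =>
        transmissionSymbol q Y 0 (p + (1 : ℝ) * Complex.I))
        (c := fun p : ℝ => -Complex.I * (p + (1 : ℝ) * Complex.I)) 1
        (G := transmissionSymbol q (Y - x) 0) (fun p => by
        rw [transmissionSymbol_mul_exp_left, one_mul]),
      lineIntegral_freeWave hτ, lineIntegral_freeWave hτ,
      lineIntegral_transmission hq hτ (by linarith) le_rfl zero_le_one]
    ring
  have vR : ∀ s x : ℝ, 0 ≤ x →
      2 * waveIntegral ε t 1 Vm (fun p : ℝ => transmissionSymbol q Y 0 (p + (1 : ℝ) * Complex.I))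
        (fun p : ℝ => Complex.I * stepMomentum q (p + (1 : ℝ) * Complex.I)) s x
      = Complex.exp (-(ε + Complex.I * (s - t)) * Vm) *
        (2 * transmission q (ε + Complex.I * (s - t)) Y x) := by
    intro s x hx
    have hτ : 0 < ((ε : ℂ) + Complex.I * (s - t)).re := by rwa [complexTime_re]
    rw [waveIntegral_eq_lineIntegral (a := fun p : ℝ =>
        transmissionSymbol q Y 0 (p + (1 : ℝ) * Complex.I))
        (c := fun p : ℝ => Complex.I * stepMomentum q (p + (1 : ℝ) * Complex.I)) 1
        (G := transmissionSymbol q Y x) (fun p => by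
        rw [transmissionSymbol_mul_exp_right, one_mul, zero_add]),
      lineIntegral_transmission hq hτ hY.le hx zero_le_one]
    ring
  -- At x = 0 the direct wave and its image cancel in value and add in slope. The values agree at
  -- once, and the slopes by the identity for (z + ℓ) times the symbol.
  refine ⟨_, _, _, _, _, _, ⟨(A1.add (A2.const_mul (-1))).add (A3.const_mul 2), B.const_mul 2,
    fun s => ?_, fun s => ?_⟩, vL, vR⟩
  · rw [vL s 0 le_rfl, vR s 0 le_rfl]
    simp
  · have hτ : 0 < ((ε : ℂ) + Complex.I * (s - t)).re := by rwa [complexTime_re]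
    have h1 := lineIntegral_transmission_slope hq hτ Y 0
    simp only [Complex.ofReal_zero, mul_zero, add_zero] at h1
    change waveIntegral ε t (-1) Vm _ _ s 0 + -1 * waveIntegral ε t 1 Vm _ _ s 0
      + 2 * waveIntegral ε t 1 Vm _ _ s 0 = 2 * waveIntegral ε t 1 Vm _ _ s 0
    rw [waveIntegral_eq_lineIntegral (a := fun p : ℝ =>
        Complex.exp (Complex.I * (((p : ℂ) + (-1 : ℝ) * Complex.I) * Y)) *
          (Complex.I * (p + (-1 : ℝ) * Complex.I)))
        (c := fun p : ℝ => Complex.I * (p + (-1 : ℝ) * Complex.I)) Complex.I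
        (G := fun z => z * Complex.exp (Complex.I * (z * Y)))
        (fun p => by simp only [Complex.ofReal_zero, zero_mul, Complex.exp_zero, mul_one]; ring),
      waveIntegral_eq_lineIntegral (a := fun p : ℝ =>
        Complex.exp (Complex.I * (((p : ℂ) + (1 : ℝ) * Complex.I) * Y)) *
          (-Complex.I * (p + (1 : ℝ) * Complex.I)))
        (c := fun p : ℝ => -Complex.I * (p + (1 : ℝ) * Complex.I)) (-Complex.I)
        (G := fun z => z * Complex.exp (Complex.I * (z * Y)))
        (fun p => by simp only [Complex.ofReal_zero, zero_mul, Complex.exp_zero, mul_one]; ring),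
      waveIntegral_eq_lineIntegral (a := fun p : ℝ =>
        transmissionSymbol q Y 0 (p + (1 : ℝ) * Complex.I) *
          (-Complex.I * (p + (1 : ℝ) * Complex.I)))
        (c := fun p : ℝ => -Complex.I * (p + (1 : ℝ) * Complex.I)) (-Complex.I)
        (G := fun z => z * transmissionSymbol q Y 0 z)
        (fun p => by simp only [Complex.ofReal_zero, zero_mul, Complex.exp_zero, mul_one]; ring),
      waveIntegral_eq_lineIntegral (a := fun p : ℝ =>
        transmissionSymbol q Y 0 (p + (1 : ℝ) * Complex.I) *
          (Complex.I * stepMomentum q (p + (1 : ℝ) * Complex.I)))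
        (c := fun p : ℝ => Complex.I * stepMomentum q (p + (1 : ℝ) * Complex.I)) Complex.I
        (G := fun z => stepMomentum q z * transmissionSymbol q Y 0 z)
        (fun p => by simp only [Complex.ofReal_zero, zero_mul, Complex.exp_zero, mul_one]; ring),
      lineIntegral_entire hτ Y (p := fun z => z) (by fun_prop) (fun z => by simp) (-1) 1, ← h1]
    ring

/-- Matched waves issued by a point source at `Y`, to the right of the step. -/
theorem exists_matchedWaves_right {Vm q Y : ℝ} (hq : 0 < q) (hY : 0 < Y) (hε : 0 < ε) (t : ℝ) :
    ∃ L L1 L2 R R1 R2, MatchedWaves Vm (Vm + q ^ 2) L L1 L2 R R1 R2 ∧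
      (∀ s x, x ≤ 0 → L s x = Complex.exp (-(ε + Complex.I * (s - t)) * Vm) *
        (2 * transmission q (ε + Complex.I * (s - t)) (-x) Y)) ∧
      (∀ s x, 0 ≤ x → R s x =
        Complex.exp (-(ε + Complex.I * (s - t)) * ((Vm + q ^ 2 : ℝ) : ℂ)) *
          (freeWave (ε + Complex.I * (s - t)) (x - Y) - freeWave (ε + Complex.I * (s - t)) (x + Y))
        + Complex.exp (-(ε + Complex.I * (s - t)) * Vm) *
          (2 * transmission q (ε + Complex.I * (s - t)) 0 (Y + x))) := by
  have hz : ∀ η : ℝ, LinBdd fun x : ℝ => (x + η * Complex.I : ℂ) := fun η =>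
    LinBdd.ofReal.add (LinBdd.const _)
  have hl := linBdd_stepMomentum hq.le zero_le_one
  have hT := expBdd_transmissionSymbol hq.le 0 Y (η := 1) zero_le_one
  have he : ∀ X : ℝ, ExpBdd fun p : ℝ =>
      Complex.exp (Complex.I * (((p : ℂ) + (1 : ℝ) * Complex.I) * X)) := fun X => by
    have := (((hz 1).const_mul X).const_mul Complex.I).exp
    simpa only [mul_comm (X : ℂ)] using this
  have hI : ∀ z : ℂ, (Complex.I * z) ^ 2 = -z ^ 2 := fun z => by
    rw [mul_pow, Complex.I_sq]; ring
  have hI' : ∀ z : ℂ, (-Complex.I * z) ^ 2 = -z ^ 2 := fun z => by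
    rw [mul_pow, neg_sq, Complex.I_sq]; ring
  have A := halfWave_waveIntegral (t := t) (η := 1) (v := Vm) (V := Vm) (σ := -1) (δ := 1) hε
    hT ((hz 1).const_mul (-Complex.I)) one_pos (fun p => by simp) (by norm_num)
    (fun p => by rw [hI']; push_cast; ring)
  -- The direct wave and its image live behind the step, so they are written in the momentum there,
  -- with energy z² + Vm + q².
  have B : ∀ X : ℝ, _ := fun X => halfWave_waveIntegral (t := t) (η := 1) (v := Vm + q ^ 2)
    (V := Vm + q ^ 2) (σ := 1) (δ := 1) hε (he X) ((hz 1).const_mul Complex.I) one_pos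
    (fun p => by simp) (by norm_num) (fun p => by rw [hI]; push_cast; ring)
  have B3 := halfWave_waveIntegral (t := t) (η := 1) (v := Vm) (V := Vm + q ^ 2) (σ := 1) (δ := 1)
    hε hT (hl.const_mul Complex.I) one_pos
    (fun p => by
      have := (stepMomentum_im_ge (q := q) (z := (p : ℂ) + (1 : ℝ) * Complex.I) (by simp)).1
      simpa using this)
    (by norm_num)
    (fun p => by rw [hI, stepMomentum_sq]; push_cast; ring)
  have vL : ∀ s x : ℝ, x ≤ 0 →
      2 * waveIntegral ε t 1 Vm (fun p : ℝ => transmissionSymbol q 0 Y (p + (1 : ℝ) * Complex.I))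
        (fun p : ℝ => -Complex.I * (p + (1 : ℝ) * Complex.I)) s x
      = Complex.exp (-(ε + Complex.I * (s - t)) * Vm) *
        (2 * transmission q (ε + Complex.I * (s - t)) (-x) Y) := by
    intro s x hx
    have hτ : 0 < ((ε : ℂ) + Complex.I * (s - t)).re := by rwa [complexTime_re]
    rw [waveIntegral_eq_lineIntegral (a := fun p : ℝ =>
        transmissionSymbol q 0 Y (p + (1 : ℝ) * Complex.I))
        (c := fun p : ℝ => -Complex.I * (p + (1 : ℝ) * Complex.I)) 1
        (G := transmissionSymbol q (-x) Y) (fun p => by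
        rw [transmissionSymbol_mul_exp_left, one_mul, zero_sub]),
      lineIntegral_transmission hq hτ (by linarith) hY.le zero_le_one]
    ring
  have vR : ∀ s x : ℝ, 0 ≤ x →
      waveIntegral ε t 1 (Vm + q ^ 2)
        (fun p : ℝ => Complex.exp (Complex.I * (((p : ℂ) + (1 : ℝ) * Complex.I) * (-Y : ℝ))))
        (fun p : ℝ => Complex.I * (p + (1 : ℝ) * Complex.I)) s x
      + -1 * waveIntegral ε t 1 (Vm + q ^ 2)
        (fun p : ℝ => Complex.exp (Complex.I * (((p : ℂ) + (1 : ℝ) * Complex.I) * Y)))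
        (fun p : ℝ => Complex.I * (p + (1 : ℝ) * Complex.I)) s x
      + 2 * waveIntegral ε t 1 Vm (fun p : ℝ => transmissionSymbol q 0 Y (p + (1 : ℝ) * Complex.I))
        (fun p : ℝ => Complex.I * stepMomentum q (p + (1 : ℝ) * Complex.I)) s x
      = Complex.exp (-(ε + Complex.I * (s - t)) * ((Vm + q ^ 2 : ℝ) : ℂ)) *
          (freeWave (ε + Complex.I * (s - t)) (x - Y) - freeWave (ε + Complex.I * (s - t)) (x + Y))
        + Complex.exp (-(ε + Complex.I * (s - t)) * Vm) *
          (2 * transmission q (ε + Complex.I * (s - t)) 0 (Y + x)) := by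
    intro s x hx
    have hτ : 0 < ((ε : ℂ) + Complex.I * (s - t)).re := by rwa [complexTime_re]
    rw [waveIntegral_eq_lineIntegral (a := fun p : ℝ =>
        Complex.exp (Complex.I * (((p : ℂ) + (1 : ℝ) * Complex.I) * (-Y : ℝ))))
        (c := fun p : ℝ => Complex.I * (p + (1 : ℝ) * Complex.I)) 1
        (G := fun z => Complex.exp (Complex.I * (z * (x - Y : ℝ)))) (fun p => by
        rw [← Complex.exp_add, one_mul]; congr 1; push_cast; ring),
      waveIntegral_eq_lineIntegral (a := fun p : ℝ =>
        Complex.exp (Complex.I * (((p : ℂ) + (1 : ℝ) * Complex.I) * Y)))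
        (c := fun p : ℝ => Complex.I * (p + (1 : ℝ) * Complex.I)) 1
        (G := fun z => Complex.exp (Complex.I * (z * (x + Y : ℝ)))) (fun p => by
        rw [← Complex.exp_add, one_mul]; congr 1; push_cast; ring),
      waveIntegral_eq_lineIntegral (a := fun p : ℝ =>
        transmissionSymbol q 0 Y (p + (1 : ℝ) * Complex.I))
        (c := fun p : ℝ => Complex.I * stepMomentum q (p + (1 : ℝ) * Complex.I)) 1
        (G := transmissionSymbol q 0 (Y + x)) (fun p => by
        rw [transmissionSymbol_mul_exp_right, one_mul]),
      lineIntegral_freeWave hτ, lineIntegral_freeWave hτ,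
      lineIntegral_transmission hq hτ le_rfl (by linarith) zero_le_one]
    ring
  refine ⟨_, _, _, _, _, _, ⟨A.const_mul 2, ((B (-Y)).add ((B Y).const_mul (-1))).add
    (B3.const_mul 2), fun s => ?_, fun s => ?_⟩, vL, vR⟩
  · have hτ : 0 < ((ε : ℂ) + Complex.I * (s - t)).re := by rwa [complexTime_re]
    rw [vL s 0 le_rfl, vR s 0 le_rfl, zero_sub, zero_add, freeWave_neg hτ]
    simp
  · have hτ : 0 < ((ε : ℂ) + Complex.I * (s - t)).re := by rwa [complexTime_re]
    have h1 := lineIntegral_transmission_slope hq hτ 0 Y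
    simp only [Complex.ofReal_zero, mul_zero, zero_add] at h1
    -- The transmitted part is parametrised by the momentum in front of the step and the direct wave
    -- by the one behind it. The slopes become comparable only after this change of variables, whose
    -- factor e^{−τq²} accounts for the energy shift.
    rw [lineIntegral_stepMomentum_exp hq hτ hY.le] at h1
    change 2 * waveIntegral ε t 1 Vm _ _ s 0 = waveIntegral ε t 1 (Vm + q ^ 2) _ _ s 0
      + -1 * waveIntegral ε t 1 (Vm + q ^ 2) _ _ s 0 + 2 * waveIntegral ε t 1 Vm _ _ s 0
    rw [waveIntegral_eq_lineIntegral (a := fun p : ℝ =>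
        Complex.exp (Complex.I * (((p : ℂ) + (1 : ℝ) * Complex.I) * (-Y : ℝ))) *
          (Complex.I * (p + (1 : ℝ) * Complex.I)))
        (c := fun p : ℝ => Complex.I * (p + (1 : ℝ) * Complex.I)) Complex.I
        (G := fun z => z * Complex.exp (Complex.I * (z * (-Y : ℝ))))
        (fun p => by simp only [Complex.ofReal_zero, zero_mul, Complex.exp_zero, mul_one]; ring),
      waveIntegral_eq_lineIntegral (a := fun p : ℝ =>
        Complex.exp (Complex.I * (((p : ℂ) + (1 : ℝ) * Complex.I) * Y)) *
          (Complex.I * (p + (1 : ℝ) * Complex.I)))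
        (c := fun p : ℝ => Complex.I * (p + (1 : ℝ) * Complex.I)) Complex.I
        (G := fun z => z * Complex.exp (Complex.I * (z * Y)))
        (fun p => by simp only [Complex.ofReal_zero, zero_mul, Complex.exp_zero, mul_one]; ring),
      waveIntegral_eq_lineIntegral (a := fun p : ℝ =>
        transmissionSymbol q 0 Y (p + (1 : ℝ) * Complex.I) *
          (-Complex.I * (p + (1 : ℝ) * Complex.I)))
        (c := fun p : ℝ => -Complex.I * (p + (1 : ℝ) * Complex.I)) (-Complex.I)
        (G := fun z => z * transmissionSymbol q 0 Y z)
        (fun p => by simp only [Complex.ofReal_zero, zero_mul, Complex.exp_zero, mul_one]; ring),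
      waveIntegral_eq_lineIntegral (a := fun p : ℝ =>
        transmissionSymbol q 0 Y (p + (1 : ℝ) * Complex.I) *
          (Complex.I * stepMomentum q (p + (1 : ℝ) * Complex.I)))
        (c := fun p : ℝ => Complex.I * stepMomentum q (p + (1 : ℝ) * Complex.I)) Complex.I
        (G := fun z => stepMomentum q z * transmissionSymbol q 0 Y z)
        (fun p => by simp only [Complex.ofReal_zero, zero_mul, Complex.exp_zero, mul_one]; ring),
      lineIntegral_mul_exp_neg hτ]
    have h2 : Complex.exp (-(ε + Complex.I * (s - t)) * ((Vm + q ^ 2 : ℝ) : ℂ))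
        = Complex.exp (-(ε + Complex.I * (s - t)) * Vm)
          * Complex.exp (-(ε + Complex.I * (s - t)) * q ^ 2) := by
      rw [← Complex.exp_add]; congr 1; push_cast; ring
    rw [h2]
    linear_combination (-2 * Complex.I * Complex.exp (-(ε + Complex.I * (s - t)) * Vm)) * h1

end Kernel

theorem norm_exp_complexTime (ε t s V : ℝ) :
    ‖Complex.exp (-((ε : ℂ) + Complex.I * (s - t)) * V)‖ = Real.exp (-ε * V) := by
  rw [Complex.norm_exp]
  congr 1
  simp

theorem MatchedWaves.continuous_glue {Vm Vp : ℝ} {L L1 L2 R R1 R2 : ℝ → ℝ → ℂ}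
    (h : MatchedWaves Vm Vp L L1 L2 R R1 R2) (s : ℝ) : Continuous (glue (L s) (R s)) :=
  continuous_iff_continuousAt.2 fun x => ((h.piecewiseTest s).d1 x).continuousAt

theorem norm_two_mul_le {a : ℂ} {A : ℝ} (h : ‖a‖ ≤ A) : ‖2 * a‖ ≤ 2 * A := by
  rw [norm_mul, Complex.norm_ofNat]; linarith

/-- A matched wave concentrating at `y` as `s` tends to `t`, with its dispersive bound. -/
theorem exists_kernel {Vm q y ε : ℝ} (hq : 0 < q) (hy : y ≠ 0) (hε : 0 < ε) (t : ℝ) :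
    ∃ G : ℝ → ℝ → ℂ, (∀ s, Continuous (G s)) ∧
      (∀ u, IsL2Solution Vm (Vm + q ^ 2) u → ∀ a b,
        ∫ x, u a x * G a x = ∫ x, u b x * G b x) ∧
      (∀ s, s ≠ t → ∀ x, ‖G s x‖ ≤ Real.exp (-ε * Vm) * (1156 / √|s - t|)) ∧
      (∀ x, ‖G t x - Complex.exp (-ε * stepPotential Vm (Vm + q ^ 2) y) * freeWave ε (x - y)‖
        ≤ Real.exp (-ε * Vm) *
          (3 * (Real.exp 1 * √(Real.pi / ε) * Real.exp (-(|x| + |y|) / √ε)))) := by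
  have hτ : ∀ s : ℝ, 0 < ((ε : ℂ) + Complex.I * (s - t)).re := fun s => by rwa [complexTime_re]
  have hεc : 0 < ((ε : ℝ) : ℂ).re := by simpa using hε
  have him : ∀ s : ℝ, s ≠ t → ((ε : ℂ) + Complex.I * (s - t)).im ≠ 0 := fun s hs => by
    rw [complexTime_im]; exact sub_ne_zero.2 hs
  have hF : ∀ s : ℝ, s ≠ t → ∀ X,
      ‖freeWave (ε + Complex.I * (s - t)) X‖ ≤ 2 / √|s - t| := fun s hs X => by
    have := norm_freeWave_le (hτ s) (him s hs) X
    rwa [complexTime_im] at this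
  have hT : ∀ s : ℝ, s ≠ t → ∀ X Y, 0 ≤ X → 0 ≤ Y →
      ‖transmission q (ε + Complex.I * (s - t)) X Y‖ ≤ 576 / √|s - t| := fun s hs X Y hX hY => by
    have := norm_transmission_le hq (hτ s) (him s hs) hX hY
    rwa [complexTime_im] at this
  have htt : (ε : ℂ) + Complex.I * (t - t) = ε := by simp
  have hexp : Real.exp (-ε * (Vm + q ^ 2)) ≤ Real.exp (-ε * Vm) :=
    Real.exp_le_exp.2 (by nlinarith [mul_pos hε (pow_pos hq 2)])
  have hn : ∀ V : ℝ, ‖Complex.exp (-(ε : ℂ) * V)‖ = Real.exp (-ε * V) := fun V => by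
    rw [Complex.norm_exp]; congr 1; simp
  rcases lt_or_gt_of_ne hy with hy | hy
  · obtain ⟨L, L1, L2, R, R1, R2, h, hL, hR⟩ :=
      exists_matchedWaves_left (Vm := Vm) hq (neg_pos.2 hy) hε t
    refine ⟨fun s => glue (L s) (R s), h.continuous_glue, fun u hu => hu.pairing_conserved h,
      fun s hs x => ?_, fun x => ?_⟩
    · rcases lt_or_ge x 0 with hx | hx
      · beta_reduce
        rw [glue_of_neg hx, hL s x hx.le, norm_mul, norm_exp_complexTime]
        refine mul_le_mul_of_nonneg_left ?_ (Real.exp_pos _).le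
        -- Two free waves and twice the transmission integral: 1156 = 2 + 2 + 2 · 576.
        refine (norm_add_le_of_le (norm_sub_le_of_le (hF s hs _) (hF s hs _))
          (norm_two_mul_le (hT s hs _ 0 (by linarith) le_rfl))).trans (le_of_eq ?_)
        ring
      · beta_reduce
        rw [glue_of_nonneg hx, hR s x hx, norm_mul, norm_exp_complexTime]
        refine mul_le_mul_of_nonneg_left ?_ (Real.exp_pos _).le
        refine (norm_two_mul_le (hT s hs _ x (by linarith) hx)).trans ?_
        rw [mul_div_assoc']
        gcongr
        norm_num
    -- At s = t the direct wave cancels on the side of the source, leaving one image and twice the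
    -- transmission integral. On the other side |x − y| = |x| + |y|, so the subtracted heat kernel
    -- is itself small. Both cases give 2 + 1 = 3.
    · rw [stepPotential, if_pos hy]
      rcases lt_or_ge x 0 with hx | hx
      · beta_reduce
        rw [glue_of_neg hx, hL t x hx.le, htt, sub_eq_add_neg x y, ← mul_sub, norm_mul, hn]
        refine mul_le_mul_of_nonneg_left ?_ (Real.exp_pos _).le
        have e : |x| + |y| = -y - x := by rw [abs_of_neg hx, abs_of_neg hy]; ring
        have h1 := norm_freeWave_real_le (X := -y - x) hε
        have h2 := norm_transmission_real_le (X := -y - x) (Y := 0) hq hε (by linarith) le_rfl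
        rw [add_zero] at h2
        have e2 : ∀ a b c : ℂ, a - b + c - a = c - b := fun a b c => by ring
        rw [e, e2]
        refine (norm_sub_le_of_le (norm_two_mul_le h2) h1).trans (le_of_eq ?_)
        ring
      · beta_reduce
        rw [glue_of_nonneg hx, hR t x hx, htt, ← mul_sub, norm_mul, hn]
        refine mul_le_mul_of_nonneg_left ?_ (Real.exp_pos _).le
        have e : |x| + |y| = -y + x := by rw [abs_of_nonneg hx, abs_of_neg hy]; ring
        have h1 := norm_freeWave_real_le (X := x - y) hε
        have h2 := norm_transmission_real_le (X := -y) (Y := x) hq hε (by linarith) hx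
        rw [sub_eq_neg_add] at h1
        rw [e, sub_eq_neg_add x]
        refine (norm_sub_le_of_le (norm_two_mul_le h2) h1).trans (le_of_eq ?_)
        ring
  · obtain ⟨L, L1, L2, R, R1, R2, h, hL, hR⟩ :=
      exists_matchedWaves_right (Vm := Vm) hq hy hε t
    refine ⟨fun s => glue (L s) (R s), h.continuous_glue, fun u hu => hu.pairing_conserved h,
      fun s hs x => ?_, fun x => ?_⟩
    · rcases lt_or_ge x 0 with hx | hx
      · beta_reduce
        rw [glue_of_neg hx, hL s x hx.le, norm_mul, norm_exp_complexTime]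
        refine mul_le_mul_of_nonneg_left ?_ (Real.exp_pos _).le
        refine (norm_two_mul_le (hT s hs (-x) y (by linarith) hy.le)).trans ?_
        rw [mul_div_assoc']
        gcongr
        norm_num
      · beta_reduce
        rw [glue_of_nonneg hx, hR s x hx]
        have h1 := norm_sub_le_of_le (hF s hs (x - y)) (hF s hs (x + y))
        have h2 := norm_two_mul_le (hT s hs 0 (y + x) le_rfl (by linarith))
        refine (norm_add_le _ _).trans ?_
        rw [norm_mul, norm_mul, norm_exp_complexTime, norm_exp_complexTime]
        refine (add_le_add (mul_le_mul hexp h1 (norm_nonneg _) (Real.exp_pos _).le)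
          (mul_le_mul_of_nonneg_left h2 (Real.exp_pos _).le)).trans (le_of_eq ?_)
        ring
    · rw [stepPotential, if_neg (not_lt.2 hy.le)]
      rcases lt_or_ge x 0 with hx | hx
      · beta_reduce
        rw [glue_of_neg hx, hL t x hx.le, htt]
        have e : |x| + |y| = -x + y := by rw [abs_of_neg hx, abs_of_pos hy]
        have h1 := norm_freeWave_real_le (X := -x + y) hε
        rw [← freeWave_neg hεc, neg_add_rev, neg_neg, neg_add_eq_sub] at h1
        have h2 := norm_two_mul_le
          (norm_transmission_real_le (X := -x) (Y := y) hq hε (by linarith) hy.le)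
        refine (norm_sub_le _ _).trans ?_
        rw [norm_mul (Complex.exp _), norm_mul (Complex.exp _), hn, hn, e]
        refine (add_le_add (mul_le_mul_of_nonneg_left h2 (Real.exp_pos _).le)
          (mul_le_mul hexp h1 (norm_nonneg _) (Real.exp_pos _).le)).trans (le_of_eq ?_)
        ring_nf
      · beta_reduce
        rw [glue_of_nonneg hx, hR t x hx, htt]
        have e : |x| + |y| = y + x := by rw [abs_of_nonneg hx, abs_of_pos hy]; ring
        have h1 := norm_freeWave_real_le (X := y + x) hε
        rw [add_comm y x] at h1
        have h2 := norm_two_mul_le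
          (norm_transmission_real_le (X := 0) (Y := y + x) hq hε le_rfl (by linarith))
        rw [zero_add] at h2
        have e2 : ∀ a b c d : ℂ, a * (b - c) + d - a * b = d - a * c := fun a b c d => by ring
        rw [e2]
        refine (norm_sub_le _ _).trans ?_
        rw [norm_mul (Complex.exp _), norm_mul (Complex.exp _), hn, hn, e]
        rw [add_comm x y] at h1 ⊢
        refine (add_le_add (mul_le_mul_of_nonneg_left h2 (Real.exp_pos _).le)
          (mul_le_mul hexp h1 (norm_nonneg _) (Real.exp_pos _).le)).trans (le_of_eq ?_)
        ring

/-! ### From the smoothed kernel to almost everywhere bounds. -/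

/-- A locally integrable function bounded by `B` against normalised bumps away from the origin is
bounded by `B` almost everywhere. -/
theorem ae_norm_le_of_forall_bump {v : ℝ → ℂ} (hv : LocallyIntegrable v volume) {B : ℝ}
    (h : ∀ φ : ℝ → ℝ, ContDiff ℝ ∞ φ → HasCompactSupport φ → (∀ x, 0 ≤ φ x) → ∫ x, φ x = 1 →
      (∃ δ > 0, ∀ x, φ x ≠ 0 → δ ≤ |x|) → ‖∫ x, v x * φ x‖ ≤ B) :
    ∀ᵐ x, ‖v x‖ ≤ B := by
  let ρ : ℕ → ContDiffBump (0 : ℝ) := fun n =>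
    ⟨(1 / 2) / ((n : ℝ) + 1), 1 / ((n : ℝ) + 1), by positivity, by
      exact div_lt_div_of_pos_right (by norm_num) (by positivity)⟩
  have hr : Tendsto (fun n => (ρ n).rOut) atTop (𝓝 0) := tendsto_one_div_add_atTop_nhds_zero_nat
  -- The two radii of the bumps stay comparable, as Lebesgue differentiation requires; they have
  -- ratio exactly 2.
  have hK : ∀ᶠ n in atTop, (ρ n).rOut ≤ 2 * (ρ n).rIn := Eventually.of_forall fun n => by
    change 1 / ((n : ℝ) + 1) ≤ 2 * ((1 / 2) / ((n : ℝ) + 1))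
    exact le_of_eq (by field_simp)
  have hne : ∀ᵐ x : ℝ, x ≠ 0 := by simp [ae_iff]
  filter_upwards [ContDiffBump.ae_convolution_tendsto_right_of_locallyIntegrable hr hK hv, hne]
    with x hx hx0
  refine le_of_tendsto hx.norm ?_
  -- Once the radius is below |x|/2, the bump centred at x avoids the ball of radius |x|/2 about the
  -- origin.
  filter_upwards [hr.eventually (gt_mem_nhds (half_pos (abs_pos.2 hx0)))] with n hn
  rw [convolution_eq_swap]
  have hb := h (fun t => (ρ n).normed volume (x - t))
    ((ρ n).contDiff_normed.comp (contDiff_const.sub contDiff_id))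
    ((ρ n).hasCompactSupport_normed.comp_homeomorph (Homeomorph.subLeft x))
    (fun t => (ρ n).nonneg_normed _)
    (by
        rw [integral_sub_left_eq_self (fun t => (ρ n).normed volume t)]
        exact (ρ n).integral_normed)
    ⟨|x| / 2, half_pos (abs_pos.2 hx0), fun t ht => by
      have h1 : x - t ∈ Function.support ((ρ n).normed volume) := ht
      rw [ContDiffBump.support_normed_eq, Metric.mem_ball, dist_zero_right, Real.norm_eq_abs] at h1
      have h2 := abs_sub_abs_le_abs_sub x t
      linarith⟩
  refine le_trans (le_of_eq ?_) hb
  congr 2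
  funext t
  simp [mul_comm]

theorem continuous_freeWave {τ : ℂ} (hτ : 0 < τ.re) : Continuous (freeWave τ) := by
  have : freeWave τ = fun X : ℝ =>
      (Real.pi / τ) ^ (1 / 2 : ℂ) * Complex.exp (-(X : ℂ) ^ 2 / (4 * τ)) :=
    funext fun X => freeWave_eq hτ X
  rw [this]
  fun_prop

theorem norm_freeWave_real_le_abs {ε : ℝ} (hε : 0 < ε) (X : ℝ) :
    ‖freeWave ε X‖ ≤ Real.exp 1 * √(Real.pi / ε) * Real.exp (-|X| / √ε) := by
  rcases abs_cases X with ⟨h, -⟩ | ⟨h, -⟩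
  · rw [h]; exact norm_freeWave_real_le hε
  · rw [h, ← freeWave_neg (by simpa using hε)]; exact norm_freeWave_real_le hε

theorem neg_div_sqrt_le {ε a : ℝ} (hε : 0 < ε) (hε1 : ε ≤ 1) (ha : 0 ≤ a) : -a / √ε ≤ -a := by
  rw [div_le_iff₀ (Real.sqrt_pos.2 hε)]
  have : √ε ≤ 1 := Real.sqrt_le_one.2 hε1
  nlinarith

theorem norm_freeWave_sub_le {ε : ℝ} (hε : 0 < ε) (hε1 : ε ≤ 1) (x y : ℝ) :
    ‖freeWave ε (x - y)‖
      ≤ Real.exp 1 * √(Real.pi / ε) * Real.exp |y| * Real.exp (-1 * |x|) := by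
  refine (norm_freeWave_real_le_abs hε _).trans ?_
  rw [mul_assoc _ (Real.exp |y|), ← Real.exp_add]
  refine mul_le_mul_of_nonneg_left (Real.exp_le_exp.2 ?_) (by positivity)
  have h1 := neg_div_sqrt_le hε hε1 (abs_nonneg (x - y))
  have h2 := abs_sub_abs_le_abs_sub x y
  linarith

/-- The smoothed solution at `y`, with an error vanishing with `ε`. -/
theorem IsL2Solution.norm_integral_freeWave_le {Vm q t : ℝ}
    {u : ℝ → Lp ℂ 2 (volume : Measure ℝ)} (hq : 0 < q) (hu : IsL2Solution Vm (Vm + q ^ 2) u)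
    (h0 : Integrable (u 0)) (ht : t ≠ 0) :
    ∃ N : ℝ, ∀ ε δ y : ℝ, 0 < ε → ε ≤ 1 → 0 < δ → δ ≤ |y| →
      ‖∫ x, u t x * freeWave ε (x - y)‖ ≤ Real.exp (ε * q ^ 2) *
        (1156 / √|t| * (∫ x, ‖u 0 x‖) + N * (√(Real.pi / ε) * Real.exp (-δ / √ε))) := by
  -- N is independent of ε, δ and y: it is the constant of the kernel error times the L² norms of
  -- e^{−|x|} and of u(t).
  refine ⟨3 * Real.exp 1 * ((eLpNorm (fun x : ℝ => 1 * Real.exp (-1 * |x|)) 2 volume).toReal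
    * ‖u t‖), fun ε δ y hε hε1 hδ hy => ?_⟩
  have hεc : 0 < ((ε : ℝ) : ℂ).re := by simpa using hε
  obtain ⟨G, hGc, hGu, hGb, hGt⟩ := exists_kernel (Vm := Vm) hq
    (abs_pos.1 (hδ.trans_le hy)) hε t
  have hfwc : Continuous fun x => freeWave ε (x - y) :=
    (continuous_freeWave hεc).comp (continuous_id.sub continuous_const)
  have hfw : MemLp (fun x => freeWave ε (x - y)) 2 volume :=
    memLp_of_exp_bound hfwc.aestronglyMeasurable one_pos fun x => norm_freeWave_sub_le hε hε1 x y
  set E : ℂ := Complex.exp (-ε * stepPotential Vm (Vm + q ^ 2) y) with hE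
  set D : ℝ → ℂ := fun x => G t x - E * freeWave ε (x - y) with hD
  -- Since ε ≤ 1 and |y| ≥ δ, the kernel error is at most K e^{−|x|}. Dividing by K leaves a fixed
  -- L² majorant.
  set K : ℝ := Real.exp (-ε * Vm) * (3 * Real.exp 1 * (√(Real.pi / ε) * Real.exp (-δ / √ε)))
    with hK
  have hDm : AEStronglyMeasurable D volume :=
    ((hGc t).sub (continuous_const.mul hfwc)).aestronglyMeasurable
  have hDb : ∀ x, ‖((K : ℂ))⁻¹ * D x‖ ≤ 1 * Real.exp (-1 * |x|) := by
    intro x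
    have hKpos : 0 < K := by
      have : 0 < √(Real.pi / ε) := Real.sqrt_pos.2 (div_pos Real.pi_pos hε)
      positivity
    rw [norm_mul, norm_inv, Complex.norm_real, Real.norm_of_nonneg hKpos.le, one_mul,
      inv_mul_le_iff₀ hKpos]
    refine (hGt x).trans ?_
    have h1 : Real.exp (-(|x| + |y|) / √ε) ≤ Real.exp (-δ / √ε) * Real.exp (-1 * |x|) := by
      rw [← Real.exp_add, Real.exp_le_exp]
      have h2 := neg_div_sqrt_le hε hε1 (abs_nonneg x)
      have h3 : -|y| / √ε ≤ -δ / √ε := by gcongr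
      have h4 : -(|x| + |y|) / √ε = -|x| / √ε + -|y| / √ε := by ring
      linarith
    calc _ ≤ Real.exp (-ε * Vm) * (3 * (Real.exp 1 * √(Real.pi / ε) *
          (Real.exp (-δ / √ε) * Real.exp (-1 * |x|)))) := by gcongr
      _ = K * Real.exp (-1 * |x|) := by rw [hK]; ring
  have hKne : (K : ℂ) ≠ 0 := by
    have : 0 < √(Real.pi / ε) := Real.sqrt_pos.2 (div_pos Real.pi_pos hε)
    have : 0 < K := by positivity
    exact_mod_cast this.ne'
  have hDL : MemLp (fun x => (K : ℂ)⁻¹ * D x) 2 volume :=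
    memLp_of_exp_bound (hDm.const_mul _) one_pos hDb
  have hDpair : ∫ x, u t x * D x = K * ∫ x, u t x * ((K : ℂ)⁻¹ * D x) := by
    rw [← integral_const_mul]
    congr 1; funext x; field_simp
  have hDint : Integrable fun x => u t x * D x := by
    refine ((integrable_pairing hDL (u t)).const_mul (K : ℂ)).congr
      (Eventually.of_forall fun x => ?_)
    simp only
    field_simp
  have hDn := norm_pairing_le (hDm.const_mul _) (memLp_exp_neg_mul_abs one_pos 1) hDb (u t)
  have hsplit : ∫ x, u t x * G t x = E * (∫ x, u t x * freeWave ε (x - y)) + ∫ x, u t x * D x := by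
    rw [← integral_const_mul, ← integral_add ((integrable_pairing hfw (u t)).const_mul E) hDint]
    congr 1; funext x; simp only [hD]; ring
  have hG0 : ‖∫ x, u 0 x * G 0 x‖ ≤ Real.exp (-ε * Vm) * (1156 / √|t| * ∫ x, ‖u 0 x‖) := by
    rw [← mul_assoc, ← integral_const_mul]
    refine norm_integral_le_of_norm_le (h0.norm.const_mul _) (Eventually.of_forall fun x => ?_)
    have := hGb 0 ht.symm x
    rw [zero_sub, abs_neg] at this
    rw [norm_mul, mul_comm]
    exact mul_le_mul_of_nonneg_right this (norm_nonneg _)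
  have hEn : Real.exp (-ε * (Vm + q ^ 2)) ≤ ‖E‖ := by
    rw [hE, Complex.norm_exp, Real.exp_le_exp]
    have e : (-(ε : ℂ) * stepPotential Vm (Vm + q ^ 2) y).re
        = -ε * stepPotential Vm (Vm + q ^ 2) y := by simp
    rw [e]
    have : stepPotential Vm (Vm + q ^ 2) y ≤ Vm + q ^ 2 := by
      unfold stepPotential
      split_ifs
      · nlinarith
      · exact le_rfl
    nlinarith
  have hKn : ‖(K : ℂ)‖ = K := by
    rw [Complex.norm_real, Real.norm_of_nonneg (by positivity)]
  have hmain : Real.exp (-ε * (Vm + q ^ 2)) * ‖∫ x, u t x * freeWave ε (x - y)‖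
      ≤ Real.exp (-ε * Vm) * (1156 / √|t| * ∫ x, ‖u 0 x‖)
        + K * ((eLpNorm (fun x : ℝ => 1 * Real.exp (-1 * |x|)) 2 volume).toReal * ‖u t‖) := by
    have e : E * (∫ x, u t x * freeWave ε (x - y))
        = (∫ x, u 0 x * G 0 x) - ∫ x, u t x * D x := by
      rw [hGu u hu 0 t, hsplit]; ring
    refine (mul_le_mul_of_nonneg_right hEn (norm_nonneg _)).trans ?_
    rw [← norm_mul, e]
    refine (norm_sub_le _ _).trans (add_le_add hG0 ?_)
    rw [hDpair, norm_mul, hKn]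
    exact mul_le_mul_of_nonneg_left hDn (by positivity)
  have hmul := mul_le_mul_of_nonneg_left hmain (Real.exp_pos (ε * (Vm + q ^ 2))).le
  rw [← mul_assoc, ← Real.exp_add] at hmul
  have e0 : ε * (Vm + q ^ 2) + -ε * (Vm + q ^ 2) = 0 := by ring
  rw [e0, Real.exp_zero, one_mul] at hmul
  refine hmul.trans (le_of_eq ?_)
  -- The damping factors of the two sides differ by e^{εq²}, which tends to 1. This keeps the final
  -- constant independent of the potential.
  have e1 : Real.exp (ε * (Vm + q ^ 2)) * Real.exp (-ε * Vm) = Real.exp (ε * q ^ 2) := by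
    rw [← Real.exp_add]; congr 1; ring
  rw [← e1, hK]
  ring

theorem tendsto_sqrt_pi_div_mul_exp {δ : ℝ} (hδ : 0 < δ) :
    Tendsto (fun ε : ℝ => √(Real.pi / ε) * Real.exp (-δ / √ε)) (𝓝[>] 0) (𝓝 0) := by
  have h1 : Tendsto (fun ε : ℝ => √(ε⁻¹)) (𝓝[>] 0) atTop :=
    Real.tendsto_sqrt_atTop.comp tendsto_inv_nhdsGT_zero
  have h2 := ((tendsto_rpow_mul_exp_neg_mul_atTop_nhds_zero 1 δ hδ).comp h1).const_mul √Real.pi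
  rw [mul_zero] at h2
  refine h2.congr fun ε => ?_
  simp only [Function.comp_apply, Real.rpow_one]
  rw [div_eq_mul_inv Real.pi, Real.sqrt_mul Real.pi_pos.le, Real.sqrt_inv, div_eq_mul_inv]
  ring

/-- This is 2π times a unit-mass Gaussian, in the normalisation of
`Real.tendsto_integral_gaussian_smul'` with parameter 1/(4π²ε); small ε corresponds to a large
parameter. -/
theorem freeWave_eq_heat {ε : ℝ} (hε : 0 < ε) (X : ℝ) :
    freeWave ε X = 2 * Real.pi * (((Real.pi * ((4 * Real.pi ^ 2 * ε)⁻¹ : ℝ) : ℂ)) ^ (1 / 2 : ℂ) *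
      Complex.exp (-Real.pi ^ 2 * ((4 * Real.pi ^ 2 * ε)⁻¹ : ℝ) * (‖X‖ : ℂ) ^ 2)) := by
  rw [freeWave_eq (by simpa using hε)]
  have hpi := Real.pi_pos
  have e1 : ((Real.pi : ℂ) / ε) ^ (1 / 2 : ℂ) = 2 * Real.pi *
      ((Real.pi * ((4 * Real.pi ^ 2 * ε)⁻¹ : ℝ) : ℂ)) ^ (1 / 2 : ℂ) := by
    have a1 : ((Real.pi : ℂ) / ε) = ((Real.pi / ε : ℝ) : ℂ) := by push_cast; rfl
    have a2 : ((Real.pi : ℂ) * ((4 * Real.pi ^ 2 * ε)⁻¹ : ℝ))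
        = ((Real.pi * (4 * Real.pi ^ 2 * ε)⁻¹ : ℝ) : ℂ) := by push_cast; rfl
    have a3 : (1 / 2 : ℂ) = ((1 / 2 : ℝ) : ℂ) := by push_cast; rfl
    rw [a1, a2, a3, ← Complex.ofReal_cpow (by positivity), ← Complex.ofReal_cpow (by positivity),
      ← Real.sqrt_eq_rpow, ← Real.sqrt_eq_rpow]
    have a4 : Real.pi / ε = (2 * Real.pi) ^ 2 * (Real.pi * (4 * Real.pi ^ 2 * ε)⁻¹) := by
      field_simp; ring
    rw [a4, Real.sqrt_mul (by positivity), Real.sqrt_sq (by positivity)]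
    push_cast
    rfl
  rw [e1, mul_assoc]
  congr 3
  rw [← Complex.ofReal_pow ‖X‖, Real.norm_eq_abs, sq_abs]
  have : (Real.pi : ℂ) ≠ 0 := by exact_mod_cast hpi.ne'
  have : (ε : ℂ) ≠ 0 := by exact_mod_cast hε.ne'
  push_cast
  field_simp

theorem tendsto_integral_freeWave {φ : ℝ → ℝ} (hφ : Continuous φ) (hφi : Integrable φ) (x : ℝ) :
    Tendsto (fun ε : ℝ => ∫ y, (φ y : ℂ) * freeWave ε (x - y)) (𝓝[>] 0)
      (𝓝 (2 * Real.pi * φ x)) := by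
  have h1 := Real.tendsto_integral_gaussian_smul' (f := fun y => (φ y : ℂ)) (hφi.ofReal)
    (v := x) (Complex.continuous_ofReal.comp hφ).continuousAt
  have h2 : Tendsto (fun ε : ℝ => (4 * Real.pi ^ 2 * ε)⁻¹) (𝓝[>] 0) atTop := by
    have : Tendsto (fun ε : ℝ => (4 * Real.pi ^ 2)⁻¹ * ε⁻¹) (𝓝[>] 0) atTop :=
      tendsto_inv_nhdsGT_zero.const_mul_atTop (by positivity)
    exact this.congr fun ε => by rw [mul_inv (4 * Real.pi ^ 2)]
  refine ((h1.comp h2).const_mul (2 * Real.pi : ℂ)).congr' ?_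
  filter_upwards [self_mem_nhdsWithin] with ε hε
  simp only [Function.comp_apply]
  rw [← integral_const_mul]
  congr 1
  funext y
  rw [freeWave_eq_heat hε, smul_eq_mul, Module.finrank_self]
  push_cast
  ring

theorem integral_exp_neg_abs_sub_div {a : ℝ} (ha : 0 < a) (x : ℝ) :
    ∫ y, Real.exp (-|x - y| / a) = a * ∫ y, Real.exp (-1 * |y|) := by
  rw [integral_sub_left_eq_self (fun y => Real.exp (-|y| / a)) volume x]
  have h := Measure.integral_comp_div (fun y : ℝ => Real.exp (-1 * |y|)) a
  rw [abs_of_pos ha, smul_eq_mul] at h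
  rw [← h]
  congr 1; funext y
  rw [abs_div, abs_of_pos ha]
  congr 1
  ring

/-- Half of the decay rate 1/√ε is spent on transferring e^{−|y|} to e^{−|x|}, which requires 2√ε ≤
1. The other half is integrated and contributes the √ε that cancels the height of the heat kernel,
so the majorant is uniform in ε. -/
theorem norm_integral_mul_freeWave_le {φ : ℝ → ℝ} {M ε : ℝ}
    (hM : ∀ y, |φ y| ≤ M * Real.exp (-1 * |y|)) (hε : 0 < ε) (hε4 : ε ≤ 1 / 4) (x : ℝ) :
    ‖∫ y, (φ y : ℂ) * freeWave ε (x - y)‖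
      ≤ (M * Real.exp 1 * √Real.pi * 2 * ∫ y, Real.exp (-1 * |y|)) * Real.exp (-1 * |x|) := by
  have hr : 0 < √ε := Real.sqrt_pos.2 hε
  have hM0 : 0 ≤ M := by
    have := (abs_nonneg _).trans (hM 0)
    simpa using this
  have hr2 : 2 * √ε ≤ 1 := by
    have : √ε ≤ √(1 / 4) := Real.sqrt_le_sqrt hε4
    have h4 : √(1 / 4 : ℝ) = 1 / 2 := by
      rw [show (1 / 4 : ℝ) = (1 / 2) ^ 2 by norm_num, Real.sqrt_sq (by norm_num)]
    linarith
  have hi : Integrable fun y => Real.exp (-|x - y| / (2 * √ε)) := by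
    have h1 := (integrable_exp_neg_mul_abs (δ := (2 * √ε)⁻¹) (by positivity)).comp_sub_left x
    refine h1.congr (Eventually.of_forall fun y => ?_)
    simp only
    congr 1
    ring
  have key : ∀ y, ‖(φ y : ℂ) * freeWave ε (x - y)‖
      ≤ (M * Real.exp 1 * √(Real.pi / ε) * Real.exp (-1 * |x|))
        * Real.exp (-|x - y| / (2 * √ε)) := by
    intro y
    rw [norm_mul, Complex.norm_real, Real.norm_eq_abs]
    refine (mul_le_mul (hM y) (norm_freeWave_real_le_abs hε _) (norm_nonneg _)
      (by positivity)).trans ?_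
    have h1 : Real.exp (-1 * |y|) * Real.exp (-|x - y| / √ε)
        ≤ Real.exp (-1 * |x|) * Real.exp (-|x - y| / (2 * √ε)) := by
      rw [← Real.exp_add, ← Real.exp_add, Real.exp_le_exp]
      have h2 := abs_sub_abs_le_abs_sub x y
      have h3 : -|x - y| / √ε = 2 * (-|x - y| / (2 * √ε)) := by field_simp
      have h4 : -|x - y| / (2 * √ε) ≤ -|x - y| := by
        rw [div_le_iff₀ (by positivity)]
        nlinarith [abs_nonneg (x - y)]
      linarith
    calc _ = M * Real.exp 1 * √(Real.pi / ε) *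
          (Real.exp (-1 * |y|) * Real.exp (-|x - y| / √ε)) := by ring
      _ ≤ M * Real.exp 1 * √(Real.pi / ε) *
          (Real.exp (-1 * |x|) * Real.exp (-|x - y| / (2 * √ε))) := by gcongr
      _ = _ := by ring
  refine (norm_integral_le_of_norm_le (hi.const_mul _) (Eventually.of_forall key)).trans
    (le_of_eq ?_)
  rw [integral_const_mul, integral_exp_neg_abs_sub_div (by positivity),
    Real.sqrt_div Real.pi_pos.le]
  field_simp

theorem HasCompactSupport.exists_exp_bound {φ : ℝ → ℝ} (hc : Continuous φ)
    (hs : HasCompactSupport φ) (a : ℝ) : ∃ M, ∀ y, |φ y| ≤ M * Real.exp (-a * |y|) := by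
  obtain ⟨M, hM⟩ := (hs.mul_right (f' := fun y => Real.exp (a * |y|))).exists_bound_of_continuous
    (hc.mul (by fun_prop))
  refine ⟨M, fun y => ?_⟩
  have := hM y
  rw [Pi.mul_apply, norm_mul, Real.norm_eq_abs, Real.norm_of_nonneg (Real.exp_pos _).le] at this
  rw [neg_mul, Real.exp_neg, ← div_eq_mul_inv, le_div_iff₀ (Real.exp_pos _)]
  exact this

theorem integral_freeWave_swap {φ : ℝ → ℝ} (hc : Continuous φ) (hs : HasCompactSupport φ)
    (v : Lp ℂ 2 (volume : Measure ℝ)) {ε : ℝ} (hε : 0 < ε) (hε1 : ε ≤ 1) :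
    ∫ x, v x * ∫ y, (φ y : ℂ) * freeWave ε (x - y)
      = ∫ y, (φ y : ℂ) * ∫ x, v x * freeWave ε (x - y) := by
  have hεc : 0 < ((ε : ℝ) : ℂ).re := by simpa using hε
  -- Rate 2 is taken because the bound for the translated heat kernel grows like e^{|y|}; rate 1
  -- then remains for integrability in y.
  obtain ⟨M, hM⟩ := HasCompactSupport.exists_exp_bound hc hs 2
  simp_rw [← integral_const_mul]
  have hfw := continuous_freeWave hεc
  have hexp1 : MemLp (fun x : ℝ => ((Real.exp (-1 * |x|) : ℝ) : ℂ)) 2 volume :=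
    memLp_of_exp_bound (C := 1) (δ := 1) (by fun_prop) one_pos fun x => by
      rw [Complex.norm_real, Real.norm_of_nonneg (Real.exp_pos _).le, one_mul]
  have hdom := (integrable_pairing hexp1 v).norm.mul_prod
    ((integrable_exp_neg_mul_abs one_pos).const_mul (Real.exp 1 * √(Real.pi / ε) * M))
  rw [integral_integral_swap]
  · congr 1; funext y; congr 1; funext x; ring
  · refine hdom.mono' ?_ (Eventually.of_forall fun p => ?_)
    · refine (Lp.aestronglyMeasurable v).comp_fst.mul ?_
      refine Continuous.aestronglyMeasurable ?_
      exact (Complex.continuous_ofReal.comp (hc.comp continuous_snd)).mul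
        (hfw.comp (continuous_fst.sub continuous_snd))
    · simp only [Function.uncurry]
      rw [norm_mul, norm_mul, norm_mul, Complex.norm_real, Complex.norm_real, Real.norm_eq_abs,
        Real.norm_of_nonneg (Real.exp_pos _).le, mul_assoc]
      refine mul_le_mul_of_nonneg_left ?_ (norm_nonneg _)
      refine (mul_le_mul (hM p.2) (norm_freeWave_sub_le hε hε1 p.1 p.2) (norm_nonneg _)
        ((abs_nonneg _).trans (hM p.2))).trans (le_of_eq ?_)
      have : Real.exp (-2 * |p.2|) * Real.exp |p.2| = Real.exp (-1 * |p.2|) := by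
        rw [← Real.exp_add]; congr 1; ring
      rw [← this]
      ring

/-- The dispersive estimate tested against a normalised bump away from the origin. -/
theorem IsL2Solution.norm_integral_bump_le {Vm Vp t : ℝ} {u : ℝ → Lp ℂ 2 (volume : Measure ℝ)}
    (hV : Vm < Vp) (hu : IsL2Solution Vm Vp u) (h0 : Integrable (u 0)) (ht : t ≠ 0) {φ : ℝ → ℝ}
    (hc : Continuous φ) (hs : HasCompactSupport φ) (hφ0 : ∀ x, 0 ≤ φ x) (hφ1 : ∫ x, φ x = 1)
    {δ : ℝ} (hδ : 0 < δ) (hφδ : ∀ x, φ x ≠ 0 → δ ≤ |x|) :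
    ‖∫ x, u t x * φ x‖ ≤ 1156 / √|t| * ∫ x, ‖u 0 x‖ := by
  have hq : 0 < √(Vp - Vm) := Real.sqrt_pos.2 (sub_pos.2 hV)
  have hVp : Vp = Vm + √(Vp - Vm) ^ 2 := by
    rw [Real.sq_sqrt (sub_pos.2 hV).le]; ring
  set q := √(Vp - Vm)
  rw [hVp] at hu
  obtain ⟨N, hN⟩ := hu.norm_integral_freeWave_le hq h0 ht
  obtain ⟨M, hM⟩ := HasCompactSupport.exists_exp_bound hc hs 1
  have hφi : Integrable φ := hc.integrable_of_hasCompactSupport hs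
  have hsmall : ∀ᶠ ε : ℝ in 𝓝[>] 0, 0 < ε ∧ ε ≤ 1 / 4 := by
    filter_upwards [Ioc_mem_nhdsGT (show (0 : ℝ) < 1 / 4 by norm_num)] with ε hε using hε
  have hlim : Tendsto (fun ε : ℝ => ∫ x, u t x * ∫ y, (φ y : ℂ) * freeWave ε (x - y)) (𝓝[>] 0)
      (𝓝 (∫ x, u t x * (2 * Real.pi * φ x))) := by
    refine tendsto_integral_filter_of_dominated_convergence
      (fun x => ‖u t x‖ * ((M * Real.exp 1 * √Real.pi * 2 * ∫ y, Real.exp (-1 * |y|)) *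
        Real.exp (-1 * |x|))) ?_ ?_
      ((Lp.memLp (u t)).norm.integrable_mul (memLp_exp_neg_mul_abs one_pos _))
      (Eventually.of_forall fun x => (tendsto_integral_freeWave hc hφi x).const_mul _)
    · filter_upwards [hsmall] with ε hε
      refine (Lp.aestronglyMeasurable (u t)).mul ?_
      have hεc : 0 < ((ε : ℝ) : ℂ).re := by simpa using hε.1
      have : Continuous fun p : ℝ × ℝ => (φ p.2 : ℂ) * freeWave ε (p.1 - p.2) :=
        (Complex.continuous_ofReal.comp (hc.comp continuous_snd)).mul
          ((continuous_freeWave hεc).comp (continuous_fst.sub continuous_snd))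
      exact this.stronglyMeasurable.integral_prod_right'.aestronglyMeasurable
    · filter_upwards [hsmall] with ε hε
      refine Eventually.of_forall fun x => ?_
      rw [norm_mul]
      exact mul_le_mul_of_nonneg_left (norm_integral_mul_freeWave_le hM hε.1 hε.2 x)
        (norm_nonneg _)
  -- After Fubini the pointwise bound for the smoothed solution is averaged over y. It applies
  -- because φ vanishes for |y| < δ, and it is preserved because φ is nonnegative of mass 1.
  have hbound : ∀ᶠ ε : ℝ in 𝓝[>] 0, ‖∫ x, u t x * ∫ y, (φ y : ℂ) * freeWave ε (x - y)‖
      ≤ Real.exp (ε * q ^ 2) * (1156 / √|t| * (∫ x, ‖u 0 x‖)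
        + N * (√(Real.pi / ε) * Real.exp (-δ / √ε))) := by
    filter_upwards [hsmall] with ε hε
    have hε1 : ε ≤ 1 := hε.2.trans (by norm_num)
    rw [integral_freeWave_swap hc hs (u t) hε.1 hε1]
    set B := Real.exp (ε * q ^ 2) * (1156 / √|t| * (∫ x, ‖u 0 x‖)
        + N * (√(Real.pi / ε) * Real.exp (-δ / √ε)))
    refine (norm_integral_le_of_norm_le (hφi.mul_const B) (Eventually.of_forall fun y => ?_)).trans
      (le_of_eq (by rw [integral_mul_const, hφ1, one_mul]))
    rw [norm_mul, Complex.norm_real, Real.norm_of_nonneg (hφ0 y)]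
    by_cases hy : φ y = 0
    · simp [hy]
    · exact mul_le_mul_of_nonneg_left (hN ε δ y hε.1 hε1 hδ (hφδ y hy)) (hφ0 y)
  have hrhs : Tendsto (fun ε : ℝ => Real.exp (ε * q ^ 2) * (1156 / √|t| * (∫ x, ‖u 0 x‖)
        + N * (√(Real.pi / ε) * Real.exp (-δ / √ε)))) (𝓝[>] 0)
      (𝓝 (1156 / √|t| * ∫ x, ‖u 0 x‖)) := by
    have h1 : Tendsto (fun ε : ℝ => Real.exp (ε * q ^ 2)) (𝓝[>] 0) (𝓝 1) := by
      have : Continuous fun ε : ℝ => Real.exp (ε * q ^ 2) := by fun_prop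
      have h := this.tendsto 0
      rw [zero_mul, Real.exp_zero] at h
      exact h.mono_left nhdsWithin_le_nhds
    have h2 := h1.mul (((tendsto_sqrt_pi_div_mul_exp hδ).const_mul N).const_add
      (1156 / √|t| * ∫ x, ‖u 0 x‖))
    simpa using h2
  have h := le_of_tendsto_of_tendsto hlim.norm hrhs hbound
  refine le_trans ?_ h
  have e : ∫ x, u t x * (2 * Real.pi * φ x) = (2 * Real.pi : ℂ) * ∫ x, u t x * φ x := by
    rw [← integral_const_mul]
    congr 1; funext x; ring
  rw [e, norm_mul]
  -- The heat kernel has mass 2π; this factor is discarded instead of being used to improve the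
  -- constant.
  have h2 : (1 : ℝ) ≤ ‖(2 * Real.pi : ℂ)‖ := by
    rw [norm_mul, Complex.norm_real, Complex.norm_ofNat, Real.norm_of_nonneg Real.pi_pos.le]
    linarith [Real.pi_gt_three]
  exact le_mul_of_one_le_left (norm_nonneg _) h2

theorem mainTheorem2 :
    ∃ C : ℝ, 0 < C ∧ ∀ Vm Vp : ℝ, Vm < Vp → ∀ f : ℝ → ℂ, Integrable f volume →
      (∀ u : ℝ → Lp ℂ 2 (volume : Measure ℝ), IsL2Solution Vm Vp u →
        (u 0 : ℝ → ℂ) =ᵐ[volume] f →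
        ∀ t : ℝ, t ≠ 0 → ∀ᵐ x ∂(volume : Measure ℝ),
          ‖u t x‖ ≤ C * (∫ y : ℝ, ‖f y‖) * |t| ^ (-(1 / 2 : ℝ))) ∧
      (∀ u : ℝ → ℝ → ℂ, IsL1Solution Vm Vp f u →
        ∀ t : ℝ, t ≠ 0 → ∀ᵐ x ∂(volume : Measure ℝ),
          ‖u t x‖ ≤ C * (∫ y : ℝ, ‖f y‖) * |t| ^ (-(1 / 2 : ℝ))) := by
  refine ⟨1156, by norm_num, fun Vm Vp hV f hf => ?_⟩
  have hrpow : ∀ t I : ℝ, 1156 * I * |t| ^ (-(1 / 2 : ℝ)) = 1156 / √|t| * I := fun t I => by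
    rw [Real.rpow_neg (abs_nonneg t), ← Real.sqrt_eq_rpow]; ring
  refine ⟨fun u hu h0 t ht => ?_, fun u hu t ht => ?_⟩
  · rw [hrpow]
    have hi : Integrable (u 0) := hf.congr h0.symm
    have hI : ∫ y, ‖f y‖ = ∫ y, ‖u 0 y‖ := by
      refine integral_congr_ae ?_
      filter_upwards [h0] with x hx
      rw [hx]
    rw [hI]
    refine ae_norm_le_of_forall_bump ((Lp.memLp (u t)).locallyIntegrable one_le_two) ?_
    rintro φ hφ hs hφ0 hφ1 ⟨δ, hδ, hφδ⟩
    exact hu.norm_integral_bump_le hV hi ht hφ.continuous hs hφ0 hφ1 hδ hφδ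
  · rw [hrpow]
    obtain ⟨w, hw, hwi, hw0, hwt⟩ := hu.approximation
    refine ae_norm_le_of_forall_bump (hu.locallyIntegrable t) ?_
    rintro φ hφ hs hφ0 hφ1 ⟨δ, hδ, hφδ⟩
    have htest : IsTestFunction fun x => (φ x : ℂ) :=
      ⟨Complex.ofRealCLM.contDiff.comp hφ, hs.comp_left Complex.ofReal_zero⟩
    have hlim : Tendsto (fun n => ∫ x, ‖w n 0 x‖) atTop (𝓝 (∫ x, ‖f x‖)) := by
      rw [tendsto_iff_norm_sub_tendsto_zero]
      refine squeeze_zero (fun _ => norm_nonneg _) (fun n => ?_) hw0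
      rw [← integral_sub (hwi n).norm hf.norm]
      refine norm_integral_le_of_norm_le ((hwi n).sub hf).norm (Eventually.of_forall fun x => ?_)
      exact abs_norm_sub_norm_le _ _
    -- Distributional convergence carries no pointwise information, so the limit is taken in the
    -- tested inequality, before Lebesgue differentiation.
    refine le_of_tendsto_of_tendsto (hwt t _ htest).norm (hlim.const_mul _)
      (Eventually.of_forall fun n => ?_)
    exact (hw n).norm_integral_bump_le hV (hwi n) ht hφ.continuous hs hφ0 hφ1 hδ hφδ
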